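/- Write $\lg=\log_2$. An arithmetic pointer machine has a memory consisting of nodes with a constant number of one-word fields, and a constant number of one-word registers. A word holds $\mathrm{nil}$, a pointer to a node, a nonnegative integer of $O(\lg n)$ bits (at most $n^{w}$ for a constant $w$), or a real coordinate. Each of the following takes one step: copying a word, following a pointer to read or write a field, creating a node, $+,-,\times,\div$ on integers (with $-$ truncated at $0$ and $\div$ rounded down), and comparing two integers or two coordinates, or testing two words for equality. There is no arithmetic on pointers. The space of a structure is the number of words in its nodes. In this model there is a data structure for two-dimensional colored orthogonal range counting with the following bounds, with constants in the $O$-notation, number of fields, exponent $w$ and query program independent of $n$, $X$ and the input. Given $n\ge 2$ points in $\mathbb{R}^2$, each assigned a color, and an integer parameter $X\in[1,n]$, the structure occupies $$O\Bigl(\bigl(\tfrac{n}{X}\bigr)^2\lg^4 n+n\lg^3 n\Bigr)$$ words, including the working space of a query, and for every query rectangle $[a,b]\times[c,d]$ with $a,b,c,d\in\mathbb{R}$ the number of distinct colors of the points in $[a,b]\times[c,d]$ is computed in $$O\bigl(\lg^5 n+X\lg^3 n\bigr)$$ steps; the query leaves the structure unchanged. In particular, $X=\lceil\sqrt{n\lg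 n}\,\rceil$ lies in $[1,n]$, and with this choice the structure occupies $O(n\lg^3 n)$ words and answers a query in $O(\sqrt{n}\,\lg^{7/2}n)$ steps. -/

import Mathlib

/-!
An arithmetic pointer machine, as a structured programming language with a step count.

The memory is a collection of nodes, each with a fixed number `K` of fields; a field or a register
holds one word.  A word is `nil`, a pointer to a node, an integer of at most the size `W` that the
word length admits, or a coordinate of the geometric input.  Nodes can only be reached by following
pointers: there is no arithmetic on pointers (they are only copied, followed and tested for equality).
Integers may be compared, added, subtracted, multiplied and divided.  Coordinates are real numbers
that may only be copied and compared.
-/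

namespace PointerMachine

/-- The content of one word. -/
inductive Word where
  | nil : Word
  | ptr (a : ℕ) : Word
  | int (k : ℕ) : Word
  | coord (r : ℝ) : Word

/-- A configuration: registers (numbered, of which a program mentions only finitely many),
and nodes at the addresses `0, …, size - 1`.  The values of `heap` at other addresses are
inaccessible. -/
structure State (K : ℕ) where
  reg : ℕ → Word
  heap : ℕ → Fin K → Word
  size : ℕ

/-- `σ.setReg x v` writes the word `v` into register `x`. -/
def State.setReg {K : ℕ} (σ : State K) (x : ℕ) (v : Word) : State K :=
  { σ with reg := Function.update σ.reg x v }

/-- The arithmetic operations on integer words. -/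
inductive ArithOp where
  | add : ArithOp
  | sub : ArithOp
  | mul : ArithOp
  | div : ArithOp

/-- Results of arithmetic operations: subtraction of a larger number gives `0`, division rounds down,
and division by `0` is not allowed. -/
def ArithOp.eval : ArithOp → ℕ → ℕ → Option ℕ
  | .add, k, l => some (k + l)
  | .sub, k, l => some (k - l)
  | .mul, k, l => some (k * l)
  | .div, k, l => if l = 0 then none else some (k / l)

/-- The elementary instructions.  Letters `x`, `y`, `z` are register numbers. -/
inductive Instr (K : ℕ) where
  /-- `x := nil` -/
  | setNil (x : ℕ) : Instr K
  /-- `x := k`, for a number `k` written in the program -/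
  | setInt (x k : ℕ) : Instr K
  /-- `x := y` -/
  | move (x y : ℕ) : Instr K
  /-- `x := y op z` -/
  | arith (op : ArithOp) (x y z : ℕ) : Instr K
  /-- `x :=` a pointer to a new node, all of whose fields are `nil` -/
  | alloc (x : ℕ) : Instr K
  /-- `x := y.f` -/
  | load (x y : ℕ) (f : Fin K) : Instr K
  /-- `x.f := y` -/
  | store (x : ℕ) (f : Fin K) (y : ℕ) : Instr K

/-- The effect of an instruction on a machine whose integers are at most `W`.  The value `none` means
that the machine is stuck: an operand has the wrong type, an integer exceeds `W`, there is a division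
by zero, or a pointer does not point to a node. -/
def Instr.step {K : ℕ} (W : ℕ) (σ : State K) : Instr K → Option (State K)
  | .setNil x => some (σ.setReg x .nil)
  | .setInt x k => if k ≤ W then some (σ.setReg x (.int k)) else none
  | .move x y => some (σ.setReg x (σ.reg y))
  | .arith op x y z =>
    match σ.reg y, σ.reg z with
    | .int k, .int l =>
      match op.eval k l with
      | some m => if m ≤ W then some (σ.setReg x (.int m)) else none
      | none => none
    | _, _ => none
  | .alloc x =>
    some
      { reg := Function.update σ.reg x (.ptr σ.size)
        heap := Function.update σ.heap σ.size (fun _ => .nil)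
        size := σ.size + 1 }
  | .load x y f =>
    match σ.reg y with
    | .ptr a => if a < σ.size then some (σ.setReg x (σ.heap a f)) else none
    | _ => none
  | .store x f y =>
    match σ.reg x with
    | .ptr a =>
      if a < σ.size then
        some { σ with heap := Function.update σ.heap a (Function.update (σ.heap a) f (σ.reg y)) }
      else none
    | _ => none

/-- The elementary tests. -/
inductive Test where
  /-- Does register `x` hold `nil`? -/
  | isNil (x : ℕ) : Test
  /-- Do the registers `x` and `y` hold the same word? -/
  | eq (x y : ℕ) : Test
  /-- Is `x ≤ y`?  Both must be integers, or both must be coordinates. -/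
  | le (x y : ℕ) : Test

open Classical in
/-- The outcome of a test; `none` means that the machine is stuck. -/
noncomputable def Test.eval {K : ℕ} (σ : State K) : Test → Option Bool
  | .isNil x => some (decide (σ.reg x = .nil))
  | .eq x y => some (decide (σ.reg x = σ.reg y))
  | .le x y =>
    match σ.reg x, σ.reg y with
    | .int k, .int l => some (decide (k ≤ l))
    | .coord r, .coord s => some (decide (r ≤ s))
    | _, _ => none

/-- Programs. -/
inductive Program (K : ℕ) where
  | skip : Program K
  | instr (i : Instr K) : Program K
  | seq (p q : Program K) : Program K
  | ite (b : Test) (p q : Program K) : Program K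
  | loop (b : Test) (p : Program K) : Program K

/-- `Exec W p σ t σ'`: on a machine whose integers are at most `W`, the program `p`, started in the
configuration `σ`, halts after exactly `t` steps in the configuration `σ'`.  Every execution of an
elementary instruction and every evaluation of a test is one step. -/
inductive Exec {K : ℕ} (W : ℕ) : Program K → State K → ℕ → State K → Prop where
  | skip (σ : State K) : Exec W .skip σ 0 σ
  | instr (i : Instr K) (σ σ' : State K) (h : i.step W σ = some σ') : Exec W (.instr i) σ 1 σ'
  | seq (p q : Program K) (σ σ' σ'' : State K) (s t : ℕ)
      (hp : Exec W p σ s σ') (hq : Exec W q σ' t σ'') : Exec W (.seq p q) σ (s + t) σ''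
  | ite_true (b : Test) (p q : Program K) (σ σ' : State K) (t : ℕ)
      (hb : b.eval σ = some true) (hp : Exec W p σ t σ') : Exec W (.ite b p q) σ (1 + t) σ'
  | ite_false (b : Test) (p q : Program K) (σ σ' : State K) (t : ℕ)
      (hb : b.eval σ = some false) (hq : Exec W q σ t σ') : Exec W (.ite b p q) σ (1 + t) σ'
  | loop_true (b : Test) (p : Program K) (σ σ' σ'' : State K) (s t : ℕ)
      (hb : b.eval σ = some true) (hp : Exec W p σ s σ') (hl : Exec W (.loop b p) σ' t σ'') :
      Exec W (.loop b p) σ (1 + s + t) σ''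
  | loop_false (b : Test) (p : Program K) (σ : State K)
      (hb : b.eval σ = some false) : Exec W (.loop b p) σ 1 σ

/-- A data structure in memory: nodes at the addresses `0, …, size - 1` and a distinguished one, the
root.  The values of `heap` at other addresses are irrelevant. -/
structure DataStructure (K : ℕ) where
  size : ℕ
  root : ℕ
  heap : ℕ → Fin K → Word

/-- The words that may be stored in a structure with `size` nodes, on a machine whose integers are at
most `W`, for input points `P`: pointers to nodes of the structure, integers of at most `W`, and
coordinates of input points. -/
def Word.Admissible {n : ℕ} (W size : ℕ) (P : Fin n → ℝ × ℝ) : Word → Prop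
  | .nil => True
  | .ptr a => a < size
  | .int k => k ≤ W
  | .coord r => ∃ i, r = (P i).1 ∨ r = (P i).2

/-- The structure has a root and all its words are admissible. -/
def DataStructure.WellFormed {K n : ℕ} (D : DataStructure K) (W : ℕ) (P : Fin n → ℝ × ℝ) : Prop :=
  D.root < D.size ∧ ∀ a < D.size, ∀ f, (D.heap a f).Admissible W D.size P

/-- The initial configuration of a query: the registers `0`, `1`, `2`, `3` hold the sides of the query
rectangle `[a, b] × [c, d]`, register `4` holds a pointer to the root, all others hold `nil`. -/
def DataStructure.start {K : ℕ} (D : DataStructure K) (a b c d : ℝ) : State K where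
  reg
    | 0 => .coord a
    | 1 => .coord b
    | 2 => .coord c
    | 3 => .coord d
    | 4 => .ptr D.root
    | _ => .nil
  heap := D.heap
  size := D.size

/-- The number of distinct colors of the points in the rectangle `[a, b] × [c, d]`, where point `i` is
`P i` and has color `color i`. -/
noncomputable def colorCount {n : ℕ} (P : Fin n → ℝ × ℝ) (color : Fin n → ℕ) (a b c d : ℝ) : ℕ :=
  (color '' {i | (P i).1 ∈ Set.Icc a b ∧ (P i).2 ∈ Set.Icc c d}).ncard

/-- `D` is a structure of at most `S` words from which the program `query` answers every colored
orthogonal range counting query on the colored points `(P, color)` within `T` steps.  The answer is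
delivered in register `0`.  A query may allocate and use new nodes, but these too have to fit into the
`S` words, and the query leaves `D` as it found it. -/
def AnswersWithin {K n : ℕ} (W : ℕ) (query : Program K) (D : DataStructure K)
    (P : Fin n → ℝ × ℝ) (color : Fin n → ℕ) (S T : ℝ) : Prop :=
  D.WellFormed W P ∧
  ((D.size * K : ℕ) : ℝ) ≤ S ∧
  ∀ a b c d : ℝ, ∃ (t : ℕ) (σ : State K),
    Exec W query (D.start a b c d) t σ ∧
    (t : ℝ) ≤ T ∧
    ((σ.size * K : ℕ) : ℝ) ≤ S ∧
    (∀ i < D.size, σ.heap i = D.heap i) ∧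
    σ.reg 0 = .int (colorCount P color a b c d)

end PointerMachine

/-!
The structure is one set of natural numbers in a balanced search tree, on which a query does successor
searches, and two search trees that replace the sides of the rectangle by their ranks.

*Tables as numbers.*  An entry with the digits `l`, a last digit `z` and a value `v` is stored as the
number with these digits in a base `B` that exceeds all of them.  The successor of `(l, z, 0)` is the entry
for `l` with the smallest last digit that is at least `z`, if there is one (`acc_cases`).  So all tables
are in one set, and the query is an expression (`Expr.queryE`) in a small language with arithmetic,
bounded sums and access to the set; `Expr.compile_spec` and `exists_program` turn it into a program.

*Counting colors.*  The points are in rank space, with odd coordinates, and the sides of the query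
rectangle are even (`toGrid`).  Suppose that `2 ^ l` is the length of the sibling dyadic blocks that separate
the left side from the right side.  Then the rectangle consists of a part of the left block that reaches to
the boundary between the blocks and a part of the right block that starts there
(`Separates.mem_Icc_iff`).  Among the points of a block that have one color and a second coordinate
in `[c, d]`, the representative of the color is the one nearest to the boundary; the color occurs in the
part of the block that belongs to the rectangle iff the representative lies in that part
(`Grid.exists_rep`).  A point `p` is a representative for the sides `(c, d)` iff `c` is in an interval
`Grid.low` and `d` is in an interval `Grid.high`, which depend only on `p`.  These intervals split into
maximal dyadic blocks, at most two of each length (`Canon.eq_of_mod_two`), and a list is kept for every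
pair of dyadic blocks.  The representatives for `(c, d)` are distributed over the `O(lg² n)` lists for the
blocks that contain `c` and `d` (`Grid.sum_reps`).  The lists are ordered by the distance from the boundary,
so that those within the rectangle form a prefix of each list, the length of which is stored.

*Common colors.*  A color is counted twice iff it has representatives on both sides
(`card_image_union_eq`).  The prefixes are divided into full blocks of `X` elements and fewer than `X`
leftover elements.  For each pair of lists in sibling blocks and each pair of prefixes of full blocks, the
number of common colors is stored.  The leftover elements are tested one by one: the maxima over columns of
one color give the representative of the color on the other side (`Grid.top_eq_of_mem_reps`), and the
tables of maximal dyadic blocks give its list and with it its position (`Grid.full_eq`).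

*The bounds.*  The query looks at `O(lg⁴ n)` pairs of lists and `O(X lg² n)` leftover elements, with a
successor search of `O(lg n)` steps for each (`Expr.cost_queryE_le`).  The lists have `O(n lg³ n)`
elements (`Grid.sum_card_list_le`).  Two points determine the level at which they are in sibling blocks, so
that there are `O(n² lg⁴ n)` pairs of elements of lists in sibling blocks, and `1 / X ²` of this many stored
numbers of common colors (`Grid.card_matTable_le`).
-/

namespace PointerMachine

open Finset

/-! ### Executions with a bound on the number of steps -/

/-- `Runs W p σ t σ'`: the program `p` leads from `σ` to `σ'` in at most `t` steps. -/
def Runs {K : ℕ} (W : ℕ) (p : Program K) (σ : State K) (t : ℕ) (σ' : State K) : Prop :=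
  ∃ s ≤ t, Exec W p σ s σ'

theorem Runs.mono {K W : ℕ} {p : Program K} {σ σ' : State K} {s t : ℕ} (h : Runs W p σ s σ')
    (hst : s ≤ t) : Runs W p σ t σ' := by
  obtain ⟨u, hu, h⟩ := h
  exact ⟨u, hu.trans hst, h⟩

theorem Runs.instr {K W : ℕ} {i : Instr K} {σ σ' : State K} (h : i.step W σ = some σ') :
    Runs W (.instr i) σ 1 σ' :=
  ⟨1, le_rfl, .instr _ _ _ h⟩

theorem Runs.seq {K W : ℕ} {p q : Program K} {σ σ' σ'' : State K} {s t : ℕ}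
    (hp : Runs W p σ s σ') (hq : Runs W q σ' t σ'') : Runs W (.seq p q) σ (s + t) σ'' := by
  obtain ⟨s', hs, hp⟩ := hp
  obtain ⟨t', ht, hq⟩ := hq
  exact ⟨s' + t', by omega, .seq _ _ _ _ _ _ _ hp hq⟩

theorem Runs.ite_true {K W : ℕ} {b : Test} {p q : Program K} {σ σ' : State K} {t : ℕ}
    (hb : b.eval σ = some true) (hp : Runs W p σ t σ') : Runs W (.ite b p q) σ (1 + t) σ' := by
  obtain ⟨t', ht, hp⟩ := hp
  exact ⟨1 + t', by omega, .ite_true _ _ _ _ _ _ hb hp⟩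

theorem Runs.ite_false {K W : ℕ} {b : Test} {p q : Program K} {σ σ' : State K} {t : ℕ}
    (hb : b.eval σ = some false) (hq : Runs W q σ t σ') : Runs W (.ite b p q) σ (1 + t) σ' := by
  obtain ⟨t', ht, hq⟩ := hq
  exact ⟨1 + t', by omega, .ite_false _ _ _ _ _ _ hb hq⟩

theorem Runs.loop_true {K W : ℕ} {b : Test} {p : Program K} {σ σ' σ'' : State K} {s t : ℕ}
    (hb : b.eval σ = some true) (hp : Runs W p σ s σ') (hl : Runs W (.loop b p) σ' t σ'') :
    Runs W (.loop b p) σ (1 + s + t) σ'' := by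
  obtain ⟨s', hs, hp⟩ := hp
  obtain ⟨t', ht, hl⟩ := hl
  exact ⟨1 + s' + t', by omega, .loop_true _ _ _ _ _ _ _ hb hp hl⟩

theorem Runs.loop_false {K W : ℕ} {b : Test} {p : Program K} {σ : State K}
    (hb : b.eval σ = some false) : Runs W (.loop b p) σ 1 σ :=
  ⟨1, le_rfl, .loop_false _ _ _ hb⟩

section Steps

variable {K W : ℕ} {f : ℕ → Word} {H : ℕ → Fin K → Word} {N : ℕ}

theorem runs_setNil (x : ℕ) :
    Runs W (.instr (.setNil x)) ⟨f, H, N⟩ 1 ⟨Function.update f x .nil, H, N⟩ :=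
  .instr rfl

theorem runs_setInt (x k : ℕ) (hk : k ≤ W) :
    Runs W (.instr (.setInt x k)) ⟨f, H, N⟩ 1 ⟨Function.update f x (.int k), H, N⟩ :=
  .instr (by simp [Instr.step, hk, State.setReg])

theorem runs_move (x y : ℕ) :
    Runs W (.instr (.move x y)) ⟨f, H, N⟩ 1 ⟨Function.update f x (f y), H, N⟩ :=
  .instr rfl

theorem runs_arith {op : ArithOp} {x y z k l m : ℕ} (hy : f y = .int k) (hz : f z = .int l)
    (hm : op.eval k l = some m) (hW : m ≤ W) :
    Runs W (.instr (.arith op x y z)) ⟨f, H, N⟩ 1 ⟨Function.update f x (.int m), H, N⟩ :=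
  .instr (by simp [Instr.step, hy, hz, hm, hW, State.setReg])

theorem runs_load {x y a : ℕ} {g : Fin K} (hy : f y = .ptr a) (ha : a < N) :
    Runs W (.instr (.load x y g)) ⟨f, H, N⟩ 1 ⟨Function.update f x (H a g), H, N⟩ :=
  .instr (by simp [Instr.step, hy, ha, State.setReg])

theorem eval_isNil_true {x : ℕ} (hx : f x = .nil) :
    (Test.isNil x).eval (⟨f, H, N⟩ : State K) = some true := by
  simp [Test.eval, hx]

theorem eval_isNil_false {x : ℕ} (hx : f x ≠ .nil) :
    (Test.isNil x).eval (⟨f, H, N⟩ : State K) = some false := by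
  simp [Test.eval, hx]

theorem eval_eq_int {x y k l : ℕ} (hx : f x = .int k) (hy : f y = .int l) :
    (Test.eq x y).eval (⟨f, H, N⟩ : State K) = some (decide (k = l)) := by
  simp [Test.eval, hx, hy]

theorem eval_le_int {x y k l : ℕ} (hx : f x = .int k) (hy : f y = .int l) :
    (Test.le x y).eval (⟨f, H, N⟩ : State K) = some (decide (k ≤ l)) := by
  simp [Test.eval, hx, hy]

theorem eval_le_coord {x y : ℕ} {k l : ℝ} (hx : f x = .coord k) (hy : f y = .coord l) :
    (Test.le x y).eval (⟨f, H, N⟩ : State K) = some (decide (k ≤ l)) := by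
  simp [Test.eval, hx, hy]

/-- Started with registers `f`, the program `p` ends within `t` steps with the number `v` in
register `r`; it changes no register below `r`, and not the heap. -/
def Computes (H : ℕ → Fin K → Word) (N W : ℕ) (p : Program K) (f : ℕ → Word) (t r v : ℕ) : Prop :=
  ∃ f', Runs W p ⟨f, H, N⟩ t ⟨f', H, N⟩ ∧ f' r = .int v ∧ ∀ x < r, f' x = f x

end Steps

/-! ### Search trees -/

/-- Binary search trees whose nodes carry a key and a number. -/
inductive Tree (α : Type) where
  | leaf : Tree α
  | node (l : Tree α) (k : α) (v : ℕ) (r : Tree α) : Tree α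

namespace Tree

variable {α : Type}

def toList : Tree α → List (α × ℕ)
  | leaf => []
  | node l k v r => l.toList ++ (k, v) :: r.toList

def height : Tree α → ℕ
  | leaf => 0
  | node l _ _ r => max l.height r.height + 1

/-- The search that goes to the right at the keys that satisfy `P`; the result is the number at the
last node at which it went to the left, `d` if there is none. -/
def search (P : α → Prop) [DecidablePred P] : Tree α → ℕ → ℕ
  | leaf, d => d
  | node l k v r, d => if P k then r.search P d else l.search P v

theorem search_eq (P : α → Prop) [DecidablePred P] (t : Tree α) (d : ℕ)
    (ht : t.toList.Pairwise fun a b => P b.1 → P a.1) :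
    t.search P d = ((t.toList.find? fun a => ¬ P a.1).map Prod.snd).getD d := by
  induction t generalizing d with
  | leaf => rfl
  | node l k v r ihl ihr =>
    simp only [toList, List.pairwise_append, List.pairwise_cons, List.mem_cons] at ht
    obtain ⟨hl, ⟨hk, hr⟩, hlr⟩ := ht
    by_cases h : P k
    · have : l.toList.find? (fun a => ¬ P a.1) = none := by
        rw [List.find?_eq_none]
        intro a ha
        simpa using hlr a ha _ (Or.inl rfl) h
      rw [search, if_pos h, ihr d hr, toList, List.find?_append, this, List.find?_cons]
      simp [h]
    · simp only [search, h, if_false, toList, ihl v hl, List.find?_append]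
      cases hf : l.toList.find? (fun a => ¬ P a.1) <;> simp [h]

/-- A list is the inorder sequence of a tree of logarithmic height. -/
theorem exists_balanced (m : ℕ) (s : List (α × ℕ)) (hs : s.length < 2 ^ m) :
    ∃ t : Tree α, t.toList = s ∧ t.height ≤ m := by
  induction m generalizing s with
  | zero =>
    have : s = [] := by simpa using hs
    exact ⟨leaf, by simp [toList, this], le_rfl⟩
  | succ m ih =>
    rcases h : s.drop (s.length / 2) with _ | ⟨⟨k, v⟩, s'⟩
    · have h1 : s.length - s.length / 2 = 0 := by rw [← List.length_drop, h]; rfl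
      have : s = [] := List.length_eq_zero_iff.1 (by omega)
      exact ⟨leaf, by simp [toList, this], by simp [height]⟩
    · have h1 : s.length - s.length / 2 = s'.length + 1 := by rw [← List.length_drop, h]; rfl
      have h2 : (s.take (s.length / 2)).length = s.length / 2 := by
        rw [List.length_take]; omega
      obtain ⟨t, ht, ht'⟩ := ih (s.take (s.length / 2)) (by rw [h2]; omega)
      obtain ⟨u, hu, hu'⟩ := ih s' (by omega)
      refine ⟨node t k v u, ?_, ?_⟩
      · simp only [toList, ht, hu, ← h, List.take_append_drop]
      · simp only [height]; omega

/-- The tree is stored in the heap, with root word `w` and nodes at addresses below `N`.  Fields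
`0`, `1`, `2`, `3` of a node hold its key, its number and its children. -/
def StoredAt (emb : α → Word) (H : ℕ → Fin 8 → Word) (N : ℕ) : Tree α → Word → Prop
  | leaf, w => w = .nil
  | node l k v r, w => ∃ a < N, w = .ptr a ∧ H a 0 = emb k ∧ H a 1 = .int v ∧
      l.StoredAt emb H N (H a 2) ∧ r.StoredAt emb H N (H a 3)

theorem StoredAt.mono {emb : α → Word} {H H' : ℕ → Fin 8 → Word} {N N' : ℕ} {t : Tree α} {w : Word}
    (h : t.StoredAt emb H N w) (hN : N ≤ N') (hH : ∀ a < N, H' a = H a) :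
    t.StoredAt emb H' N' w := by
  induction t generalizing w with
  | leaf => exact h
  | node l k v r ihl ihr =>
    obtain ⟨a, ha, rfl, h0, h1, hl, hr⟩ := h
    refine ⟨a, ha.trans_le hN, rfl, ?_, ?_, ?_, ?_⟩ <;> rw [hH a ha]
    exacts [h0, h1, ihl hl, ihr hr]

/-- Trees can be stored in fresh memory, one node each. -/
theorem exists_storedAt (emb : α → Word) (A : ℕ → Word → Prop)
    (hA : ∀ N N' v, N ≤ N' → A N v → A N' v) (hnil : ∀ N, A N .nil)
    (hptr : ∀ N a, a < N → A N (.ptr a)) (t : Tree α)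
    (ht : ∀ a ∈ t.toList, ∀ N, A N (emb a.1) ∧ A N (.int a.2))
    (H : ℕ → Fin 8 → Word) (N : ℕ) :
    ∃ H' w, t.StoredAt emb H' (N + t.toList.length) w ∧ A (N + t.toList.length) w ∧
      (∀ a < N, H' a = H a) ∧
      ∀ a, N ≤ a → a < N + t.toList.length → ∀ g, A (N + t.toList.length) (H' a g) := by
  induction t generalizing H N with
  | leaf => exact ⟨H, .nil, rfl, hnil _, fun _ _ => rfl, fun a h1 h2 => by simp [toList] at h2; omega⟩
  | node l k v r ihl ihr =>
    obtain ⟨H₁, w₁, h₁, a₁, e₁, g₁⟩ := ihl (fun a ha => ht a (by simp [toList, ha])) H N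
    obtain ⟨H₂, w₂, h₂, a₂, e₂, g₂⟩ := ihr (fun a ha => ht a (by simp [toList, ha])) H₁
      (N + l.toList.length)
    set N₁ := N + l.toList.length
    set N₂ := N₁ + r.toList.length
    have hN : N + (node l k v r).toList.length = N₂ + 1 := by
      simp [toList, N₂, N₁]; omega
    rw [hN]
    have hk := ht (k, v) (by simp [toList])
    refine ⟨Function.update H₂ N₂ ![emb k, .int v, w₁, w₂, .nil, .nil, .nil, .nil], .ptr N₂,
      ⟨N₂, by omega, rfl, ?_, ?_, ?_, ?_⟩, hptr _ _ (by omega), ?_, ?_⟩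
    · simp
    · simp
    · simp only [Function.update_self]
      refine h₁.mono (by omega) fun a ha => ?_
      rw [Function.update_of_ne (by omega), e₂ a ha]
    · simp only [Function.update_self]
      refine h₂.mono (by omega) fun a ha => ?_
      rw [Function.update_of_ne (by omega)]
    · intro a ha
      rw [Function.update_of_ne (by omega), e₂ a (by omega), e₁ a ha]
    · intro a h1 h2 g
      rcases Nat.lt_or_ge a N₂ with h3 | h3
      · rw [Function.update_of_ne (by omega)]
        rcases Nat.lt_or_ge a N₁ with h4 | h4
        · rw [e₂ a h4]
          exact hA N₁ _ _ (by omega) (g₁ a h1 h4 g)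
        · exact hA N₂ _ _ (by omega) (g₂ a h4 h3 g)
      · obtain rfl : a = N₂ := by omega
        rw [Function.update_self]
        fin_cases g
        · exact (hk _).1
        · exact (hk _).2
        · exact hA N₁ _ _ (by omega) a₁
        · exact hA N₂ _ _ (by omega) a₂
        all_goals exact hnil _

end Tree

/-- The body of the search loop.  Register `q` holds the query, `s` the result, `s + 1` the current
node, and `s + 2` is no longer `nil` when the search has ended. -/
def searchStep (strict : Bool) (q s : ℕ) : Program 8 :=
  .ite (.isNil (s + 1)) (.instr (.setInt (s + 2) 0))
    (.seq (.instr (.load (s + 3) (s + 1) 0))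
      (if strict then
        .ite (.le (s + 3) q) (.instr (.load (s + 1) (s + 1) 3))
          (.seq (.instr (.load s (s + 1) 1)) (.instr (.load (s + 1) (s + 1) 2)))
      else
        .ite (.le q (s + 3))
          (.seq (.instr (.load s (s + 1) 1)) (.instr (.load (s + 1) (s + 1) 2)))
          (.instr (.load (s + 1) (s + 1) 3))))

/-- Search in the tree to whose root register `p` points, for the first key that is at least the
content of `q`, or larger if `strict` is set.  Register `s` initially holds the default result. -/
def searchProg (strict : Bool) (p q s : ℕ) : Program 8 :=
  .seq (.instr (.move (s + 1) p)) (.seq (.instr (.setNil (s + 2)))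
    (.loop (.isNil (s + 2)) (searchStep strict q s)))

/-- The tests of the search loop decide `P`. -/
def DecidesRight {α : Type} (emb : α → Word) (strict : Bool) (wq : Word) (P : α → Prop) : Prop :=
  ∀ (k : α) (f : ℕ → Word) (H : ℕ → Fin 8 → Word) (N q s : ℕ), f q = wq → f s = emb k →
    if strict then ∃ b, (Test.le s q).eval (⟨f, H, N⟩ : State 8) = some b ∧ (b = true ↔ P k)
    else ∃ b, (Test.le q s).eval (⟨f, H, N⟩ : State 8) = some b ∧ (b = true ↔ ¬ P k)

theorem searchLoop_spec {α : Type} {emb : α → Word} {P : α → Prop} [DecidablePred P] {strict : Bool}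
    {wq : Word} (hP : DecidesRight emb strict wq P) (W : ℕ) {H : ℕ → Fin 8 → Word} {N : ℕ} {q s : ℕ}
    (hq : q < s) (t : Tree α) (f : ℕ → Word) (d : ℕ) (ht : t.StoredAt emb H N (f (s + 1)))
    (h2 : f (s + 2) = .nil) (hd : f s = .int d) (hfq : f q = wq) :
    Computes H N W (.loop (.isNil (s + 2)) (searchStep strict q s)) f (6 * t.height + 4) s
      (t.search P d) := by
  induction t generalizing f d with
  | leaf =>
    have hl : f (s + 1) = .nil := ht
    refine ⟨Function.update f (s + 2) (.int 0), ?_, ?_, ?_⟩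
    · refine Runs.mono (.loop_true (eval_isNil_true h2) (.ite_true (eval_isNil_true hl)
        (runs_setInt _ _ (Nat.zero_le _))) (.loop_false (eval_isNil_false ?_))) ?_
      · simp
      · simp [Tree.height]
    · rw [Function.update_of_ne (by omega), hd]; rfl
    · intro x hx
      rw [Function.update_of_ne (by omega)]
  | node l k v r ihl ihr =>
    obtain ⟨a, ha, hw, h0, h1, hl, hr⟩ := ht
    set f₁ := Function.update f (s + 3) (H a 0) with hf₁
    have hs1 : f₁ (s + 1) = .ptr a := by rw [hf₁, Function.update_of_ne (by omega), hw]
    have hgo := hP k f₁ H N q (s + 3)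
      (by rw [hf₁, Function.update_of_ne (by omega), hfq]) (by rw [hf₁, Function.update_self, h0])
    have right : P k → Computes H N W (.loop (.isNil (s + 2)) (searchStep strict q s)) f
        (6 * (Tree.node l k v r).height + 4) s ((Tree.node l k v r).search P d) := by
      intro hk
      set f₂ := Function.update f₁ (s + 1) (H a 3) with hf₂
      obtain ⟨f', hrun, hv, hf'⟩ := ihr f₂ d (by rw [hf₂, Function.update_self]; exact hr)
        (by rw [hf₂, Function.update_of_ne (by omega), hf₁, Function.update_of_ne (by omega), h2])
        (by rw [hf₂, Function.update_of_ne (by omega), hf₁, Function.update_of_ne (by omega), hd])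
        (by rw [hf₂, Function.update_of_ne (by omega), hf₁, Function.update_of_ne (by omega), hfq])
      refine ⟨f', ?_, by rw [hv, Tree.search, if_pos hk], ?_⟩
      · refine Runs.mono (.loop_true (eval_isNil_true h2) (.ite_false
          (eval_isNil_false (by simp [hw])) (.seq (runs_load hw ha) (t := 2) (σ'' := ⟨f₂, H, N⟩) ?_))
          hrun) ?_
        · cases strict
          · obtain ⟨b, hb, hb'⟩ := hgo
            obtain rfl : b = false := by simpa [hk] using hb'
            exact .ite_false hb (runs_load hs1 ha)
          · obtain ⟨b, hb, hb'⟩ := hgo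
            obtain rfl : b = true := by simpa [hk] using hb'
            exact .ite_true hb (runs_load hs1 ha)
        · simp only [Tree.height]; omega
      · intro x hx
        rw [hf' x hx, hf₂, Function.update_of_ne (by omega), hf₁, Function.update_of_ne (by omega)]
    have left : ¬ P k → Computes H N W (.loop (.isNil (s + 2)) (searchStep strict q s)) f
        (6 * (Tree.node l k v r).height + 4) s ((Tree.node l k v r).search P d) := by
      intro hk
      set f₂ := Function.update f₁ s (H a 1) with hf₂
      have hs2 : f₂ (s + 1) = .ptr a := by rw [hf₂, Function.update_of_ne (by omega), hs1]
      set f₃ := Function.update f₂ (s + 1) (H a 2) with hf₃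
      obtain ⟨f', hrun, hv, hf'⟩ := ihl f₃ v (by rw [hf₃, Function.update_self]; exact hl)
        (by rw [hf₃, Function.update_of_ne (by omega), hf₂, Function.update_of_ne (by omega), hf₁,
              Function.update_of_ne (by omega), h2])
        (by rw [hf₃, Function.update_of_ne (by omega), hf₂, Function.update_self, h1])
        (by rw [hf₃, Function.update_of_ne (by omega), hf₂, Function.update_of_ne (by omega), hf₁,
              Function.update_of_ne (by omega), hfq])
      have hrun₂ : Runs W (.seq (.instr (.load s (s + 1) 1)) (.instr (.load (s + 1) (s + 1) 2)))
          (⟨f₁, H, N⟩ : State 8) (1 + 1) ⟨f₃, H, N⟩ := .seq (runs_load hs1 ha) (runs_load hs2 ha)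
      refine ⟨f', ?_, by rw [hv, Tree.search, if_neg hk], ?_⟩
      · refine Runs.mono (.loop_true (eval_isNil_true h2) (.ite_false
          (eval_isNil_false (by simp [hw])) (.seq (runs_load hw ha) (t := 3) (σ'' := ⟨f₃, H, N⟩) ?_))
          hrun) ?_
        · cases strict
          · obtain ⟨b, hb, hb'⟩ := hgo
            obtain rfl : b = true := by simpa [hk] using hb'
            exact .ite_true hb hrun₂
          · obtain ⟨b, hb, hb'⟩ := hgo
            obtain rfl : b = false := by simpa [hk] using hb'
            exact .ite_false hb hrun₂
        · simp only [Tree.height]; omega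
      · intro x hx
        rw [hf' x hx, hf₃, Function.update_of_ne (by omega), hf₂, Function.update_of_ne (by omega),
          hf₁, Function.update_of_ne (by omega)]
    by_cases hk : P k
    exacts [right hk, left hk]

theorem searchProg_spec {α : Type} {emb : α → Word} {P : α → Prop} [DecidablePred P] {strict : Bool}
    {wq : Word} (hP : DecidesRight emb strict wq P) (W : ℕ) {H : ℕ → Fin 8 → Word} {N : ℕ} {p q s : ℕ}
    (hq : q < s) {t : Tree α} {f : ℕ → Word} {d : ℕ} (ht : t.StoredAt emb H N (f p))
    (hd : f s = .int d) (hfq : f q = wq) :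
    Computes H N W (searchProg strict p q s) f (6 * t.height + 6) s (t.search P d) := by
  set f₁ := Function.update (Function.update f (s + 1) (f p)) (s + 2) .nil with hf₁
  obtain ⟨f', hrun, hv, hf'⟩ := searchLoop_spec hP W hq t f₁ d
    (by rw [hf₁, Function.update_of_ne (by omega), Function.update_self]; exact ht)
    (by rw [hf₁, Function.update_self])
    (by rw [hf₁, Function.update_of_ne (by omega), Function.update_of_ne (by omega), hd])
    (by rw [hf₁, Function.update_of_ne (by omega), Function.update_of_ne (by omega), hfq])
  refine ⟨f', ?_, hv, fun x hx => ?_⟩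
  · exact Runs.mono (.seq (runs_move _ _) (.seq (runs_setNil _) hrun)) (by omega)
  · rw [hf' x hx, hf₁, Function.update_of_ne (by omega), Function.update_of_ne (by omega)]

theorem decidesRight_int (k : ℕ) : DecidesRight Word.int false (.int k) fun l => l < k := by
  intro l f H N q s hq hs
  exact ⟨_, eval_le_int hq hs, by simp⟩

theorem decidesRight_coord_lt (a : ℝ) :
    DecidesRight Word.coord false (.coord a) fun l => l < a := by
  intro l f H N q s hq hs
  exact ⟨_, eval_le_coord hq hs, by simp⟩

theorem decidesRight_coord_le (a : ℝ) :
    DecidesRight Word.coord true (.coord a) fun l => l ≤ a := by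
  intro l f H N q s hq hs
  exact ⟨_, eval_le_coord hs hq, by simp⟩

/-! ### A functional language for queries -/

/-- Expressions over the natural numbers.  Variables are numbered from the outermost binding
inwards.  `sum e₁ e₂` binds a variable that runs through `0, …, e₁ - 1`; `succ` is the access to the
stored set; `call is e` evaluates `e` with the variables `is` as its only variables. -/
inductive Expr where
  | var (i : ℕ) : Expr
  | const (k : ℕ) : Expr
  | op (o : ArithOp) (e₁ e₂ : Expr) : Expr
  | ifle (e₁ e₂ e₃ e₄ : Expr) : Expr
  | letE (e₁ e₂ : Expr) : Expr
  | sum (e₁ e₂ : Expr) : Expr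
  | succ (e : Expr) : Expr
  | call (is : List ℕ) (e : Expr) : Expr

/-- The arithmetic operations as total functions; division by `0` gives `0`. -/
def ArithOp.total : ArithOp → ℕ → ℕ → ℕ
  | .add, k, l => k + l
  | .sub, k, l => k - l
  | .mul, k, l => k * l
  | .div, k, l => k / l

namespace Expr

/-- The value of an expression, where `O` is the function computed by `succ`. -/
def denote (O : ℕ → ℕ) : Expr → List ℕ → ℕ
  | var i, ρ => ρ[i]?.getD 0
  | const k, _ => k
  | op o e₁ e₂, ρ => o.total (e₁.denote O ρ) (e₂.denote O ρ)
  | ifle e₁ e₂ e₃ e₄, ρ =>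
    if e₁.denote O ρ ≤ e₂.denote O ρ then e₃.denote O ρ else e₄.denote O ρ
  | letE e₁ e₂, ρ => e₂.denote O (ρ ++ [e₁.denote O ρ])
  | sum e₁ e₂, ρ => ∑ k ∈ range (e₁.denote O ρ), e₂.denote O (ρ ++ [k])
  | succ e, ρ => O (e.denote O ρ)
  | call is e, ρ => e.denote O (is.filterMap fun i => ρ[i]?)

/-- A bound on the number of steps of the compiled expression, where `h` is the cost of `succ`. -/
def cost (O : ℕ → ℕ) (h : ℕ) : Expr → List ℕ → ℕ
  | var _, _ => 1
  | const _, _ => 1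
  | op _ e₁ e₂, ρ => e₁.cost O h ρ + e₂.cost O h ρ + 3
  | ifle e₁ e₂ e₃ e₄, ρ => e₁.cost O h ρ + e₂.cost O h ρ + 1 +
    if e₁.denote O ρ ≤ e₂.denote O ρ then e₃.cost O h ρ else e₄.cost O h ρ
  | letE e₁ e₂, ρ => e₁.cost O h ρ + e₂.cost O h (ρ ++ [e₁.denote O ρ]) + 1
  | sum e₁ e₂, ρ => e₁.cost O h ρ + 5 +
    ∑ k ∈ range (e₁.denote O ρ), (e₂.cost O h (ρ ++ [k]) + 5)
  | succ e, ρ => e.cost O h ρ + h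
  | call is e, ρ => e.cost O h (is.filterMap fun i => ρ[i]?)

/-- The program that applies `o` to the registers `r` and `r + 1`. -/
def arithProg (o : ArithOp) (r : ℕ) : Program 8 :=
  match o with
  | .div => .seq (.instr (.setInt (r + 2) 0)) (.ite (.eq (r + 1) (r + 2))
      (.instr (.setInt r 0)) (.instr (.arith .div r r (r + 1))))
  | o => .instr (.arith o r r (r + 1))

/-- The body of the loop for `sum`: register `r + 3` holds the summation variable, `r + 2` its
successor, `r + 1` the sum up to now, and `p` evaluates the summand into `r + 4`. -/
def sumStep (p : Program 8) (r : ℕ) : Program 8 :=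
  .seq p (.seq (.instr (.arith .add (r + 1) (r + 1) (r + 4))) (.seq (.instr (.move (r + 3) (r + 2)))
    (.seq (.instr (.setInt (r + 4) 1)) (.instr (.arith .add (r + 2) (r + 2) (r + 4))))))

/-- Access to the stored set, with the argument and the result in register `r`; register `5` points
to the search tree. -/
def succProg (r : ℕ) : Program 8 :=
  .seq (.instr (.setInt (r + 1) 0)) (.seq (searchProg false 5 r (r + 1))
    (.instr (.move r (r + 1))))

/-- The program that evaluates an expression into register `r`, where `φ` lists the registers of the
variables; registers below `r` are not changed. -/
def compile : Expr → List ℕ → ℕ → Program 8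
  | var i, φ, r =>
    match φ[i]? with
    | some x => .instr (.move r x)
    | none => .instr (.setInt r 0)
  | const k, _, r => .instr (.setInt r k)
  | op o e₁ e₂, φ, r => .seq (e₁.compile φ r) (.seq (e₂.compile φ (r + 1)) (arithProg o r))
  | ifle e₁ e₂ e₃ e₄, φ, r => .seq (e₁.compile φ r) (.seq (e₂.compile φ (r + 1))
      (.ite (.le r (r + 1)) (e₃.compile φ r) (e₄.compile φ r)))
  | letE e₁ e₂, φ, r => .seq (e₁.compile φ r) (.seq (e₂.compile (φ ++ [r]) (r + 1))
      (.instr (.move r (r + 1))))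
  | sum e₁ e₂, φ, r => .seq (e₁.compile φ r) (.seq (.instr (.setInt (r + 1) 0))
      (.seq (.instr (.setInt (r + 2) 1)) (.seq (.instr (.setInt (r + 3) 0))
      (.seq (.loop (.le (r + 2) r) (sumStep (e₂.compile (φ ++ [r + 3]) (r + 4)) r))
      (.instr (.move r (r + 1)))))))
  | succ e, φ, r => .seq (e.compile φ r) (succProg r)
  | call is e, φ, r => e.compile (is.filterMap fun i => φ[i]?) r

section Spec

variable {H : ℕ → Fin 8 → Word} {N W : ℕ}

theorem arithProg_spec {o : ArithOp} {r k l : ℕ} {f : ℕ → Word} (hk : f r = .int k)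
    (hl : f (r + 1) = .int l) (hW : o.total k l ≤ W) :
    Computes H N W (arithProg o r) f 3 r (o.total k l) := by
  have key : ∀ m, o.eval k l = some m → m ≤ W →
      Computes H N W (.instr (.arith o r r (r + 1))) f 1 r m := fun m hm hW =>
    ⟨_, runs_arith hk hl hm hW, Function.update_self .., fun x hx => Function.update_of_ne (by omega) ..⟩
  cases o with
  | div =>
    set f₁ := Function.update f (r + 2) (.int 0) with hf₁
    have hr : f₁ r = .int k := by rw [hf₁, Function.update_of_ne (by omega), hk]
    have hr1 : f₁ (r + 1) = .int l := by rw [hf₁, Function.update_of_ne (by omega), hl]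
    have hr2 : f₁ (r + 2) = .int 0 := by rw [hf₁, Function.update_self]
    have hb := eval_eq_int (H := H) (N := N) hr1 hr2
    by_cases h0 : l = 0
    · refine ⟨_, Runs.mono (.seq (runs_setInt _ _ (Nat.zero_le _)) (.ite_true (by simpa [h0] using hb)
        (runs_setInt _ _ (Nat.zero_le _)))) (by omega), ?_, ?_⟩
      · rw [Function.update_self, h0]; simp [ArithOp.total]
      · intro x hx
        rw [Function.update_of_ne (by omega), Function.update_of_ne (by omega)]
    · refine ⟨_, Runs.mono (.seq (runs_setInt _ _ (Nat.zero_le _)) (.ite_false (by simpa [h0] using hb)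
        (runs_arith hr hr1 (m := k / l) (by simp [ArithOp.eval, h0]) hW))) (by omega), ?_, ?_⟩
      · rw [Function.update_self]; simp [ArithOp.total]
      · intro x hx
        rw [Function.update_of_ne (by omega), Function.update_of_ne (by omega)]
  | _ =>
    obtain ⟨f', h, h'⟩ := key _ rfl hW
    exact ⟨f', h.mono (by omega), h'⟩

/-- The loop for `sum`, entered when `k` of the summands `v 0, …, v (m - 1)` have been added. -/
theorem sumLoop_spec {p : Program 8} {r m : ℕ} {g : ℕ → Word} {v c : ℕ → ℕ}
    (hp : ∀ k < m, ∀ f : ℕ → Word, (∀ x < r, f x = g x) → f (r + 3) = .int k →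
      Computes H N W p f (c k) (r + 4) (v k))
    (hW : ∑ k ∈ range m, v k ≤ W) (hm : m + 1 ≤ W) (j k : ℕ) (hjk : k + j = m) (f : ℕ → Word)
    (hg : ∀ x < r, f x = g x) (h0 : f r = .int m) (h1 : f (r + 1) = .int (∑ i ∈ range k, v i))
    (h2 : f (r + 2) = .int (k + 1)) (h3 : f (r + 3) = .int k) :
    Computes H N W (.loop (.le (r + 2) r) (sumStep p r)) f
      (1 + ∑ i ∈ range j, (c (k + i) + 5)) (r + 1) (∑ i ∈ range m, v i) := by
  induction j generalizing k f with
  | zero =>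
    obtain rfl : k = m := by omega
    exact ⟨f, by simpa using Runs.loop_false ((eval_le_int h2 h0).trans (by simp)), h1, fun _ _ => rfl⟩
  | succ j ih =>
    have hkm : k < m := by omega
    obtain ⟨f₁, hrun, hv, hf₁⟩ := hp k hkm f hg h3
    have hle : ∑ i ∈ range (k + 1), v i ≤ ∑ i ∈ range m, v i :=
      sum_le_sum_of_subset (range_subset_range.2 hkm)
    set f₂ := Function.update f₁ (r + 1) (.int (∑ i ∈ range (k + 1), v i)) with hf₂
    set f₃ := Function.update f₂ (r + 3) (f₂ (r + 2)) with hf₃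
    set f₄ := Function.update f₃ (r + 4) (.int 1) with hf₄
    set f₅ := Function.update f₄ (r + 2) (.int (k + 1 + 1)) with hf₅
    have s2 : f₂ (r + 2) = .int (k + 1) := by
      rw [hf₂, Function.update_of_ne (by omega), hf₁ _ (by omega), h2]
    have low : ∀ x < r + 1, f₅ x = f x := fun x hx => by
      rw [hf₅, Function.update_of_ne (by omega), hf₄, Function.update_of_ne (by omega), hf₃,
        Function.update_of_ne (by omega), hf₂, Function.update_of_ne (by omega), hf₁ _ (by omega)]
    obtain ⟨f', hr', hv', hf'⟩ := ih (k + 1) (by omega) f₅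
      (fun x hx => by rw [low x (by omega), hg x hx]) (by rw [low r (by omega), h0])
      (by rw [hf₅, Function.update_of_ne (by omega), hf₄, Function.update_of_ne (by omega), hf₃,
            Function.update_of_ne (by omega), hf₂, Function.update_self])
      (by rw [hf₅, Function.update_self])
      (by rw [hf₅, Function.update_of_ne (by omega), hf₄, Function.update_of_ne (by omega), hf₃,
            Function.update_self, s2])
    refine ⟨f', ?_, hv', fun x hx => by rw [hf' x hx, low x hx]⟩
    refine Runs.mono (.loop_true ((eval_le_int h2 h0).trans (by simp; omega)) (.seq hrun (.seq
      (runs_arith (x := r + 1) (m := ∑ i ∈ range (k + 1), v i) ((hf₁ _ (by omega)).trans h1) hv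
        (by rw [sum_range_succ]; rfl) (hle.trans hW)) (.seq (runs_move _ _) (.seq
      (runs_setInt (r + 4) 1 (by omega)) (runs_arith (x := r + 2) (k := k + 1) (l := 1) (m := k + 1 + 1)
        ?_ ?_ rfl (by omega)))))) hr') ?_
    · change f₄ (r + 2) = _
      rw [hf₄, Function.update_of_ne (by omega), hf₃, Function.update_of_ne (by omega), s2]
    · exact Function.update_self ..
    · have hs : ∑ i ∈ range j, (c (k + (i + 1)) + 5) = ∑ i ∈ range j, (c (k + 1 + i) + 5) :=
        sum_congr rfl fun i _ => by rw [show k + (i + 1) = k + 1 + i by omega]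
      rw [sum_range_succ', hs]
      simp only [add_zero]
      omega

end Spec

/-- Register `5` gives access to a stored set: with `w₀` in this register, `succProg` computes the
function `O` within `h` steps. -/
def OracleAt (H : ℕ → Fin 8 → Word) (N W : ℕ) (w₀ : Word) (O : ℕ → ℕ) (h : ℕ) : Prop :=
  ∀ (f : ℕ → Word) (r q : ℕ), 5 < r → f 5 = w₀ → f r = .int q →
    Computes H N W (succProg r) f h r (O q)

theorem map_eq_of_lt {φ ρ : List ℕ} {f f' : ℕ → Word} {r : ℕ} (hφ : ∀ x ∈ φ, x < r)
    (hf : φ.map f = ρ.map Word.int) (hf' : ∀ x < r, f' x = f x) : φ.map f' = ρ.map Word.int := by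
  rw [← hf]
  exact List.map_congr_left fun x hx => hf' x (hφ x hx)

theorem getElem?_eq {φ ρ : List ℕ} {f : ℕ → Word} (hf : φ.map f = ρ.map Word.int) (i : ℕ) :
    φ[i]?.map f = ρ[i]?.map Word.int := by
  rw [← List.getElem?_map, ← List.getElem?_map, hf]

/-- Compiled expressions compute their values.  The word length needed is a constant multiple of
`log n` if the numbers at hand are polynomial in `n`. -/
theorem compile_spec (e : Expr) (m : ℕ) : ∃ w, ∀ n, 2 ≤ n → ∀ W, n ^ w ≤ W → ∀ H N O h w₀,
    OracleAt H N W w₀ O h → (∀ q, O q ≤ n ^ m) → ∀ ρ : List ℕ, (∀ k ∈ ρ, k ≤ n ^ m) →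
    e.denote O ρ ≤ n ^ w ∧ ∀ φ r f, 5 < r → (∀ x ∈ φ, x < r) → f 5 = w₀ →
      φ.map f = ρ.map Word.int → Computes H N W (e.compile φ r) f (e.cost O h ρ) r (e.denote O ρ) := by
  induction e generalizing m with
  | var i =>
    refine ⟨m, fun n hn W hW H N O h w₀ hO hOm ρ hρ => ⟨?_, ?_⟩⟩
    · rw [denote]
      cases hi : ρ[i]? with
      | none => simp
      | some k => exact hρ k (List.mem_of_getElem? hi)
    · intro φ r f hr hφ h5 hf
      have := getElem?_eq hf i
      rw [compile, denote, cost]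
      cases hi : φ[i]? with
      | none =>
        rw [hi] at this
        have h0 : ρ[i]? = none := by simpa using this.symm
        rw [h0]
        exact ⟨_, runs_setInt _ _ (Nat.zero_le _), Function.update_self ..,
          fun x hx => Function.update_of_ne (by omega) ..⟩
      | some x =>
        rw [hi] at this
        cases hi' : ρ[i]? with
        | none => simp [hi'] at this
        | some k =>
          refine ⟨_, runs_move _ _, ?_, fun x hx => Function.update_of_ne (by omega) ..⟩
          rw [Function.update_self]
          simpa [hi'] using this
  | const k =>
    refine ⟨k, fun n hn W hW H N O h w₀ hO hOm ρ hρ => ?_⟩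
    have hk : k ≤ n ^ k := (Nat.lt_pow_self (by omega)).le
    exact ⟨hk, fun φ r f hr hφ h5 hf => ⟨_, runs_setInt _ _ (hk.trans hW), Function.update_self ..,
      fun x hx => Function.update_of_ne (by omega) ..⟩⟩
  | op o e₁ e₂ ih₁ ih₂ =>
    obtain ⟨w₁, ih₁⟩ := ih₁ m
    obtain ⟨w₂, ih₂⟩ := ih₂ m
    refine ⟨w₁ + w₂ + 1, fun n hn W hW H N O h w₀ hO hOm ρ hρ => ?_⟩
    have hn0 : 0 < n := by omega
    obtain ⟨b₁, ih₁⟩ := ih₁ n hn W ((Nat.pow_le_pow_right hn0 (by omega)).trans hW) H N O h w₀ hO hOm ρ hρ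
    obtain ⟨b₂, ih₂⟩ := ih₂ n hn W ((Nat.pow_le_pow_right hn0 (by omega)).trans hW) H N O h w₀ hO hOm ρ hρ
    have p₁ : n ^ w₁ ≤ n ^ (w₁ + w₂) := Nat.pow_le_pow_right hn0 (by omega)
    have p₂ : n ^ w₂ ≤ n ^ (w₁ + w₂) := Nat.pow_le_pow_right hn0 (by omega)
    have p₃ : n ^ (w₁ + w₂) * 2 ≤ n ^ (w₁ + w₂ + 1) := by
      rw [pow_succ]; exact Nat.mul_le_mul le_rfl hn
    have hb : (Expr.op o e₁ e₂).denote O ρ ≤ n ^ (w₁ + w₂ + 1) := by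
      rw [denote]
      cases o <;> simp only [ArithOp.total]
      · omega
      · omega
      · calc _ ≤ n ^ w₁ * n ^ w₂ := Nat.mul_le_mul b₁ b₂
          _ = n ^ (w₁ + w₂) := (pow_add ..).symm
          _ ≤ _ := by omega
      · exact (Nat.div_le_self _ _).trans (by omega)
    refine ⟨hb, fun φ r f hr hφ h5 hf => ?_⟩
    obtain ⟨f₁, hr₁, hv₁, hf₁⟩ := ih₁ φ r f hr hφ h5 hf
    obtain ⟨f₂, hr₂, hv₂, hf₂⟩ := ih₂ φ (r + 1) f₁ (by omega) (fun x hx => (hφ x hx).trans (by omega))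
      ((hf₁ _ hr).trans h5) (map_eq_of_lt hφ hf hf₁)
    obtain ⟨f₃, hr₃, hv₃, hf₃⟩ := arithProg_spec (H := H) (N := N) (o := o)
      ((hf₂ r (by omega)).trans hv₁) hv₂ (hb.trans hW)
    exact ⟨f₃, Runs.mono (.seq hr₁ (.seq hr₂ hr₃)) (by rw [cost]; omega), hv₃, fun x hx => by
      rw [hf₃ x hx, hf₂ x (by omega), hf₁ x hx]⟩
  | ifle e₁ e₂ e₃ e₄ ih₁ ih₂ ih₃ ih₄ =>
    obtain ⟨w₁, ih₁⟩ := ih₁ m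
    obtain ⟨w₂, ih₂⟩ := ih₂ m
    obtain ⟨w₃, ih₃⟩ := ih₃ m
    obtain ⟨w₄, ih₄⟩ := ih₄ m
    refine ⟨w₁ + w₂ + w₃ + w₄, fun n hn W hW H N O h w₀ hO hOm ρ hρ => ?_⟩
    have hn0 : 0 < n := by omega
    have p₃ : n ^ w₃ ≤ n ^ (w₁ + w₂ + w₃ + w₄) := Nat.pow_le_pow_right hn0 (by omega)
    have p₄ : n ^ w₄ ≤ n ^ (w₁ + w₂ + w₃ + w₄) := Nat.pow_le_pow_right hn0 (by omega)
    obtain ⟨b₁, ih₁⟩ := ih₁ n hn W ((Nat.pow_le_pow_right hn0 (by omega)).trans hW) H N O h w₀ hO hOm ρ hρ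
    obtain ⟨b₂, ih₂⟩ := ih₂ n hn W ((Nat.pow_le_pow_right hn0 (by omega)).trans hW) H N O h w₀ hO hOm ρ hρ
    obtain ⟨b₃, ih₃⟩ := ih₃ n hn W (p₃.trans hW) H N O h w₀ hO hOm ρ hρ
    obtain ⟨b₄, ih₄⟩ := ih₄ n hn W (p₄.trans hW) H N O h w₀ hO hOm ρ hρ
    refine ⟨by rw [denote]; split_ifs <;> omega, fun φ r f hr hφ h5 hf => ?_⟩
    obtain ⟨f₁, hr₁, hv₁, hf₁⟩ := ih₁ φ r f hr hφ h5 hf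
    obtain ⟨f₂, hr₂, hv₂, hf₂⟩ := ih₂ φ (r + 1) f₁ (by omega) (fun x hx => (hφ x hx).trans (by omega))
      ((hf₁ _ hr).trans h5) (map_eq_of_lt hφ hf hf₁)
    have low : ∀ x < r, f₂ x = f x := fun x hx => by rw [hf₂ x (by omega), hf₁ x hx]
    have hb := eval_le_int (H := H) (N := N) ((hf₂ r (by omega)).trans hv₁) hv₂
    rw [denote, cost]
    by_cases hle : e₁.denote O ρ ≤ e₂.denote O ρ
    · obtain ⟨f₃, hr₃, hv₃, hf₃⟩ := ih₃ φ r f₂ hr hφ ((low 5 hr).trans h5) (map_eq_of_lt hφ hf low)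
      rw [if_pos hle, if_pos hle]
      exact ⟨f₃, Runs.mono (.seq hr₁ (.seq hr₂ (.ite_true (by simpa [hle] using hb) hr₃))) (by omega),
        hv₃, fun x hx => by rw [hf₃ x hx, low x hx]⟩
    · obtain ⟨f₃, hr₃, hv₃, hf₃⟩ := ih₄ φ r f₂ hr hφ ((low 5 hr).trans h5) (map_eq_of_lt hφ hf low)
      rw [if_neg hle, if_neg hle]
      exact ⟨f₃, Runs.mono (.seq hr₁ (.seq hr₂ (.ite_false (by simpa [hle] using hb) hr₃))) (by omega),
        hv₃, fun x hx => by rw [hf₃ x hx, low x hx]⟩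
  | letE e₁ e₂ ih₁ ih₂ =>
    obtain ⟨w₁, ih₁⟩ := ih₁ m
    obtain ⟨w₂, ih₂⟩ := ih₂ (m + w₁)
    refine ⟨w₁ + w₂, fun n hn W hW H N O h w₀ hO hOm ρ hρ => ?_⟩
    have hn0 : 0 < n := by omega
    have p₁ : n ^ w₁ ≤ n ^ (m + w₁) := Nat.pow_le_pow_right hn0 (by omega)
    have p₂ : n ^ w₂ ≤ n ^ (w₁ + w₂) := Nat.pow_le_pow_right hn0 (by omega)
    have pm : n ^ m ≤ n ^ (m + w₁) := Nat.pow_le_pow_right hn0 (by omega)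
    obtain ⟨b₁, ih₁⟩ := ih₁ n hn W ((Nat.pow_le_pow_right hn0 (by omega)).trans hW) H N O h w₀ hO hOm ρ hρ
    obtain ⟨b₂, ih₂⟩ := ih₂ n hn W (p₂.trans hW) H N O h w₀ hO (fun q => (hOm q).trans pm)
      (ρ ++ [e₁.denote O ρ]) (by
        intro k hk
        rcases List.mem_append.1 hk with hk | hk
        · exact (hρ k hk).trans pm
        · rw [List.mem_singleton.1 hk]; exact b₁.trans p₁)
    refine ⟨by rw [denote]; exact b₂.trans p₂, fun φ r f hr hφ h5 hf => ?_⟩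
    obtain ⟨f₁, hr₁, hv₁, hf₁⟩ := ih₁ φ r f hr hφ h5 hf
    obtain ⟨f₂, hr₂, hv₂, hf₂⟩ := ih₂ (φ ++ [r]) (r + 1) f₁ (by omega)
      (by
        intro x hx
        rcases List.mem_append.1 hx with hx | hx
        · exact (hφ x hx).trans (by omega)
        · rw [List.mem_singleton.1 hx]; omega)
      ((hf₁ _ hr).trans h5)
      (by rw [List.map_append, List.map_append, map_eq_of_lt hφ hf hf₁]; simp [hv₁])
    refine ⟨_, Runs.mono (.seq hr₁ (.seq hr₂ (runs_move _ _))) (by rw [cost]; omega), ?_, ?_⟩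
    · rw [Function.update_self, hv₂, denote]
    · intro x hx
      rw [Function.update_of_ne (by omega), hf₂ x (by omega), hf₁ x hx]
  | sum e₁ e₂ ih₁ ih₂ =>
    obtain ⟨w₁, ih₁⟩ := ih₁ m
    obtain ⟨w₂, ih₂⟩ := ih₂ (m + w₁)
    refine ⟨w₁ + w₂ + 1, fun n hn W hW H N O h w₀ hO hOm ρ hρ => ?_⟩
    have hn0 : 0 < n := by omega
    have p₁ : n ^ w₁ ≤ n ^ (m + w₁) := Nat.pow_le_pow_right hn0 (by omega)
    have p₂ : n ^ w₂ ≤ n ^ (w₁ + w₂) := Nat.pow_le_pow_right hn0 (by omega)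
    have p₁' : n ^ w₁ ≤ n ^ (w₁ + w₂) := Nat.pow_le_pow_right hn0 (by omega)
    have p₃ : n ^ (w₁ + w₂) * 2 ≤ n ^ (w₁ + w₂ + 1) := by
      rw [pow_succ]; exact Nat.mul_le_mul le_rfl hn
    have ppos : 0 < n ^ (w₁ + w₂) := Nat.pow_pos hn0
    have pm : n ^ m ≤ n ^ (m + w₁) := Nat.pow_le_pow_right hn0 (by omega)
    obtain ⟨b₁, ih₁⟩ := ih₁ n hn W ((Nat.pow_le_pow_right hn0 (by omega)).trans hW) H N O h w₀ hO hOm ρ hρ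
    have ih₂ := fun k (hk : k < e₁.denote O ρ) => ih₂ n hn W (by omega) H N O h w₀ hO
      (fun q => (hOm q).trans pm) (ρ ++ [k]) (by
        intro l hl
        rcases List.mem_append.1 hl with hl | hl
        · exact (hρ l hl).trans pm
        · rw [List.mem_singleton.1 hl]; omega)
    have hb : (Expr.sum e₁ e₂).denote O ρ ≤ n ^ (w₁ + w₂) := by
      rw [denote]
      calc _ ≤ ∑ k ∈ range (e₁.denote O ρ), n ^ w₂ :=
            sum_le_sum fun k hk => (ih₂ k (mem_range.1 hk)).1
        _ = e₁.denote O ρ * n ^ w₂ := by simp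
        _ ≤ n ^ w₁ * n ^ w₂ := Nat.mul_le_mul b₁ le_rfl
        _ = _ := (pow_add ..).symm
    refine ⟨by omega, fun φ r f hr hφ h5 hf => ?_⟩
    obtain ⟨f₁, hr₁, hv₁, hf₁⟩ := ih₁ φ r f hr hφ h5 hf
    set f₂ := Function.update (Function.update (Function.update f₁ (r + 1) (.int 0)) (r + 2) (.int 1))
      (r + 3) (.int 0) with hf₂
    have low : ∀ x < r + 1, f₂ x = f₁ x := fun x hx => by
      rw [hf₂, Function.update_of_ne (by omega), Function.update_of_ne (by omega),
        Function.update_of_ne (by omega)]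
    obtain ⟨f₃, hr₃, hv₃, hf₃⟩ := (sumLoop_spec (H := H) (N := N) (W := W) (r := r)
      (p := e₂.compile (φ ++ [r + 3]) (r + 4)) (g := f) (v := fun k => e₂.denote O (ρ ++ [k]))
      (c := fun k => e₂.cost O h (ρ ++ [k])) (m := e₁.denote O ρ) (by
        intro k hk f' hf' h3
        refine (ih₂ k hk).2 _ _ _ (by omega) ?_ ((hf' 5 hr).trans h5) ?_
        · intro x hx
          rcases List.mem_append.1 hx with hx | hx
          · exact (hφ x hx).trans (by omega)
          · rw [List.mem_singleton.1 hx]; omega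
        · rw [List.map_append, List.map_append, map_eq_of_lt hφ hf hf']; simp [h3])
      (by rw [← denote]; omega) (by omega) (e₁.denote O ρ) 0 (by omega) f₂
      (fun x hx => by rw [low x (by omega), hf₁ x hx]) ((low r (by omega)).trans hv₁)
      (by rw [hf₂, Function.update_of_ne (by omega), Function.update_of_ne (by omega),
            Function.update_self]; rfl)
      (by rw [hf₂, Function.update_of_ne (by omega), Function.update_self])
      (by rw [hf₂, Function.update_self]))
    refine ⟨_, Runs.mono (.seq hr₁ (.seq (runs_setInt _ _ (by omega)) (.seq (runs_setInt _ _ (by omega))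
      (.seq (runs_setInt _ _ (by omega)) (.seq hr₃ (runs_move _ _)))))) ?_, ?_, ?_⟩
    · simp only [cost, zero_add]; omega
    · rw [Function.update_self, hv₃, denote]
    · intro x hx
      rw [Function.update_of_ne (by omega), hf₃ x (by omega), low x (by omega), hf₁ x hx]
  | succ e ih =>
    obtain ⟨w₁, ih⟩ := ih m
    refine ⟨w₁ + m, fun n hn W hW H N O h w₀ hO hOm ρ hρ => ?_⟩
    have hn0 : 0 < n := by omega
    obtain ⟨b₁, ih⟩ := ih n hn W ((Nat.pow_le_pow_right hn0 (by omega)).trans hW) H N O h w₀ hO hOm ρ hρ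
    refine ⟨(hOm _).trans (Nat.pow_le_pow_right hn0 (by omega)), fun φ r f hr hφ h5 hf => ?_⟩
    obtain ⟨f₁, hr₁, hv₁, hf₁⟩ := ih φ r f hr hφ h5 hf
    obtain ⟨f₂, hr₂, hv₂, hf₂⟩ := hO f₁ r _ hr ((hf₁ _ hr).trans h5) hv₁
    exact ⟨f₂, Runs.seq hr₁ hr₂, hv₂, fun x hx => by rw [hf₂ x hx, hf₁ x hx]⟩
  | call is e ih =>
    obtain ⟨w, ih⟩ := ih m
    refine ⟨w, fun n hn W hW H N O h w₀ hO hOm ρ hρ => ?_⟩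
    obtain ⟨b, ih⟩ := ih n hn W hW H N O h w₀ hO hOm (is.filterMap fun i => ρ[i]?) (by
      intro k hk
      obtain ⟨i, -, hi⟩ := List.mem_filterMap.1 hk
      exact hρ k (List.mem_of_getElem? hi))
    refine ⟨b, fun φ r f hr hφ h5 hf => ih _ r f hr ?_ h5 ?_⟩
    · intro x hx
      obtain ⟨i, -, hi⟩ := List.mem_filterMap.1 hx
      exact hφ x (List.mem_of_getElem? hi)
    · rw [List.map_filterMap, List.map_filterMap]
      simp only [getElem?_eq hf]

end Expr

/-! ### The memory layout -/

/-- The smallest element of `S` that is at least `q`, or `0` if there is none. -/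
def succOf (S : Finset ℕ) (q : ℕ) : ℕ :=
  ((S.sort (· ≤ ·)).find? fun k => ¬ k < q).getD 0

theorem succOf_spec (S : Finset ℕ) (q : ℕ) :
    (succOf S q ∈ S ∧ q ≤ succOf S q ∧ ∀ s ∈ S, q ≤ s → succOf S q ≤ s) ∨
      (succOf S q = 0 ∧ ∀ s ∈ S, s < q) := by
  unfold succOf
  cases h : (S.sort (· ≤ ·)).find? fun k => ¬ k < q with
  | none =>
    right
    refine ⟨rfl, fun s hs => ?_⟩
    rw [List.find?_eq_none] at h
    simpa using h s (by simpa using hs)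
  | some k =>
    left
    rw [List.find?_eq_some_iff_append] at h
    obtain ⟨hk, l₁, l₂, hl, hlt⟩ := h
    have hsort := S.pairwise_sort (· ≤ ·)
    have hmem : ∀ s, s ∈ S ↔ s ∈ l₁ ∨ s = k ∨ s ∈ l₂ := fun s => by
      rw [← Finset.mem_sort (· ≤ ·), hl]; simp
    rw [hl, List.pairwise_append, List.pairwise_cons] at hsort
    refine ⟨(hmem k).2 (by simp), by simpa using hk, fun s hs hq => ?_⟩
    rcases (hmem s).1 hs with h | rfl | h
    · have : s < q := by simpa using hlt s h
      omega
    · exact le_rfl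
    · exact hsort.2.1.1 s h

theorem succOf_le {S : Finset ℕ} {m : ℕ} (h : ∀ s ∈ S, s ≤ m) (q : ℕ) : succOf S q ≤ m := by
  rcases succOf_spec S q with ⟨hs, -⟩ | ⟨h0, -⟩
  · exact h _ hs
  · omega

/-- The list in which the search tree for the set `S` stores every number with itself. -/
theorem find_setList (S : Finset ℕ) (q : ℕ) :
    ((((S.sort (· ≤ ·)).map fun k => (k, k)).find? fun a => ¬ a.1 < q).map Prod.snd).getD 0 =
      succOf S q := by
  rw [List.find?_map, Option.map_map, succOf]
  simp [Function.comp_def]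

/-- The distinct values of `f`, each with the number of smaller values (counted with multiplicity). -/
noncomputable def rankList {n : ℕ} (f : Fin n → ℝ) : List (ℝ × ℕ) :=
  ((univ.image f).sort (· ≤ ·)).map fun k => (k, #{i | f i < k})

theorem rankList_length_le {n : ℕ} (f : Fin n → ℝ) : (rankList f).length ≤ n := by
  rw [rankList, List.length_map, Finset.length_sort]
  exact card_image_le.trans (by simp)

/-- The first value beyond a lower set of reals comes with the number of values in that set. -/
theorem find_rankList {n : ℕ} (f : Fin n → ℝ) (p : ℝ → Prop) [DecidablePred p]
    (hp : ∀ x y, x ≤ y → p y → p x) :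
    (((rankList f).find? fun a => ¬ p a.1).map Prod.snd).getD n = #{i | p (f i)} := by
  rw [rankList, List.find?_map, Option.map_map]
  cases h : ((univ.image f).sort (· ≤ ·)).find?
      ((fun a : ℝ × ℕ => decide (¬ p a.1)) ∘ fun k => (k, #{i | f i < k})) with
  | none =>
    rw [List.find?_eq_none] at h
    have : ∀ i, p (f i) := fun i => by
      simpa using h (f i) (by simp)
    simp [this]
  | some k =>
    rw [List.find?_eq_some_iff_append] at h
    obtain ⟨hk, l₁, l₂, hl, hlt⟩ := h
    have hsort := (univ.image f).pairwise_sort (· ≤ ·)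
    have hmem : ∀ s, (∃ i, f i = s) ↔ s ∈ l₁ ∨ s = k ∨ s ∈ l₂ := fun s => by
      have : s ∈ (univ.image f).sort (· ≤ ·) ↔ ∃ i, f i = s := by simp
      rw [← this, hl]; simp
    rw [hl, List.pairwise_append, List.pairwise_cons] at hsort
    have hk' : ¬ p k := by simpa using hk
    simp only [Option.map_some, Option.getD_some, Function.comp]
    congr 1
    ext i
    simp only [mem_filter, mem_univ, true_and]
    constructor
    · intro hi
      rcases (hmem (f i)).1 ⟨i, rfl⟩ with h | h | h
      · simpa using hlt _ h
      · exact absurd hi (by rw [h]; exact lt_irrefl _)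
      · exact absurd hi (not_lt.2 (hsort.2.1.1 _ h))
    · intro hi
      by_contra h
      exact hk' (hp _ _ (not_lt.1 h) hi)

/-- The query program: it replaces the sides of the rectangle by their ranks, and evaluates `e` with
these and four numbers from the root as variables. -/
def mainProg (e : Expr) : Program 8 :=
  .seq (.instr (.load 5 4 0)) <| .seq (.instr (.load 6 4 1)) <| .seq (.instr (.load 7 4 2)) <|
  .seq (.instr (.load 9 4 4)) <| .seq (.instr (.load 10 4 5)) <| .seq (.instr (.load 11 4 6)) <|
  .seq (.instr (.load 12 4 7)) <|
  .seq (.instr (.load 13 4 3)) <| .seq (searchProg false 6 0 13) <|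
  .seq (.instr (.load 14 4 3)) <| .seq (searchProg true 6 1 14) <|
  .seq (.instr (.load 15 4 3)) <| .seq (searchProg false 7 2 15) <|
  .seq (.instr (.load 16 4 3)) <| .seq (searchProg true 7 3 16) <|
  .seq (e.compile [13, 14, 15, 16, 9, 10, 11, 12] 17) (.instr (.move 0 17))

theorem Word.Admissible.mono {n W N N' : ℕ} {P : Fin n → ℝ × ℝ} {v : Word}
    (h : v.Admissible W N P) (hN : N ≤ N') : v.Admissible W N' P := by
  cases v with
  | ptr a => exact lt_of_lt_of_le (show a < N from h) hN
  | _ => exact h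

/-- One rank computation of the query: load the default result, then search. -/
theorem rankStep_spec {W N n r x q s p : ℕ} {H : ℕ → Fin 8 → Word} {strict : Bool} {wq : Word}
    {f : ℕ → Word} {g : Fin n → ℝ} {Q : ℝ → Prop} [DecidablePred Q]
    (hP : DecidesRight Word.coord strict wq Q) (hQ : ∀ x y, x ≤ y → Q y → Q x)
    {t : Tree ℝ} (ht : t.toList = rankList g) (hp : t.height ≤ p) (hst : t.StoredAt Word.coord H N (f x))
    (hr : r < N) (hx : x < s) (hq : q < s) (h4 : f 4 = .ptr r)
    (hn : H r 3 = .int n) (hfq : f q = wq) :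
    ∃ f', (∀ p' σ u, Runs W p' ⟨f', H, N⟩ u σ →
        Runs W (.seq (.instr (.load s 4 3)) (.seq (searchProg strict x q s) p')) ⟨f, H, N⟩
          (6 * p + 7 + u) σ) ∧
      f' s = .int #{i | Q (g i)} ∧ ∀ y < s, f' y = f y := by
  set f₁ := Function.update f s (H r 3) with hf₁
  have low : ∀ y < s, f₁ y = f y := fun y hy => by rw [hf₁, Function.update_of_ne (by omega)]
  obtain ⟨f', hrun, hv, hf'⟩ := searchProg_spec hP W (H := H) (N := N) (p := x) hq
    (f := f₁) (d := n) (by rw [low x hx]; exact hst) (by rw [hf₁, Function.update_self, hn])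
    ((low q hq).trans hfq)
  refine ⟨f', fun p' σ u hu => Runs.mono (.seq (runs_load h4 hr) (.seq hrun hu)) (by omega), ?_,
    fun y hy => by rw [hf' y hy, low y hy]⟩
  rw [hv, Tree.search_eq, ht, find_rankList g Q hQ]
  rw [ht, rankList, List.pairwise_map]
  exact ((univ.image g).pairwise_sort (· ≤ ·)).imp fun h => hQ _ _ h

/-- Every expression has a query program: for all points `P` and all sets `S` of numbers polynomial in
`n` there is a structure of `#S + 2 n + 1` nodes from which the program evaluates the expression, where
`succ` is the successor function of `S`, at the ranks of the sides of the query rectangle. -/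
theorem exists_program (e : Expr) (m : ℕ) : ∃ (w : ℕ) (query : Program 8), ∀ n, 2 ≤ n →
    ∀ (P : Fin n → ℝ × ℝ) (S : Finset ℕ) (p B M X L : ℕ), (∀ s ∈ S, s ≤ n ^ m) → #S < 2 ^ p →
    B ≤ n ^ m → M ≤ n ^ m → X ≤ n ^ m → L ≤ n ^ m →
    ∃ D : DataStructure 8, D.WellFormed (n ^ w) P ∧ D.size ≤ #S + 2 * n + 1 ∧
    ∀ a b c d : ℝ, ∃ f' : ℕ → Word, Runs (n ^ w) query (D.start a b c d)
      (24 * (Nat.log 2 n + 1) + 36 + e.cost (succOf S) (6 * p + 8)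
        [#{i | (P i).1 < a}, #{i | (P i).1 ≤ b}, #{i | (P i).2 < c}, #{i | (P i).2 ≤ d}, B, M, X, L])
      ⟨f', D.heap, D.size⟩ ∧
      f' 0 = .int (e.denote (succOf S)
        [#{i | (P i).1 < a}, #{i | (P i).1 ≤ b}, #{i | (P i).2 < c}, #{i | (P i).2 ≤ d},
          B, M, X, L]) := by
  obtain ⟨w₀, hw₀⟩ := e.compile_spec (m + 1)
  refine ⟨w₀ + m + 1, mainProg e, fun n hn P S p B M X L hS hp hB hM hX hL => ?_⟩
  set W := n ^ (w₀ + m + 1) with hW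
  have hn0 : 0 < n := by omega
  have hmW : n ^ m ≤ W := Nat.pow_le_pow_right hn0 (by omega)
  have hm1 : n ^ m ≤ n ^ (m + 1) := Nat.pow_le_pow_right hn0 (by omega)
  have hnm : n ≤ n ^ (m + 1) := by
    calc n = n ^ 1 := (pow_one n).symm
      _ ≤ _ := Nat.pow_le_pow_right hn0 (by omega)
  have hnW : n ≤ W := hnm.trans (Nat.pow_le_pow_right hn0 (by omega))
  let A : ℕ → Word → Prop := fun N v => v.Admissible W N P
  have hA : ∀ N N' v, N ≤ N' → A N v → A N' v := fun N N' v h h' => Word.Admissible.mono h' h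
  have hlog : ∀ f : Fin n → ℝ, (rankList f).length < 2 ^ (Nat.log 2 n + 1) := fun f =>
    (rankList_length_le f).trans_lt (Nat.lt_pow_succ_log_self (by norm_num) n)
  obtain ⟨tS, htS, hhS⟩ := Tree.exists_balanced p ((S.sort (· ≤ ·)).map fun k => (k, k)) (by simpa using hp)
  obtain ⟨tx, htx, hhx⟩ := Tree.exists_balanced _ _ (hlog fun i => (P i).1)
  obtain ⟨ty, hty, hhy⟩ := Tree.exists_balanced _ _ (hlog fun i => (P i).2)
  obtain ⟨H₁, w₁, s₁, a₁, -, g₁⟩ := Tree.exists_storedAt Word.int A hA (fun _ => trivial)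
    (fun _ _ h => h) tS (by
      rw [htS]
      intro a ha N
      obtain ⟨k, hk, rfl⟩ := List.mem_map.1 ha
      have : k ≤ W := (hS k (by simpa using hk)).trans hmW
      exact ⟨this, this⟩) (fun _ _ => .nil) 0
  have rank_adm : ∀ f : Fin n → ℝ, (∀ i, ∃ j, f i = (P j).1 ∨ f i = (P j).2) → ∀ a ∈ rankList f,
      ∀ N, A N (.coord a.1) ∧ A N (.int a.2) := by
    intro f hf a ha N
    obtain ⟨k, hk, rfl⟩ := List.mem_map.1 ha
    obtain ⟨i, rfl⟩ : ∃ i, f i = k := by simpa using hk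
    have h : #{j | f j < f i} ≤ n := (card_filter_le _ _).trans (by simp)
    exact ⟨hf i, h.trans hnW⟩
  obtain ⟨H₂, w₂, s₂, a₂, e₂, g₂⟩ := Tree.exists_storedAt Word.coord A hA (fun _ => trivial)
    (fun _ _ h => h) tx (by rw [htx]; exact rank_adm _ fun i => ⟨i, .inl rfl⟩) H₁ (0 + tS.toList.length)
  obtain ⟨H₃, w₃, s₃, a₃, e₃, g₃⟩ := Tree.exists_storedAt Word.coord A hA (fun _ => trivial)
    (fun _ _ h => h) ty (by rw [hty]; exact rank_adm _ fun i => ⟨i, .inr rfl⟩) H₂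
    (0 + tS.toList.length + tx.toList.length)
  set N₁ := 0 + tS.toList.length with hN₁
  set N₂ := N₁ + tx.toList.length with hN₂
  set N₃ := N₂ + ty.toList.length with hN₃
  set H := Function.update H₃ N₃ ![w₁, w₂, w₃, .int n, .int B, .int M, .int X, .int L] with hH
  have eH : ∀ a < N₃, H a = H₃ a := fun a ha => by rw [hH, Function.update_of_ne (by omega)]
  have rH : H N₃ = ![w₁, w₂, w₃, .int n, .int B, .int M, .int X, .int L] := by
    rw [hH, Function.update_self]
  replace s₁ : tS.StoredAt Word.int H (N₃ + 1) w₁ := s₁.mono (by omega) fun a ha => by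
    rw [eH a (by omega), e₃ a (by omega), e₂ a ha]
  replace s₂ : tx.StoredAt Word.coord H (N₃ + 1) w₂ := s₂.mono (by omega) fun a ha => by
    rw [eH a (by omega), e₃ a (by omega)]
  replace s₃ : ty.StoredAt Word.coord H (N₃ + 1) w₃ := s₃.mono (by omega) fun a ha => by
    rw [eH a (by omega)]
  refine ⟨⟨N₃ + 1, N₃, H⟩, ⟨Nat.lt_succ_self _, fun a ha g => ?_⟩, ?_, fun a b c d => ?_⟩
  · change a < N₃ + 1 at ha
    change A (N₃ + 1) (H a g)
    rcases Nat.lt_or_ge a N₃ with h3 | h3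
    · rw [eH a h3]
      rcases Nat.lt_or_ge a N₂ with h2 | h2
      · rw [e₃ a h2]
        rcases Nat.lt_or_ge a N₁ with h1 | h1
        · rw [e₂ a h1]
          exact hA N₁ _ _ (by omega) (g₁ a (by omega) h1 g)
        · exact hA N₂ _ _ (by omega) (g₂ a h1 h2 g)
      · exact hA N₃ _ _ (by omega) (g₃ a h2 h3 g)
    · obtain rfl : a = N₃ := by omega
      rw [rH]
      fin_cases g
      · exact hA N₁ _ _ (by omega) a₁
      · exact hA N₂ _ _ (by omega) a₂
      · exact hA N₃ _ _ (by omega) a₃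
      · exact hnW
      · exact hB.trans hmW
      · exact hM.trans hmW
      · exact hX.trans hmW
      · exact hL.trans hmW
  · have h1 : tS.toList.length = #S := by rw [htS]; simp
    have h2 : tx.toList.length ≤ n := by rw [htx]; exact rankList_length_le _
    have h3 : ty.toList.length ≤ n := by rw [hty]; exact rankList_length_le _
    change N₃ + 1 ≤ _
    omega
  · set D : DataStructure 8 := ⟨N₃ + 1, N₃, H⟩ with hD
    set f₀ := (D.start a b c d).reg with hf₀
    have hr : N₃ < N₃ + 1 := Nat.lt_succ_self _
    set f₁ := Function.update (Function.update (Function.update (Function.update (Function.update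
      (Function.update (Function.update f₀ 5 w₁) 6 w₂) 7 w₃) 9 (.int B)) 10 (.int M)) 11 (.int X))
      12 (.int L) with hf₁
    have load_run : ∀ p' σ u, Runs W p' ⟨f₁, H, N₃ + 1⟩ u σ → Runs W
        (.seq (.instr (.load 5 4 0)) <| .seq (.instr (.load 6 4 1)) <| .seq (.instr (.load 7 4 2)) <|
        .seq (.instr (.load 9 4 4)) <| .seq (.instr (.load 10 4 5)) <| .seq (.instr (.load 11 4 6)) <|
        .seq (.instr (.load 12 4 7)) p') (D.start a b c d) (7 + u) σ := by
      intro p' σ u hu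
      have h4 : f₀ 4 = .ptr N₃ := rfl
      have key : ∀ (f : ℕ → Word) (x : ℕ) (g : Fin 8) (v : Word), f 4 = .ptr N₃ → H N₃ g = v →
          ∀ p' u, Runs W p' ⟨Function.update f x v, H, N₃ + 1⟩ u σ →
          Runs W (.seq (.instr (.load x 4 g)) p') ⟨f, H, N₃ + 1⟩ (1 + u) σ := by
        rintro f x g v hf rfl p' u hu
        exact .seq (runs_load hf hr) hu
      refine Runs.mono (key f₀ 5 0 w₁ h4 (by rw [rH]; rfl) _ _ (key _ 6 1 w₂ (by simp [h4])
        (by rw [rH]; rfl) _ _ (key _ 7 2 w₃ (by simp [h4]) (by rw [rH]; rfl) _ _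
        (key _ 9 4 (.int B) (by simp [h4]) (by rw [rH]; rfl) _ _ (key _ 10 5 (.int M) (by simp [h4])
        (by rw [rH]; rfl) _ _ (key _ 11 6 (.int X) (by simp [h4]) (by rw [rH]; rfl) _ _
        (key _ 12 7 (.int L) (by simp [h4]) (by rw [rH]; rfl) _ _ hu))))))) (by omega)
    have v0 : f₁ 0 = .coord a := by simp [hf₁, hf₀, DataStructure.start]
    have v1 : f₁ 1 = .coord b := by simp [hf₁, hf₀, DataStructure.start]
    have v2 : f₁ 2 = .coord c := by simp [hf₁, hf₀, DataStructure.start]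
    have v3 : f₁ 3 = .coord d := by simp [hf₁, hf₀, DataStructure.start]
    have v4 : f₁ 4 = .ptr N₃ := by simp [hf₁, hf₀, DataStructure.start, hD]
    have v5 : f₁ 5 = w₁ := by simp [hf₁]
    have v6 : f₁ 6 = w₂ := by simp [hf₁]
    have v7 : f₁ 7 = w₃ := by simp [hf₁]
    have v9 : f₁ 9 = .int B := by simp [hf₁]
    have v10 : f₁ 10 = .int M := by simp [hf₁]
    have v11 : f₁ 11 = .int X := by simp [hf₁]
    have v12 : f₁ 12 = .int L := by simp [hf₁]
    clear_value f₁
    have r3 : H N₃ 3 = .int n := by rw [rH]; rfl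
    obtain ⟨f₂, run₂, val₂, low₂⟩ := rankStep_spec (W := W) (x := 6) (s := 13) (f := f₁)
      (decidesRight_coord_lt a) (fun x y h h' => h.trans_lt h') htx hhx (by rw [v6]; exact s₂) hr
      (by norm_num) (by norm_num) v4 r3 v0
    obtain ⟨f₃, run₃, val₃, low₃⟩ := rankStep_spec (W := W) (x := 6) (s := 14) (f := f₂)
      (decidesRight_coord_le b) (fun x y h h' => h.trans h') htx hhx
      (by rw [low₂ 6 (by norm_num), v6]; exact s₂) hr
      (by norm_num) (by norm_num) ((low₂ 4 (by norm_num)).trans v4) r3 ((low₂ 1 (by norm_num)).trans v1)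
    obtain ⟨f₄, run₄, val₄, low₄⟩ := rankStep_spec (W := W) (x := 7) (q := 2) (s := 15) (f := f₃)
      (decidesRight_coord_lt c) (fun x y h h' => h.trans_lt h') hty hhy
      (by rw [low₃ 7 (by norm_num), low₂ 7 (by norm_num), v7]; exact s₃) hr (by norm_num) (by norm_num)
      (by rw [low₃ 4 (by norm_num), low₂ 4 (by norm_num), v4]) r3
      (by rw [low₃ 2 (by norm_num), low₂ 2 (by norm_num), v2])
    obtain ⟨f₅, run₅, val₅, low₅⟩ := rankStep_spec (W := W) (x := 7) (q := 3) (s := 16) (f := f₄)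
      (decidesRight_coord_le d) (fun x y h h' => h.trans h') hty hhy
      (by rw [low₄ 7 (by norm_num), low₃ 7 (by norm_num), low₂ 7 (by norm_num), v7]; exact s₃) hr
      (by norm_num) (by norm_num)
      (by rw [low₄ 4 (by norm_num), low₃ 4 (by norm_num), low₂ 4 (by norm_num), v4]) r3
      (by rw [low₄ 3 (by norm_num), low₃ 3 (by norm_num), low₂ 3 (by norm_num), v3])
    have low : ∀ y < 13, f₅ y = f₁ y := fun y hy => by
      rw [low₅ y (by omega), low₄ y (by omega), low₃ y (by omega), low₂ y hy]
    have oracle : Expr.OracleAt H (N₃ + 1) W w₁ (succOf S) (6 * p + 8) := by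
      intro f r q hr5 h5 hq
      set g := Function.update f (r + 1) (.int 0) with hg
      obtain ⟨f', hrun, hv, hf'⟩ := searchProg_spec (decidesRight_int q) W (H := H) (N := N₃ + 1)
        (p := 5) (q := r) (s := r + 1) (by omega) (t := tS) (f := g) (d := 0)
        (by rw [hg, Function.update_of_ne (by omega), h5]; exact s₁)
        (by rw [hg, Function.update_self]) (by rw [hg, Function.update_of_ne (by omega), hq])
      refine ⟨_, Runs.mono (.seq (runs_setInt _ _ (Nat.zero_le _)) (.seq hrun (runs_move _ _)))
        (by omega), ?_, fun x hx => ?_⟩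
      · rw [Function.update_self, hv, Tree.search_eq, htS, find_setList]
        rw [htS, List.pairwise_map]
        exact (S.pairwise_sort (· ≤ ·)).imp fun h h' => lt_of_le_of_lt h h'
      · rw [Function.update_of_ne (by omega), hf' x (by omega), hg, Function.update_of_ne (by omega)]
    have hcard : ∀ (Q : Fin n → Prop) [DecidablePred Q], #{i | Q i} ≤ n ^ (m + 1) := fun Q _ =>
      ((card_filter_le _ _).trans (by simp)).trans hnm
    set ρ := [#{i | (P i).1 < a}, #{i | (P i).1 ≤ b}, #{i | (P i).2 < c}, #{i | (P i).2 ≤ d},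
      B, M, X, L] with hρ
    obtain ⟨f₆, run₆, val₆, -⟩ := (hw₀ n hn W (Nat.pow_le_pow_right hn0 (by omega)) H (N₃ + 1)
      (succOf S) (6 * p + 8) w₁ oracle (succOf_le fun s hs => (hS s hs).trans hm1) ρ (by
        intro k hk
        simp only [hρ, List.mem_cons, List.not_mem_nil, or_false] at hk
        rcases hk with rfl | rfl | rfl | rfl | rfl | rfl | rfl | rfl
        · exact hcard _
        · exact hcard _
        · exact hcard _
        · exact hcard _
        all_goals omega)).2 [13, 14, 15, 16, 9, 10, 11, 12] 17 f₅ (by norm_num) (by simp)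
      (by rw [low 5 (by norm_num), v5])
      (by
        simp only [List.map_cons, List.map_nil, hρ, val₅, low₅ 15 (by norm_num), val₄,
          low₅ 14 (by norm_num), low₄ 14 (by norm_num), val₃, low₅ 13 (by norm_num),
          low₄ 13 (by norm_num), low₃ 13 (by norm_num), val₂, low 9 (by norm_num), v9,
          low 10 (by norm_num), v10, low 11 (by norm_num), v11, low 12 (by norm_num), v12])
    refine ⟨Function.update f₆ 0 (f₆ 17), ?_, by rw [Function.update_self, val₆]⟩
    exact Runs.mono (load_run _ _ _ (run₂ _ _ _ (run₃ _ _ _ (run₄ _ _ _ (run₅ _ _ _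
      (.seq run₆ (runs_move _ _))))))) (by omega)

/-! ### The query, as an expression -/

namespace Expr

instance : Add Expr := ⟨.op .add⟩
instance : Sub Expr := ⟨.op .sub⟩
instance : Mul Expr := ⟨.op .mul⟩
instance : Div Expr := ⟨.op .div⟩
instance (k : ℕ) : OfNat Expr k := ⟨.const k⟩

section Ops

variable (O : ℕ → ℕ) (h : ℕ) (ρ : List ℕ) (e e' : Expr)

theorem denote_sub : (e - e').denote O ρ = e.denote O ρ - e'.denote O ρ := rfl
theorem denote_div : (e / e').denote O ρ = e.denote O ρ / e'.denote O ρ := rfl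
theorem cost_sub : (e - e').cost O h ρ = e.cost O h ρ + e'.cost O h ρ + 3 := rfl
theorem cost_div : (e / e').cost O h ρ = e.cost O h ρ + e'.cost O h ρ + 3 := rfl

end Ops

/-- Table access.  Variables: `B, pre, z`. -/
def accE : Expr :=
  letE (succ ((var 1 * var 0 + var 2) * var 0))
    (ifle (var 3 / var 0 / var 0) (var 1) (var 3 - var 3 / var 0 * var 0) 0)

/-- A power of two.  Variables: `B, i`. -/
def powE : Expr := call [0, 0, 1] accE

/-- The code of a list.  Variables: `B, hs, g, s, u, t, v`. -/
def lamE : Expr :=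
  ((((var 1 * var 0 + var 2) * var 0 + var 3) * var 0 + var 4) * var 0 + var 5) * var 0 + var 6

/-- The size of the two sibling dyadic blocks that separate `a` from `b`.  Variables: `a, b, B, L`. -/
def lcaE : Expr :=
  sum (var 3) (letE (call [2, 4] powE)
    (ifle (var 0 / var 5 + 1) (var 1 / var 5)
      (ifle (var 1 / (var 5 * 2)) (var 0 / (var 5 * 2)) (var 5) 0) 0))

/-- The number of elements of a list with priority at least `τ`.  Variables: `B, lam, τ`. -/
def cntE : Expr := letE (var 1 * var 0 + 2) (call [0, 3, 2] accE)

/-- The inner loop of `forListsE`. -/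
def innerListsE (body : Expr) : Expr :=
  letE (call [5, 16] powE) (letE (var 4 / var 17)
    (letE (call [5, 0, 1, 14, 15, 17, 18] lamE) body))

/-- The sum of `body` over all lists that contribute to the point `(c, d)`.  Variables:
`hs, g, τ, c, d, B, X, L` and five others, which are passed on to `body`, after which come
`i, s, u, j, t, v, lam`. -/
def forListsE (body : Expr) : Expr :=
  sum (var 7) (letE (call [5, 13] powE) (letE (var 3 / var 14) (sum (var 7) (innerListsE body))))

/-- The number of colors on one side. -/
def sizeE : Expr := forListsE (call [5, 19, 2] cntE)

/-- The inner sum of `matE`; variable `8` is the row of the matrix. -/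
def matRowE : Expr :=
  forListsE (letE (call [5, 19, 2] cntE / var 6)
    (letE ((var 8 * (var 5 * var 5 * var 5 * var 5 * var 5 * var 5 * var 5) +
      (var 19 * var 5 + var 20)) * var 5 + 3) (letE 0 (call [5, 21, 22] accE))))

/-- The number of common colors of full blocks.  Variables `8, 9` are `g, τ` of the other side. -/
def matE : Expr :=
  forListsE (letE (call [5, 19, 2] cntE / var 6) (letE (var 19 * var 5 + var 20)
    (call [0, 8, 9, 3, 4, 5, 6, 7, 21, 0, 0, 0, 0] matRowE)))

/-- The largest priority, plus one, of a point of a given color with second coordinate in `[c, d]`.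
Variables: `hs, g, c, d, B, sy, M, χ`. -/
def topE : Expr :=
  letE (var 2 / var 5) <| letE (var 3 / var 5) <| letE (var 6 - var 3) <|
  letE (((((var 0 * var 4 + var 1) * var 4 + var 5) * var 4 + var 8) * var 4 + var 7) * var 4 + 4) <|
  letE (((((var 0 * var 4 + var 1) * var 4 + var 5) * var 4 + var 9) * var 4 + var 7) * var 4 + 4) <|
  letE (call [4, 11, 2] accE) <| letE (call [4, 12, 10] accE) <|
  ifle (var 13) (var 14) (var 14) (var 13)

/-- Whether the representative with priority `z - 1` is in a full block of its list.  Variables: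
`hs, g, τ, c, d, B, X, z`. -/
def fullE : Expr :=
  letE (var 7 - 1) <| letE (((var 0 * var 5 + var 1) * var 5 + var 8) * var 5 + 5) <|
  letE (((var 0 * var 5 + var 1) * var 5 + var 8) * var 5 + 6) <|
  letE (call [5, 9, 3] accE) <| letE (call [5, 10, 4] accE) <|
  letE (var 3 / var 11) <| letE (var 4 / var 12) <|
  letE (call [5, 0, 1, 11, 13, 12, 14] lamE) <| letE (call [5, 15, 8] cntE) <|
  letE (call [5, 15, 2] cntE / var 6 * var 6) <| ifle (var 16) (var 17) 1 0

/-- Whether a color occurs on one side, and, if `F ≠ 0`, in a full block.  Variables: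
`hs, g, τ, c, d, B, X, L, sy, M, F, χ`. -/
def checkE : Expr :=
  letE (call [0, 1, 3, 4, 5, 8, 9, 11] topE) <|
  ifle (var 12) (var 2) 0 (ifle (var 10) 0 1 (call [0, 1, 2, 3, 4, 5, 6, 12] fullE))

/-- The number of elements outside full blocks whose color passes `checkE` on the other side.
Variables `8, …, 12`: `g, τ` of the other side, `sy, M, F`. -/
def leftoverE : Expr :=
  forListsE (letE (call [5, 19, 2] cntE) <| letE (var 20 / var 6 * var 6) <|
    sum (var 20 - var 21) (letE (var 21 + 1 + var 22) <| letE (var 19 * var 5 + 1) <|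
      letE (call [5, 24, 23] accE) (call [0, 8, 9, 3, 4, 5, 6, 7, 10, 11, 12, 25] checkE)))

/-- The number of colors.  Variables: `hs, g, τ, g', τ', c, d, B, X, L, sy, M`. -/
def nodeE : Expr :=
  letE 0 <| letE 1 <|
  (call [0, 1, 2, 5, 6, 7, 8, 9, 3, 4, 10, 11, 12] sizeE +
    call [0, 3, 4, 5, 6, 7, 8, 9, 1, 2, 10, 11, 12] sizeE) -
  (call [0, 1, 2, 5, 6, 7, 8, 9, 3, 4, 10, 11, 12] matE +
    call [0, 1, 2, 5, 6, 7, 8, 9, 3, 4, 10, 11, 12] leftoverE +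
    call [0, 3, 4, 5, 6, 7, 8, 9, 1, 2, 10, 11, 13] leftoverE)

/-- The whole query.  Variables: the ranks of the sides, and `B, M, X, L`. -/
def queryE : Expr :=
  letE (2 * var 0) <| letE (2 * var 1) <| letE (2 * var 2) <| letE (2 * var 3) <|
  letE (call [8, 9, 4, 7] lcaE) <| letE (call [10, 11, 4, 7] lcaE) <|
  ifle 1 (var 12) (ifle 1 (var 13)
    (letE (var 8 / var 12) <| letE (var 9 / var 12) <| letE (var 5 - var 9) <|
      call [12, 14, 8, 15, 16, 10, 11, 4, 6, 7, 13, 5] nodeE) 0) 0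

section

variable (O : ℕ → ℕ) (h : ℕ)

/-- The value of `accE`. -/
def acc (B pre z : ℕ) : ℕ :=
  let r := O ((pre * B + z) * B)
  if r / B / B ≤ pre then r - r / B * B else 0

theorem denote_accE (B pre z : ℕ) : accE.denote O [B, pre, z] = acc O B pre z := by
  simp [accE, denote, ArithOp.total, denote_sub, denote_div, acc]

theorem denote_powE (B i : ℕ) : powE.denote O [B, i] = acc O B B i := by
  simp [powE, denote, denote_accE]

/-- The value of `lamE`. -/
def lam (B hs g s u t v : ℕ) : ℕ := ((((hs * B + g) * B + s) * B + u) * B + t) * B + v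

theorem denote_lamE (B hs g s u t v : ℕ) :
    lamE.denote O [B, hs, g, s, u, t, v] = lam B hs g s u t v := by
  simp [lamE, denote, ArithOp.total, lam]

/-- The value of `cntE`. -/
def cnt (B l τ : ℕ) : ℕ := acc O B (l * B + 2) τ

theorem denote_cntE (B l τ : ℕ) : cntE.denote O [B, l, τ] = cnt O B l τ := by
  simp [cntE, denote, ArithOp.total, cnt, denote_accE]

theorem denote_lcaE (a b B L : ℕ) : lcaE.denote O [a, b, B, L] = ∑ k ∈ range L,
    if a / acc O B B k + 1 ≤ b / acc O B B k then
      if b / (acc O B B k * 2) ≤ a / (acc O B B k * 2) then acc O B B k else 0 else 0 := by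
  simp [lcaE, denote, ArithOp.total, denote_div, denote_powE]

theorem denote_forListsE (body : Expr) (hs g τ c d B X L e₁ e₂ e₃ e₄ e₅ : ℕ) :
    (forListsE body).denote O [hs, g, τ, c, d, B, X, L, e₁, e₂, e₃, e₄, e₅] =
      ∑ i ∈ range L, ∑ j ∈ range L, body.denote O [hs, g, τ, c, d, B, X, L, e₁, e₂, e₃, e₄, e₅,
        i, acc O B B i, c / acc O B B i, j, acc O B B j, d / acc O B B j,
        lam B hs g (acc O B B i) (c / acc O B B i) (acc O B B j) (d / acc O B B j)] := by
  simp [forListsE, innerListsE, denote, denote_div, denote_powE, denote_lamE]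

theorem denote_sizeE (hs g τ c d B X L e₁ e₂ e₃ e₄ e₅ : ℕ) :
    sizeE.denote O [hs, g, τ, c, d, B, X, L, e₁, e₂, e₃, e₄, e₅] =
      ∑ i ∈ range L, ∑ j ∈ range L, cnt O B (lam B hs g (acc O B B i) (c / acc O B B i)
        (acc O B B j) (d / acc O B B j)) τ := by
  simp [sizeE, denote_forListsE, denote, denote_cntE]

theorem denote_matE (hs g τ c d B X L g' τ' e₃ e₄ e₅ : ℕ) :
    matE.denote O [hs, g, τ, c, d, B, X, L, g', τ', e₃, e₄, e₅] =
      ∑ i ∈ range L, ∑ j ∈ range L, ∑ i' ∈ range L, ∑ j' ∈ range L,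
        let l := lam B hs g (acc O B B i) (c / acc O B B i) (acc O B B j) (d / acc O B B j)
        let l' := lam B hs g' (acc O B B i') (c / acc O B B i') (acc O B B j') (d / acc O B B j')
        acc O B (((l * B + cnt O B l τ / X) * (B * B * B * B * B * B * B) +
          (l' * B + cnt O B l' τ' / X)) * B + 3) 0 := by
  simp [matE, matRowE, denote_forListsE, denote, ArithOp.total, denote_div, denote_cntE, denote_accE]

/-- The value of `topE`. -/
def top (hs g c d B sy M χ : ℕ) : ℕ :=
  max (acc O B (((((hs * B + g) * B + sy) * B + c / sy) * B + χ) * B + 4) c)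
    (acc O B (((((hs * B + g) * B + sy) * B + d / sy) * B + χ) * B + 4) (M - d))

theorem denote_topE (hs g c d B sy M χ : ℕ) :
    topE.denote O [hs, g, c, d, B, sy, M, χ] = top O hs g c d B sy M χ := by
  rw [top, max_def]
  simp [topE, denote, ArithOp.total, denote_sub, denote_div, denote_accE]

/-- The value of `fullE`. -/
def full (hs g τ c d B X z : ℕ) : ℕ :=
  let s := acc O B (((hs * B + g) * B + (z - 1)) * B + 5) c
  let t := acc O B (((hs * B + g) * B + (z - 1)) * B + 6) d
  let l := lam B hs g s (c / s) t (d / t)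
  if cnt O B l (z - 1) ≤ cnt O B l τ / X * X then 1 else 0

theorem denote_fullE (hs g τ c d B X z : ℕ) :
    fullE.denote O [hs, g, τ, c, d, B, X, z] = full O hs g τ c d B X z := by
  simp [fullE, denote, ArithOp.total, denote_sub, denote_div, denote_accE, denote_cntE, denote_lamE, full]

/-- The value of `checkE`. -/
def check (hs g τ c d B X sy M F χ : ℕ) : ℕ :=
  if top O hs g c d B sy M χ ≤ τ then 0
  else if F ≤ 0 then 1 else full O hs g τ c d B X (top O hs g c d B sy M χ)

theorem denote_checkE (hs g τ c d B X L sy M F χ : ℕ) :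
    checkE.denote O [hs, g, τ, c, d, B, X, L, sy, M, F, χ] =
      check O hs g τ c d B X sy M F χ := by
  simp [checkE, denote, denote_topE, denote_fullE, check]

theorem denote_leftoverE (hs g τ c d B X L g' τ' sy M F : ℕ) :
    leftoverE.denote O [hs, g, τ, c, d, B, X, L, g', τ', sy, M, F] =
      ∑ i ∈ range L, ∑ j ∈ range L,
        let l := lam B hs g (acc O B B i) (c / acc O B B i) (acc O B B j) (d / acc O B B j)
        ∑ k ∈ range (cnt O B l τ - cnt O B l τ / X * X),
          check O hs g' τ' c d B X sy M F (acc O B (l * B + 1) (cnt O B l τ / X * X + 1 + k)) := by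
  simp [leftoverE, denote_forListsE, denote, ArithOp.total, denote_sub, denote_div,
    denote_accE, denote_cntE, denote_checkE]

theorem denote_nodeE (hs g τ g' τ' c d B X L sy M : ℕ) :
    nodeE.denote O [hs, g, τ, g', τ', c, d, B, X, L, sy, M] =
      (sizeE.denote O [hs, g, τ, c, d, B, X, L, g', τ', sy, M, 0] +
        sizeE.denote O [hs, g', τ', c, d, B, X, L, g, τ, sy, M, 0]) -
      (matE.denote O [hs, g, τ, c, d, B, X, L, g', τ', sy, M, 0] +
        leftoverE.denote O [hs, g, τ, c, d, B, X, L, g', τ', sy, M, 0] +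
        leftoverE.denote O [hs, g', τ', c, d, B, X, L, g, τ, sy, M, 1]) := by
  simp [nodeE, denote, ArithOp.total, denote_sub]

theorem denote_queryE (ra rb rc rd B M X L : ℕ) :
    queryE.denote O [ra, rb, rc, rd, B, M, X, L] =
      let hs := lcaE.denote O [2 * ra, 2 * rb, B, L]
      let sy := lcaE.denote O [2 * rc, 2 * rd, B, L]
      if 1 ≤ hs then if 1 ≤ sy then nodeE.denote O [hs, 2 * ra / hs, 2 * ra, 2 * rb / hs, M - 2 * rb,
        2 * rc, 2 * rd, B, X, L, sy, M] else 0 else 0 := by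
  simp [queryE, denote, ArithOp.total, denote_sub, denote_div]

/-! ### The cost of the query -/

theorem cost_accE_le (B pre z : ℕ) : accE.cost O h [B, pre, z] ≤ h + 40 := by
  simp [accE, cost, cost_sub, cost_div]
  split_ifs <;> omega

theorem cost_powE_le (B i : ℕ) : powE.cost O h [B, i] ≤ h + 40 := cost_accE_le ..

theorem cost_lamE_le (B hs g s u t v : ℕ) : lamE.cost O h [B, hs, g, s, u, t, v] ≤ 41 := by
  simp [lamE, cost]

theorem cost_cntE_le (B l τ : ℕ) : cntE.cost O h [B, l, τ] ≤ h + 60 := by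
  have := cost_accE_le O h B (l * B + 2) τ
  simp [cntE, cost, denote, ArithOp.total]
  omega

theorem cost_lcaE_le (a b B L : ℕ) : lcaE.cost O h [a, b, B, L] ≤ (L + 1) * (h + 100) := by
  rw [lcaE, cost]
  have : ∀ k ∈ range L, (letE (call [2, 4] powE)
    (ifle (var 0 / var 5 + 1) (var 1 / var 5)
      (ifle (var 1 / (var 5 * 2)) (var 0 / (var 5 * 2)) (var 5) 0) 0)).cost O h ([a, b, B, L] ++ [k]) + 5
      ≤ h + 100 := by
    intro k _
    have := cost_powE_le O h B k
    simp [cost, cost_div]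
    split_ifs <;> omega
  have := sum_le_sum this
  simp [denote, denote_div, cost, cost_div] at this ⊢
  nlinarith

theorem cost_innerListsE_le (body : Expr) (hs g τ c d B X L e₁ e₂ e₃ e₄ e₅ i s u j C : ℕ)
    (hC : body.cost O h [hs, g, τ, c, d, B, X, L, e₁, e₂, e₃, e₄, e₅, i, s, u, j, acc O B B j,
        d / acc O B B j, lam B hs g s u (acc O B B j) (d / acc O B B j)] ≤ C) :
    (innerListsE body).cost O h [hs, g, τ, c, d, B, X, L, e₁, e₂, e₃, e₄, e₅, i, s, u, j] + 5 ≤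
      h + 110 + C := by
  have h1 := cost_powE_le O h B j
  have h2 := cost_lamE_le O h B hs g s u (acc O B B j) (d / acc O B B j)
  simp [innerListsE, cost, cost_div, denote, denote_div, denote_powE, denote_lamE]
  omega

theorem cost_forListsE_le (body : Expr) (hs g τ c d B X L e₁ e₂ e₃ e₄ e₅ C : ℕ)
    (hC : ∀ i j, body.cost O h [hs, g, τ, c, d, B, X, L, e₁, e₂, e₃, e₄, e₅,
        i, acc O B B i, c / acc O B B i, j, acc O B B j, d / acc O B B j,
        lam B hs g (acc O B B i) (c / acc O B B i) (acc O B B j) (d / acc O B B j)] ≤ C) :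
    (forListsE body).cost O h [hs, g, τ, c, d, B, X, L, e₁, e₂, e₃, e₄, e₅] ≤
      (L + 1) ^ 2 * (h + 110 + C) := by
  have outer : ∀ i, (letE (call [5, 13] powE) (letE (var 3 / var 14)
      (sum (var 7) (innerListsE body)))).cost O h
      [hs, g, τ, c, d, B, X, L, e₁, e₂, e₃, e₄, e₅, i] + 5 ≤ h + 70 + L * (h + 110 + C) := by
    intro i
    have h1 := cost_powE_le O h B i
    have h2 := sum_le_sum fun j (_ : j ∈ range L) => cost_innerListsE_le O h body hs g τ c d B X L
      e₁ e₂ e₃ e₄ e₅ i (acc O B B i) (c / acc O B B i) j C (hC i j)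
    rw [sum_const, card_range, smul_eq_mul, sum_add_distrib] at h2
    simp [cost, cost_div, denote, denote_div, denote_powE, sum_add_distrib] at h2 ⊢
    omega
  have h2 := sum_le_sum fun i (_ : i ∈ range L) => outer i
  rw [sum_const, card_range, smul_eq_mul] at h2
  have h3 : (forListsE body).cost O h [hs, g, τ, c, d, B, X, L, e₁, e₂, e₃, e₄, e₅] ≤
      6 + L * (h + 70 + L * (h + 110 + C)) := by
    rw [forListsE, cost]
    exact Nat.add_le_add_left h2 6
  refine h3.trans ?_
  nlinarith [Nat.zero_le (L * h), Nat.zero_le (L * C), Nat.zero_le (L * L)]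

theorem cost_sizeE_le (hs g τ c d B X L e₁ e₂ e₃ e₄ e₅ : ℕ) :
    sizeE.cost O h [hs, g, τ, c, d, B, X, L, e₁, e₂, e₃, e₄, e₅] ≤
      (L + 1) ^ 2 * (2 * (h + 110)) := by
  refine (cost_forListsE_le O h _ _ _ _ _ _ _ _ _ _ _ _ _ _ (h + 60) fun i j => ?_).trans
    (Nat.mul_le_mul le_rfl (by omega))
  simpa [cost] using cost_cntE_le O h _ _ _

theorem cost_matRowE_le (hs g τ c d B X L e₁ e₂ e₃ e₄ e₅ : ℕ) :
    matRowE.cost O h [hs, g, τ, c, d, B, X, L, e₁, e₂, e₃, e₄, e₅] ≤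
      (L + 1) ^ 2 * (4 * (h + 110)) := by
  refine (cost_forListsE_le O h _ _ _ _ _ _ _ _ _ _ _ _ _ _ (2 * h + 250) fun i j => ?_).trans
    (Nat.mul_le_mul le_rfl (by omega))
  have h1 := cost_cntE_le O h B
    (lam B hs g (acc O B B i) (c / acc O B B i) (acc O B B j) (d / acc O B B j)) τ
  have h2 := cost_accE_le O h B ((e₁ * (B * B * B * B * B * B * B) +
    (lam B hs g (acc O B B i) (c / acc O B B i) (acc O B B j) (d / acc O B B j) * B +
      cnt O B (lam B hs g (acc O B B i) (c / acc O B B i) (acc O B B j) (d / acc O B B j)) τ / X)) *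
    B + 3) 0
  simp [cost, cost_div, denote, denote_div, denote_cntE, ArithOp.total]
  omega

theorem cost_matE_le (hs g τ c d B X L e₁ e₂ e₃ e₄ e₅ : ℕ) :
    matE.cost O h [hs, g, τ, c, d, B, X, L, e₁, e₂, e₃, e₄, e₅] ≤
      (L + 1) ^ 4 * (7 * (h + 110)) := by
  have hQ : 1 ≤ (L + 1) ^ 2 := Nat.one_le_pow _ _ (by omega)
  refine (cost_forListsE_le O h _ _ _ _ _ _ _ _ _ _ _ _ _ _
    (2 * (h + 110) + (L + 1) ^ 2 * (4 * (h + 110))) fun i j => ?_).trans ?_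
  · have h1 := cost_cntE_le O h B
      (lam B hs g (acc O B B i) (c / acc O B B i) (acc O B B j) (d / acc O B B j)) τ
    have h2 := cost_matRowE_le O h hs e₁ e₂ c d B X L
      (lam B hs g (acc O B B i) (c / acc O B B i) (acc O B B j) (d / acc O B B j) * B +
        cnt O B (lam B hs g (acc O B B i) (c / acc O B B i) (acc O B B j) (d / acc O B B j)) τ / X)
      hs hs hs hs
    simp [cost, cost_div, denote, denote_div, denote_cntE, ArithOp.total]
    omega
  · calc _ ≤ (L + 1) ^ 2 * ((L + 1) ^ 2 * (7 * (h + 110))) := Nat.mul_le_mul le_rfl (by nlinarith)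
      _ = _ := by ring

theorem cost_topE_le (hs g c d B sy M χ : ℕ) :
    topE.cost O h [hs, g, c, d, B, sy, M, χ] ≤ 2 * h + 300 := by
  have h1 := fun p z => cost_accE_le O h B p z
  simp [topE, cost, cost_sub, cost_div, denote, denote_sub, denote_div, ArithOp.total]
  have := h1 (((((hs * B + g) * B + sy) * B + c / sy) * B + χ) * B + 4) c
  have := h1 (((((hs * B + g) * B + sy) * B + d / sy) * B + χ) * B + 4) (M - d)
  omega

theorem cost_fullE_le (hs g τ c d B X z : ℕ) :
    fullE.cost O h [hs, g, τ, c, d, B, X, z] ≤ 4 * h + 400 := by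
  have h1 := cost_accE_le O h B (((hs * B + g) * B + (z - 1)) * B + 5) c
  have h2 := cost_accE_le O h B (((hs * B + g) * B + (z - 1)) * B + 6) d
  set s := acc O B (((hs * B + g) * B + (z - 1)) * B + 5) c with hs'
  set t := acc O B (((hs * B + g) * B + (z - 1)) * B + 6) d with ht
  have h3 := cost_lamE_le O h B hs g s (c / s) t (d / t)
  have h4 := cost_cntE_le O h B (lam B hs g s (c / s) t (d / t)) (z - 1)
  have h5 := cost_cntE_le O h B (lam B hs g s (c / s) t (d / t)) τ
  simp [fullE, cost, cost_sub, cost_div, denote, denote_sub, denote_div, ArithOp.total, denote_accE,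
    denote_lamE, ← hs', ← ht]
  omega

theorem cost_checkE_le (hs g τ c d B X L sy M F χ : ℕ) :
    checkE.cost O h [hs, g, τ, c, d, B, X, L, sy, M, F, χ] ≤ 8 * (h + 110) := by
  have h1 := cost_topE_le O h hs g c d B sy M χ
  have h2 := cost_fullE_le O h hs g τ c d B X (top O hs g c d B sy M χ)
  simp [checkE, cost, denote, denote_topE]
  split_ifs <;> omega

theorem cost_leftoverE_le (hs g τ c d B X L g' τ' sy M F : ℕ) (hX : 1 ≤ X) :
    leftoverE.cost O h [hs, g, τ, c, d, B, X, L, g', τ', sy, M, F] ≤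
      (L + 1) ^ 2 * (X * (13 * (h + 110))) := by
  refine (cost_forListsE_le O h _ _ _ _ _ _ _ _ _ _ _ _ _ _
    (2 * (h + 110) + X * (10 * (h + 110))) fun i j => ?_).trans
    (Nat.mul_le_mul le_rfl (by nlinarith))
  set l := lam B hs g (acc O B B i) (c / acc O B B i) (acc O B B j) (d / acc O B B j) with hl
  have h1 := cost_cntE_le O h B l τ
  set k := cnt O B l τ with hk
  have h2 : ∀ x ∈ range (k - k / X * X), (letE (var 21 + 1 + var 22) <| letE (var 19 * var 5 + 1) <|
      letE (call [5, 24, 23] accE) (call [0, 8, 9, 3, 4, 5, 6, 7, 10, 11, 12, 25] checkE)).cost O h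
      [hs, g, τ, c, d, B, X, L, g', τ', sy, M, F, i, acc O B B i, c / acc O B B i, j, acc O B B j,
        d / acc O B B j, l, k, k / X * X, x] + 5 ≤ 10 * (h + 110) := by
    intro x _
    have h3 := cost_accE_le O h B (l * B + 1) (k / X * X + 1 + x)
    have h4 := cost_checkE_le O h hs g' τ' c d B X L sy M F (acc O B (l * B + 1) (k / X * X + 1 + x))
    simp [cost, denote, denote_accE, ArithOp.total]
    omega
  have h3 := sum_le_sum h2
  have h4 : k - k / X * X ≤ X := by
    have := Nat.div_add_mod' k X
    have := Nat.mod_lt k hX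
    omega
  rw [sum_const, card_range, smul_eq_mul] at h3
  replace h3 := h3.trans (Nat.mul_le_mul h4 le_rfl)
  rw [cost, cost, cost]
  simp only [cost, cost_sub, cost_div, denote, denote_cntE, denote_div, denote_sub, ArithOp.total,
    List.cons_append, List.nil_append, List.filterMap, List.getElem?_cons_succ,
    List.getElem?_cons_zero, Option.getD_some, ← hk] at h3 ⊢
  omega

theorem cost_nodeE_le (hs g τ g' τ' c d B X L sy M : ℕ) (hX : 1 ≤ X) :
    nodeE.cost O h [hs, g, τ, g', τ', c, d, B, X, L, sy, M] ≤
      40 * (h + 110) * ((L + 1) ^ 4 + X * (L + 1) ^ 2) := by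
  have h1 := cost_sizeE_le O h hs g τ c d B X L g' τ' sy M 0
  have h2 := cost_sizeE_le O h hs g' τ' c d B X L g τ sy M 0
  have h3 := cost_matE_le O h hs g τ c d B X L g' τ' sy M 0
  have h4 := cost_leftoverE_le O h hs g τ c d B X L g' τ' sy M 0 hX
  have h5 := cost_leftoverE_le O h hs g' τ' c d B X L g τ sy M 1 hX
  have h6 : nodeE.cost O h [hs, g, τ, g', τ', c, d, B, X, L, sy, M] ≤ 30 +
      sizeE.cost O h [hs, g, τ, c, d, B, X, L, g', τ', sy, M, 0] +
      sizeE.cost O h [hs, g', τ', c, d, B, X, L, g, τ, sy, M, 0] +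
      matE.cost O h [hs, g, τ, c, d, B, X, L, g', τ', sy, M, 0] +
      leftoverE.cost O h [hs, g, τ, c, d, B, X, L, g', τ', sy, M, 0] +
      leftoverE.cost O h [hs, g', τ', c, d, B, X, L, g, τ, sy, M, 1] := by
    simp [nodeE, cost, cost_sub, denote]
    omega
  refine h6.trans ((Nat.add_le_add (Nat.add_le_add (Nat.add_le_add (Nat.add_le_add
    (Nat.add_le_add_left h1 _) h2) h3) h4) h5).trans ?_)
  have hQ : 1 ≤ (L + 1) ^ 2 := Nat.one_le_pow _ _ (by omega)
  have hQ4 : (L + 1) ^ 4 = (L + 1) ^ 2 * (L + 1) ^ 2 := by ring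
  rw [hQ4]
  generalize (L + 1) ^ 2 = Q at *
  generalize hH : h + 110 = H
  have : 110 ≤ H := by omega
  have e1 : Q * H ≤ Q * Q * H := by nlinarith [Nat.mul_le_mul hQ (le_refl (Q * H))]
  have e2 : 110 ≤ Q * H := by nlinarith
  nlinarith [Nat.zero_le (X * Q * H)]

theorem cost_queryE_le (ra rb rc rd B M X L : ℕ) (hX : 1 ≤ X) :
    queryE.cost O h [ra, rb, rc, rd, B, M, X, L] ≤
      50 * (h + 110) * ((L + 1) ^ 4 + X * (L + 1) ^ 2) := by
  have h1 := cost_lcaE_le O h (2 * ra) (2 * rb) B L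
  have h2 := cost_lcaE_le O h (2 * rc) (2 * rd) B L
  set hs := lcaE.denote O [2 * ra, 2 * rb, B, L] with hhs
  set sy := lcaE.denote O [2 * rc, 2 * rd, B, L] with hsy
  have h3 := cost_nodeE_le O h hs (2 * ra / hs) (2 * ra) (2 * rb / hs) (M - 2 * rb) (2 * rc) (2 * rd)
    B X L sy M hX
  have h4 : queryE.cost O h [ra, rb, rc, rd, B, M, X, L] ≤ 60 +
      lcaE.cost O h [2 * ra, 2 * rb, B, L] + lcaE.cost O h [2 * rc, 2 * rd, B, L] +
      nodeE.cost O h [hs, 2 * ra / hs, 2 * ra, 2 * rb / hs, M - 2 * rb, 2 * rc, 2 * rd, B, X, L,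
        sy, M] := by
    simp [queryE, cost, cost_sub, cost_div, denote, denote_sub, denote_div, ArithOp.total, ← hhs, ← hsy]
    split_ifs <;> omega
  refine h4.trans ((Nat.add_le_add (Nat.add_le_add (Nat.add_le_add_left h1 _) h2) h3).trans ?_)
  have hQ4 : L + 1 ≤ (L + 1) ^ 4 := Nat.le_self_pow (by norm_num) _
  generalize (L + 1) ^ 4 = Q at *
  have hR : 0 ≤ X * (L + 1) ^ 2 := Nat.zero_le _
  generalize X * (L + 1) ^ 2 = R at *
  nlinarith

end

end Expr

/-! ### Tables as sets of numbers -/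

/-- An entry of a table: a list of digits, in which the search is for equality, a last digit, in which
it is for a successor, and the value. -/
abbrev Entry := List ℕ × ℕ × ℕ

/-- The number that represents an entry. -/
def Entry.code (B : ℕ) (e : Entry) : ℕ := (Nat.ofDigits B e.1 * B + e.2.1) * B + e.2.2

/-- Digit lists of numbers in base `B`, without leading zero. -/
def IsKey (B : ℕ) (l : List ℕ) : Prop := (∀ d ∈ l, d < B) ∧ ∃ h : l ≠ [], l.getLast h ≠ 0

theorem IsKey.inj {B : ℕ} (hB : 1 < B) {l l' : List ℕ} (h : IsKey B l) (h' : IsKey B l')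
    (heq : Nat.ofDigits B l = Nat.ofDigits B l') : l = l' := by
  obtain ⟨h1, h2, h3⟩ := h
  obtain ⟨h1', h2', h3'⟩ := h'
  rw [← Nat.digits_ofDigits B hB l h1 fun _ => h3, heq,
    Nat.digits_ofDigits B hB l' h1' fun _ => h3']

/-- The digits of an entry are at most `B`. -/
def Entry.Valid (B : ℕ) (e : Entry) : Prop := IsKey B e.1 ∧ e.2.1 < B ∧ e.2.2 < B

/-- The set of numbers that represents a table. -/
def tableSet (B : ℕ) (E : Finset Entry) : Finset ℕ := E.image (Entry.code B)

theorem div_div_code {B P z v : ℕ} (hz : z < B) (hv : v < B) :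
    ((P * B + z) * B + v) / B = P * B + z ∧ ((P * B + z) * B + v) / B / B = P := by
  have hB : 0 < B := by omega
  have h1 : ((P * B + z) * B + v) / B = P * B + z := by
    rw [mul_comm, Nat.mul_add_div hB, Nat.div_eq_of_lt hv, add_zero]
  refine ⟨h1, ?_⟩
  rw [h1, mul_comm, Nat.mul_add_div hB, Nat.div_eq_of_lt hz, add_zero]

/-- A table access finds the entry with the smallest last digit that is at least `z`, among the
entries with the given other digits; it gives `0` if there is none. -/
theorem acc_cases {B : ℕ} (hB : 1 < B) {E : Finset Entry} (hE : ∀ e ∈ E, e.Valid B) {l : List ℕ}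
    (hl : IsKey B l) {z : ℕ} (hz : z < B) :
    (∃ z' v, (l, z', v) ∈ E ∧ z ≤ z' ∧ (∀ z'' v', (l, z'', v') ∈ E → z ≤ z'' → z' ≤ z'') ∧
      Expr.acc (succOf (tableSet B E)) B (Nat.ofDigits B l) z = v) ∨
    ((∀ z' v, (l, z', v) ∈ E → z' < z) ∧
      Expr.acc (succOf (tableSet B E)) B (Nat.ofDigits B l) z = 0) := by
  set P := Nat.ofDigits B l with hP
  unfold Expr.acc
  have code_le : ∀ P P' z z' v v', z < B → v < B → z' < B → v' < B →
      ((P * B + z) * B + v ≤ (P' * B + z') * B + v') → P ≤ P' ∧ (P = P' → z ≤ z') := by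
    intro P P' z z' v v' hz hv hz' hv' hle
    have h1 := Nat.div_le_div_right (c := B) hle
    rw [(div_div_code hz hv).1, (div_div_code hz' hv').1] at h1
    have h2 := Nat.div_le_div_right (c := B) (Nat.div_le_div_right (c := B) hle)
    rw [(div_div_code hz hv).2, (div_div_code hz' hv').2] at h2
    exact ⟨h2, fun h => by subst h; omega⟩
  have key : ∀ z' v, (l, z', v) ∈ E → (P * B + z') * B + v ∈ tableSet B E := fun z' v h =>
    mem_image_of_mem (Entry.code B) h
  rcases succOf_spec (tableSet B E) ((P * B + z) * B) with ⟨hr, hle, hmin⟩ | ⟨h0, hlt⟩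
  · set r := succOf (tableSet B E) ((P * B + z) * B) with hr'
    obtain ⟨⟨l', z', v⟩, he, hc⟩ := mem_image.1 hr
    obtain ⟨hl', hz', hv⟩ := hE _ he
    simp only at hl' hz' hv
    simp only [Entry.code] at hc
    have hd := div_div_code (P := Nat.ofDigits B l') hz' hv
    rw [hc] at hd
    have h1 := code_le P (Nat.ofDigits B l') z z' 0 v hz (by omega) hz' hv (by rw [hc]; simpa using hle)
    dsimp only
    rw [hd.2]
    split_ifs with h2
    · have hll : l = l' := hl.inj hB hl' (le_antisymm h1.1 h2)
      subst hll
      refine .inl ⟨z', v, he, h1.2 rfl, fun z'' v' he' hzz => ?_, ?_⟩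
      · obtain ⟨-, hz'', hv'⟩ := hE _ he'
        have := hmin _ (key _ _ he') (by
          have := Nat.mul_le_mul (Nat.add_le_add_left hzz (P * B)) (le_refl B)
          omega)
        rw [← hc] at this
        exact (code_le P P z' z'' v v' hz' hv hz'' hv' this).2 rfl
      · rw [hd.1, ← hc]; omega
    · refine .inr ⟨fun z' v' he' => ?_, rfl⟩
      by_contra hzz
      obtain ⟨-, hz'', hv'⟩ := hE _ he'
      have := hmin _ (key _ _ he') (by
        have := Nat.mul_le_mul (Nat.add_le_add_left (not_lt.1 hzz) (P * B)) (le_refl B)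
        omega)
      rw [← hc] at this
      exact h2 (code_le _ P _ _ v v' (by assumption) hv hz'' hv' this).1
  · refine .inr ⟨fun z' v' he' => ?_, by simp [h0]⟩
    by_contra hzz
    have h1 := hlt _ (key _ _ he')
    have := Nat.mul_le_mul (Nat.add_le_add_left (not_lt.1 hzz) (P * B)) (le_refl B)
    omega

/-! ### Dyadic decomposition of intervals -/

/-- The block `u` of length `2 ^ i` is a maximal dyadic block in `I`. -/
def Canon (I : Set ℕ) (i u : ℕ) : Prop :=
  (∀ t, t / 2 ^ i = u → t ∈ I) ∧ ¬ ∀ t, t / 2 ^ (i + 1) = u / 2 → t ∈ I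

theorem div_two_pow_succ (t i : ℕ) : t / 2 ^ (i + 1) = t / 2 ^ i / 2 := by
  rw [pow_succ, Nat.div_div_eq_div_mul]

theorem div_two_pow_congr {s t i j : ℕ} (hij : i ≤ j) (h : s / 2 ^ i = t / 2 ^ i) :
    s / 2 ^ j = t / 2 ^ j := by
  obtain ⟨k, rfl⟩ := Nat.exists_eq_add_of_le hij
  rw [pow_add, ← Nat.div_div_eq_div_mul, h, Nat.div_div_eq_div_mul]

theorem Canon.mem {I : Set ℕ} {i t : ℕ} (h : Canon I i (t / 2 ^ i)) : t ∈ I := h.1 t rfl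

theorem exists_canon {I : Set ℕ} {L t : ℕ} (ht : t ∈ I) (hL : ¬ ∀ s, s / 2 ^ L = t / 2 ^ L → s ∈ I) :
    ∃ i < L, Canon I i (t / 2 ^ i) := by
  classical
  have hex : ∃ i, ¬ ∀ s, s / 2 ^ i = t / 2 ^ i → s ∈ I := ⟨L, hL⟩
  have h0 : Nat.find hex ≠ 0 := by
    intro h
    have := Nat.find_spec hex
    rw [h] at this
    exact this fun s hs => by simpa [show s = t by simpa using hs] using ht
  obtain ⟨i, hi⟩ := Nat.exists_eq_succ_of_ne_zero h0
  refine ⟨i, ?_, ?_, ?_⟩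
  · have := Nat.find_min' hex hL
    omega
  · have := Nat.find_min hex (show i < Nat.find hex by omega)
    exact not_not.1 this
  · have := Nat.find_spec hex
    rw [hi] at this
    rwa [← div_two_pow_succ]

theorem Canon.level_unique {I : Set ℕ} {i j t : ℕ} (hi : Canon I i (t / 2 ^ i))
    (hj : Canon I j (t / 2 ^ j)) : i = j := by
  have key : ∀ i j, Canon I i (t / 2 ^ i) → Canon I j (t / 2 ^ j) → ¬ i < j := by
    intro i j hi hj hij
    refine hi.2 fun s hs => hj.1 s ?_
    rw [← div_two_pow_succ] at hs
    exact div_two_pow_congr hij hs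
  have := key i j hi hj
  have := key j i hj hi
  omega

/-- At each level, an interval has at most one maximal block that is a left sibling, and at most one
that is a right sibling. -/
theorem Canon.eq_of_mod_two {I : Set ℕ} (hI : I.OrdConnected) {i u v : ℕ} (hu : Canon I i u)
    (hv : Canon I i v) (h : u % 2 = v % 2) : u = v := by
  have hpos : 0 < 2 ^ i := by positivity
  have key : ∀ u v, Canon I i u → Canon I i v → u % 2 = v % 2 → ¬ u < v := by
    intro u v hu hv h huv
    have hmid : ∀ t, u ≤ t / 2 ^ i → t / 2 ^ i ≤ v → t ∈ I := by
      intro t h1 h2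
      rcases h1.eq_or_lt with h1 | h1
      · exact hu.1 t h1.symm
      rcases h2.eq_or_lt with h2 | h2
      · exact hv.1 t h2
      refine hI.out (hu.1 (u * 2 ^ i) (Nat.mul_div_cancel _ hpos))
        (hv.1 (v * 2 ^ i) (Nat.mul_div_cancel _ hpos)) ⟨?_, ?_⟩
      · exact (Nat.le_div_iff_mul_le hpos).1 h1.le
      · exact ((Nat.div_lt_iff_lt_mul hpos).1 h2).le
    rcases Nat.mod_two_eq_zero_or_one u with h0 | h0
    · refine hu.2 fun t ht => hmid t ?_ ?_ <;> rw [div_two_pow_succ] at ht <;> omega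
    · refine hv.2 fun t ht => hmid t ?_ ?_ <;> rw [div_two_pow_succ] at ht <;> omega
  have := key u v hu hv h
  have := key v u hv hu h.symm
  omega

/-- The largest element of block `u` of length `2 ^ i`. -/
def blockEnd (i u : ℕ) : ℕ := u * 2 ^ i + (2 ^ i - 1)

theorem blockEnd_div (i u : ℕ) : blockEnd i u / 2 ^ i = u := by
  have hpos : 0 < 2 ^ i := by positivity
  rw [blockEnd, mul_comm, Nat.mul_add_div hpos, Nat.div_eq_of_lt (by omega), add_zero]

theorem le_blockEnd {i t : ℕ} : t ≤ blockEnd i (t / 2 ^ i) := by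
  have hpos : 0 < 2 ^ i := by positivity
  have := Nat.div_add_mod' t (2 ^ i)
  have := Nat.mod_lt t hpos
  rw [blockEnd]; omega

/-- The maximal block that contains `t` is the one with the first end at or after `t`. -/
theorem Canon.blockEnd_le {I : Set ℕ} {i j t v : ℕ} (hi : Canon I i (t / 2 ^ i))
    (hj : Canon I j v) (hle : t ≤ blockEnd j v) (hmin : blockEnd j v ≤ blockEnd i (t / 2 ^ i)) :
    j = i := by
  have hpos : 0 < 2 ^ i := by positivity
  have h1 : blockEnd j v / 2 ^ i = t / 2 ^ i := by
    refine le_antisymm ?_ (Nat.div_le_div_right hle)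
    have := Nat.div_le_div_right (c := 2 ^ i) hmin
    rwa [blockEnd_div] at this
  rw [← h1] at hi
  refine Canon.level_unique (t := blockEnd j v) ?_ hi
  rwa [blockEnd_div]

/-! ### Folding at a dyadic boundary -/

/-- Reflection of the right siblings among the dyadic blocks of length `2 ^ k`, so that in all blocks
the numbers grow towards the boundary between the siblings. -/
def fold (L k t : ℕ) : ℕ := if t / 2 ^ k % 2 = 0 then t else 2 ^ L - t

theorem fold_le {L k t : ℕ} (ht : t ≤ 2 ^ L) : fold L k t ≤ 2 ^ L := by
  unfold fold; split_ifs <;> omega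

theorem fold_inj {L k s t : ℕ} (hs : s ≤ 2 ^ L) (ht : t ≤ 2 ^ L) (hst : s / 2 ^ k = t / 2 ^ k)
    (h : fold L k s = fold L k t) : s = t := by
  unfold fold at h
  rw [hst] at h
  split_ifs at h <;> omega

/-- The blocks of length `2 ^ k` that contain `a` and `b` are left and right siblings. -/
def Separates (k a b : ℕ) : Prop := a / 2 ^ k < b / 2 ^ k ∧ b / 2 ^ (k + 1) ≤ a / 2 ^ (k + 1)

theorem Separates.sibling {k a b : ℕ} (h : Separates k a b) :
    a / 2 ^ k % 2 = 0 ∧ b / 2 ^ k = a / 2 ^ k + 1 := by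
  obtain ⟨h1, h2⟩ := h
  rw [div_two_pow_succ, div_two_pow_succ] at h2
  omega

theorem Separates.unique {j k a b : ℕ} (hj : Separates j a b) (hk : Separates k a b) : j = k := by
  have key : ∀ j k, Separates j a b → Separates k a b → ¬ j < k := by
    intro j k hj hk hjk
    have h1 : a / 2 ^ (j + 1) = b / 2 ^ (j + 1) :=
      le_antisymm (by rw [div_two_pow_succ, div_two_pow_succ]; have := hj.1; omega) hj.2
    exact hk.1.ne (div_two_pow_congr hjk h1)
  have := key j k hj hk
  have := key k j hk hj
  omega

theorem exists_separates {L a b : ℕ} (hab : a < b) (hb : b < 2 ^ L) : ∃ k < L, Separates k a b := by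
  classical
  have hex : ∃ k, b / 2 ^ k ≤ a / 2 ^ k := ⟨L, by rw [Nat.div_eq_of_lt hb]; exact Nat.zero_le _⟩
  have h0 : Nat.find hex ≠ 0 := by
    intro h
    have := Nat.find_spec hex
    rw [h] at this
    simp at this; omega
  obtain ⟨k, hk⟩ := Nat.exists_eq_succ_of_ne_zero h0
  refine ⟨k, ?_, not_le.1 (Nat.find_min hex (by omega)), ?_⟩
  · have := Nat.find_min' hex (m := L) (by rw [Nat.div_eq_of_lt hb]; exact Nat.zero_le _)
    omega
  · have := Nat.find_spec hex
    rwa [hk] at this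

/-- An interval consists of an upper part of a block and a lower part of its sibling. -/
theorem Separates.mem_Icc_iff {L k a b t : ℕ} (h : Separates k a b) (ht : t ≤ 2 ^ L) :
    a ≤ t ∧ t ≤ b ↔ (t / 2 ^ k = a / 2 ^ k ∧ fold L k a ≤ fold L k t) ∨
      (t / 2 ^ k = b / 2 ^ k ∧ fold L k b ≤ fold L k t) := by
  obtain ⟨h1, h2⟩ := h.sibling
  have hb2 : ¬ b / 2 ^ k % 2 = 0 := by omega
  have hA : t / 2 ^ k = a / 2 ^ k → (fold L k a ≤ fold L k t ↔ a ≤ t) := fun h => by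
    simp [fold, h, h1]
  have hB : t / 2 ^ k = b / 2 ^ k → (fold L k b ≤ fold L k t ↔ t ≤ b) := fun h => by
    simp [fold, h, hb2]; omega
  have hlt : ∀ {s t}, s / 2 ^ k < t / 2 ^ k → s < t := fun {s t} h => by
    by_contra hc
    exact absurd (Nat.div_le_div_right (c := 2 ^ k) (not_lt.1 hc)) (by omega)
  constructor
  · rintro ⟨h3, h4⟩
    have h5 := Nat.div_le_div_right (c := 2 ^ k) h3
    have h6 := Nat.div_le_div_right (c := 2 ^ k) h4
    rcases (show t / 2 ^ k = a / 2 ^ k ∨ t / 2 ^ k = b / 2 ^ k by omega) with h | h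
    · exact .inl ⟨h, (hA h).2 h3⟩
    · exact .inr ⟨h, (hB h).2 h4⟩
  · rintro (⟨h3, h4⟩ | ⟨h3, h4⟩)
    · exact ⟨(hA h3).1 h4, (hlt (by omega)).le⟩
    · exact ⟨(hlt (by omega)).le, (hB h3).1 h4⟩

/-! ### Positions in a ranking -/

section Ranking

variable {α : Type*} (s : Finset α) (f : α → ℕ)

/-- The number of elements of `s` for which `f` is at least `τ`. -/
def numGe (τ : ℕ) : ℕ := #{q ∈ s | τ ≤ f q}

variable {s f}

theorem numGe_le_card (τ : ℕ) : numGe s f τ ≤ #s := card_filter_le _ _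

theorem one_le_numGe {p : α} (hp : p ∈ s) : 1 ≤ numGe s f (f p) :=
  card_pos.2 ⟨p, mem_filter.2 ⟨hp, le_rfl⟩⟩

theorem numGe_le_iff {p : α} (hp : p ∈ s) (τ : ℕ) : numGe s f (f p) ≤ numGe s f τ ↔ τ ≤ f p := by
  constructor
  · intro h
    by_contra hlt
    refine absurd h (not_le.2 (card_lt_card ?_))
    rw [ssubset_iff_of_subset]
    · exact ⟨p, mem_filter.2 ⟨hp, le_rfl⟩, fun h => hlt (mem_filter.1 h).2⟩
    · intro q hq
      rw [mem_filter] at hq ⊢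
      exact ⟨hq.1, by omega⟩
  · intro h
    refine card_le_card fun q hq => ?_
    rw [mem_filter] at hq ⊢
    exact ⟨hq.1, by omega⟩

theorem numGe_injOn (hf : Set.InjOn f s) : Set.InjOn (fun p => numGe s f (f p)) s := by
  intro p hp q hq h
  have h1 := (numGe_le_iff (mem_coe.1 hq) (f p)).1 (Eq.ge h)
  have h2 := (numGe_le_iff (mem_coe.1 hp) (f q)).1 (Eq.le h)
  exact hf hp hq (le_antisymm h1 h2)

theorem exists_numGe_eq (hf : Set.InjOn f s) {k : ℕ} (h1 : 1 ≤ k) (hk : k ≤ #s) :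
    ∃ p ∈ s, numGe s f (f p) = k := by
  classical
  have : s.image (fun p => numGe s f (f p)) = Icc 1 #s := by
    refine eq_of_subset_of_card_le ?_ ?_
    · intro k hk
      obtain ⟨p, hp, rfl⟩ := mem_image.1 hk
      exact mem_Icc.2 ⟨one_le_numGe hp, numGe_le_card _⟩
    · rw [card_image_of_injOn (numGe_injOn hf)]; simp
  have hk' : k ∈ s.image (fun p => numGe s f (f p)) := by rw [this]; exact mem_Icc.2 ⟨h1, hk⟩
  simpa using hk'

/-- The elements with positions in `(m, numGe τ]`. -/
theorem sum_positions (hf : Set.InjOn f s) (τ m : ℕ) (g : ℕ → ℕ) :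
    ∑ k ∈ range (numGe s f τ - m), g (m + 1 + k) =
      ∑ p ∈ s with τ ≤ f p ∧ m < numGe s f (f p), g (numGe s f (f p)) := by
  symm
  refine sum_bij (fun p _ => numGe s f (f p) - (m + 1)) ?_ ?_ ?_ ?_
  · intro p hp
    rw [mem_filter] at hp
    have := (numGe_le_iff hp.1 τ).2 hp.2.1
    rw [mem_range]; omega
  · intro p hp q hq h
    rw [mem_filter] at hp hq
    exact numGe_injOn hf hp.1 hq.1 (show numGe s f (f p) = numGe s f (f q) by omega)
  · intro k hk
    rw [mem_range] at hk
    obtain ⟨p, hp, hpk⟩ := exists_numGe_eq hf (k := m + 1 + k) (by omega)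
      ((show m + 1 + k ≤ numGe s f τ by omega).trans (numGe_le_card _))
    refine ⟨p, mem_filter.2 ⟨hp, (numGe_le_iff hp τ).1 (by omega), by omega⟩, by omega⟩
  · intro p hp
    rw [mem_filter] at hp
    congr 1; omega

end Ranking

/-! ### Colored points in rank space -/

/-- Colored points with coordinates in rank space. -/
structure Grid (n : ℕ) where
  /-- The number of bits of a coordinate. -/
  L : ℕ
  x : Fin n → ℕ
  y : Fin n → ℕ
  col : Fin n → ℕ
  x_inj : Function.Injective x
  x_lt : ∀ p, x p < 2 ^ L
  y_pos : ∀ p, 0 < y p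
  y_lt : ∀ p, y p + 1 < 2 ^ L
  col_lt : ∀ p, col p < 2 ^ L
  n_le : n ≤ 2 ^ L
  three_le : 3 ≤ L

/-- The index of a list: it belongs to block `g` of length `2 ^ l` in the first coordinate, and to
block `u` of length `2 ^ i` for the lower side and block `v` of length `2 ^ j` for the upper side of the
query. -/
@[ext]
structure Cell where
  l : ℕ
  g : ℕ
  i : ℕ
  u : ℕ
  j : ℕ
  v : ℕ

/-- The digits by which a list is found in the tables. -/
def Cell.key (κ : Cell) : List ℕ := [κ.v, 2 ^ κ.j, κ.u, 2 ^ κ.i, κ.g, 2 ^ κ.l]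

theorem Cell.key_inj {κ κ' : Cell} (h : κ.key = κ'.key) : κ = κ' := by
  simp only [Cell.key, List.cons.injEq, Nat.pow_right_inj (le_refl 2), and_true] at h
  obtain ⟨h1, h2, h3, h4, h5, h6⟩ := h
  exact Cell.ext h6 h5 h4 h3 h2 h1

namespace Grid

variable {n : ℕ} (G : Grid n)

/-- The priority of a point in its block of length `2 ^ l`: it is the larger the nearer the point is to
the boundary between the block and its sibling. -/
def prio (l : ℕ) (p : Fin n) : ℕ := fold G.L l (G.x p)

theorem prio_le (l : ℕ) (p : Fin n) : G.prio l p ≤ 2 ^ G.L := fold_le (G.x_lt p).le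

theorem prio_inj {l : ℕ} {p q : Fin n} (h : G.x p / 2 ^ l = G.x q / 2 ^ l)
    (hpq : G.prio l p = G.prio l q) : p = q :=
  G.x_inj (fold_inj (G.x_lt p).le (G.x_lt q).le h hpq)

/-- `q` is a point of the same color and block as `p`, and of higher priority. -/
def Beats (l : ℕ) (q p : Fin n) : Prop :=
  G.x q / 2 ^ l = G.x p / 2 ^ l ∧ G.col q = G.col p ∧ G.prio l p < G.prio l q

/-- The lower sides `c` for which no point that beats `p` lies between `c` and `p`. -/
def low (l : ℕ) (p : Fin n) : Set ℕ :=
  {c | c ≤ G.y p ∧ ∀ q, G.Beats l q p → ¬ (c ≤ G.y q ∧ G.y q ≤ G.y p)}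

/-- The upper sides `d` for which no point that beats `p` lies between `p` and `d`. -/
def high (l : ℕ) (p : Fin n) : Set ℕ :=
  {d | d < 2 ^ G.L ∧ G.y p ≤ d ∧ ∀ q, G.Beats l q p → ¬ (G.y p ≤ G.y q ∧ G.y q ≤ d)}

theorem low_ordConnected (l : ℕ) (p : Fin n) : (G.low l p).OrdConnected :=
  ⟨fun _ hs _ ht _ hr => ⟨hr.2.trans ht.1, fun q hq h => hs.2 q hq ⟨hr.1.trans h.1, h.2⟩⟩⟩

theorem high_ordConnected (l : ℕ) (p : Fin n) : (G.high l p).OrdConnected :=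
  ⟨fun _ hs _ ht _ hr => ⟨hr.2.trans_lt ht.1, hs.2.1.trans hr.1,
    fun q hq h => ht.2.2 q hq ⟨h.1, h.2.trans hr.2⟩⟩⟩

theorem lt_of_canon_low {l i u : ℕ} {p : Fin n} (h : Canon (G.low l p) i u) :
    blockEnd i u < 2 ^ G.L ∧ u < 2 ^ G.L := by
  have h1 : blockEnd i u ≤ G.y p := (h.1 _ (blockEnd_div i u)).1
  have h2 := G.y_lt p
  have h3 : u ≤ blockEnd i u := by
    conv_lhs => rw [← blockEnd_div i u]
    exact Nat.div_le_self _ _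
  omega

theorem lt_of_canon_high {l i u : ℕ} {p : Fin n} (h : Canon (G.high l p) i u) :
    blockEnd i u < 2 ^ G.L ∧ u < 2 ^ G.L := by
  have h1 : blockEnd i u < 2 ^ G.L := (h.1 _ (blockEnd_div i u)).1
  have h3 : u ≤ blockEnd i u := by
    conv_lhs => rw [← blockEnd_div i u]
    exact Nat.div_le_self _ _
  omega

theorem exists_canon_low {l c : ℕ} {p : Fin n} (h : c ∈ G.low l p) :
    ∃ i < G.L, Canon (G.low l p) i (c / 2 ^ i) := by
  refine exists_canon h fun hall => ?_
  have hy := G.y_lt p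
  have hc : c ≤ G.y p := h.1
  have := (hall (2 ^ G.L - 1) (by rw [Nat.div_eq_of_lt (by omega), Nat.div_eq_of_lt (by omega)])).1
  omega

theorem exists_canon_high {l d : ℕ} {p : Fin n} (h : d ∈ G.high l p) :
    ∃ i < G.L, Canon (G.high l p) i (d / 2 ^ i) := by
  refine exists_canon h fun hall => ?_
  have hy := G.y_pos p
  have := (hall 0 (by rw [Nat.div_eq_of_lt (by positivity), Nat.div_eq_of_lt h.1])).2.1
  omega

open scoped Classical in
/-- The points of a block that represent their colors in queries with the sides `c` and `d`. -/
noncomputable def reps (l g c d : ℕ) : Finset (Fin n) :=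
  {p | G.x p / 2 ^ l = g ∧ c ∈ G.low l p ∧ d ∈ G.high l p}

theorem mem_reps {l g c d : ℕ} {p : Fin n} :
    p ∈ G.reps l g c d ↔ G.x p / 2 ^ l = g ∧ c ∈ G.low l p ∧ d ∈ G.high l p := by
  simp [reps]

theorem reps_col_inj {l g c d : ℕ} {p q : Fin n} (hp : p ∈ G.reps l g c d) (hq : q ∈ G.reps l g c d)
    (h : G.col p = G.col q) : p = q := by
  rw [mem_reps] at hp hq
  have key : ∀ p q, G.x p / 2 ^ l = g ∧ c ∈ G.low l p ∧ d ∈ G.high l p →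
      G.x q / 2 ^ l = g ∧ c ∈ G.low l q ∧ d ∈ G.high l q → G.col p = G.col q →
      ¬ G.prio l p < G.prio l q := by
    rintro p q ⟨hp, hpc, hpd⟩ ⟨hq, hqc, hqd⟩ h hlt
    have hb : G.Beats l q p := ⟨hq.trans hp.symm, h.symm, hlt⟩
    rcases le_total (G.y q) (G.y p) with hy | hy
    · exact hpc.2 q hb ⟨hqc.1, hy⟩
    · exact hpd.2.2 q hb ⟨hy, hqd.2.1⟩
  have h1 := key p q hp hq h
  have h2 := key q p hq hp h.symm
  exact G.prio_inj (hp.1.trans hq.1.symm) (by omega)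

/-- Every point between `c` and `d` has a representative. -/
theorem exists_rep {l c d : ℕ} {p : Fin n} (hc : c ≤ G.y p) (hd : G.y p ≤ d) (hd' : d < 2 ^ G.L) :
    ∃ q ∈ G.reps l (G.x p / 2 ^ l) c d, G.col q = G.col p ∧ G.prio l p ≤ G.prio l q ∧
      ∀ r, G.x r / 2 ^ l = G.x p / 2 ^ l → G.col r = G.col p → c ≤ G.y r → G.y r ≤ d →
        G.prio l r ≤ G.prio l q := by
  obtain ⟨q, hq, hmax⟩ := exists_max_image
    (univ.filter fun q => G.x q / 2 ^ l = G.x p / 2 ^ l ∧ G.col q = G.col p ∧ c ≤ G.y q ∧ G.y q ≤ d)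
    (G.prio l) ⟨p, by simp [hc, hd]⟩
  simp only [mem_filter, mem_univ, true_and] at hq hmax
  obtain ⟨hx, hcol, hcq, hqd⟩ := hq
  refine ⟨q, G.mem_reps.2 ⟨hx, ⟨hcq, ?_⟩, hd', hqd, ?_⟩, hcol, hmax p ⟨rfl, rfl, hc, hd⟩,
    fun r h1 h2 h3 h4 => hmax r ⟨h1, h2, h3, h4⟩⟩
  · intro r hr h
    exact absurd hr.2.2 (not_lt.2 (hmax r ⟨hr.1.trans hx, hr.2.1.trans hcol, h.1, h.2.trans hqd⟩))
  · intro r hr h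
    exact absurd hr.2.2 (not_lt.2 (hmax r ⟨hr.1.trans hx, hr.2.1.trans hcol, hcq.trans h.1, h.2⟩))

open scoped Classical in
/-- The points that are stored in a list. -/
noncomputable def list (κ : Cell) : Finset (Fin n) :=
  {p | G.x p / 2 ^ κ.l = κ.g ∧ Canon (G.low κ.l p) κ.i κ.u ∧ Canon (G.high κ.l p) κ.j κ.v}

theorem mem_list {κ : Cell} {p : Fin n} : p ∈ G.list κ ↔ G.x p / 2 ^ κ.l = κ.g ∧
    Canon (G.low κ.l p) κ.i κ.u ∧ Canon (G.high κ.l p) κ.j κ.v := by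
  simp [list]

theorem prio_injOn (κ : Cell) : Set.InjOn (G.prio κ.l) (G.list κ) := fun _ hp _ hq h =>
  G.prio_inj ((G.mem_list.1 hp).1.trans (G.mem_list.1 hq).1.symm) h

theorem list_subset_reps (κ : Cell) :
    G.list κ ⊆ G.reps κ.l κ.g (blockEnd κ.i κ.u) (blockEnd κ.j κ.v) := fun p hp => by
  rw [mem_list] at hp
  exact G.mem_reps.2 ⟨hp.1, hp.2.1.1 _ (blockEnd_div ..), hp.2.2.1 _ (blockEnd_div ..)⟩

theorem list_col_inj {κ : Cell} {p q : Fin n} (hp : p ∈ G.list κ) (hq : q ∈ G.list κ)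
    (h : G.col p = G.col q) : p = q :=
  G.reps_col_inj (G.list_subset_reps κ hp) (G.list_subset_reps κ hq) h

/-- The list on levels `i` and `j` that contributes to the point `(c, d)`. -/
def cellAt (l g c d i j : ℕ) : Cell := ⟨l, g, i, c / 2 ^ i, j, d / 2 ^ j⟩

/-- Every representative is in exactly one of the lists that contribute to the query. -/
theorem sum_reps {M : Type*} [AddCommMonoid M] (l g c d : ℕ) (f : Fin n → M) :
    ∑ p ∈ G.reps l g c d, f p =
      ∑ i ∈ range G.L, ∑ j ∈ range G.L, ∑ p ∈ G.list (cellAt l g c d i j), f p := by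
  rw [← sum_product' (range G.L) (range G.L) fun i j => ∑ p ∈ G.list (cellAt l g c d i j), f p,
    ← sum_biUnion]
  · congr 1
    ext p
    simp only [mem_reps, mem_biUnion, mem_product, mem_range, mem_list, cellAt, Prod.exists]
    constructor
    · rintro ⟨hx, hc, hd⟩
      obtain ⟨i, hi, hci⟩ := G.exists_canon_low hc
      obtain ⟨j, hj, hdj⟩ := G.exists_canon_high hd
      exact ⟨i, j, ⟨hi, hj⟩, hx, hci, hdj⟩
    · rintro ⟨i, j, -, hx, hc, hd⟩
      exact ⟨hx, hc.mem, hd.mem⟩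
  · rintro ⟨i, j⟩ - ⟨i', j'⟩ - hne
    refine disjoint_left.2 fun p hp hp' => hne ?_
    simp only [mem_list, cellAt] at hp hp'
    rw [hp.2.1.level_unique hp'.2.1, hp.2.2.level_unique hp'.2.2]

/-- The position of a point in a list, counted from `1` in the order of decreasing priority. -/
noncomputable def pos (κ : Cell) (p : Fin n) : ℕ := numGe (G.list κ) (G.prio κ.l) (G.prio κ.l p)

theorem pos_le {κ : Cell} {p : Fin n} : G.pos κ p ≤ n :=
  (numGe_le_card _).trans ((card_le_univ _).trans (by simp))

/-- The number of colors that occur both in the first `m` elements of one list and in the first `m'`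
elements of another. -/
noncomputable def common (κ κ' : Cell) (m m' : ℕ) : ℕ :=
  #{p ∈ G.list κ | G.pos κ p ≤ m ∧ ∃ q ∈ G.list κ', G.pos κ' q ≤ m' ∧ G.col q = G.col p}

theorem common_le (κ κ' : Cell) (m m' : ℕ) : G.common κ κ' m m' ≤ n :=
  (card_le_univ _).trans (by simp)

/-- The points of block `g` of length `2 ^ l` and color `χ` whose second coordinate is in block `e` of
length `2 ^ k`, at `z` or nearer to the sibling of this block. -/
def column (l g k e χ z : ℕ) : Finset (Fin n) :=
  {q | G.x q / 2 ^ l = g ∧ G.y q / 2 ^ k = e ∧ G.col q = χ ∧ z ≤ fold G.L k (G.y q)}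

/-- One more than the maximal priority in a column. -/
def columnTop (l g k e χ z : ℕ) : ℕ := (G.column l g k e χ z).sup fun q => G.prio l q + 1

theorem columnTop_le (l g k e χ z : ℕ) : G.columnTop l g k e χ z ≤ 2 ^ G.L + 1 :=
  Finset.sup_le fun q _ => Nat.succ_le_succ (G.prio_le l q)

/-! ### The tables -/

open scoped Classical in
/-- The indices of the nonempty lists. -/
noncomputable def cells : Finset Cell :=
  ((range G.L ×ˢ range (2 ^ G.L) ×ˢ range G.L ×ˢ range (2 ^ G.L) ×ˢ range G.L ×ˢ
    range (2 ^ G.L)).image fun t => ⟨t.1, t.2.1, t.2.2.1, t.2.2.2.1, t.2.2.2.2.1, t.2.2.2.2.2⟩).filter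
    fun κ => (G.list κ).Nonempty

theorem mem_cells {κ : Cell} :
    κ ∈ G.cells ↔ (κ.l < G.L ∧ κ.i < G.L ∧ κ.j < G.L) ∧ (G.list κ).Nonempty := by
  constructor
  · intro h
    simp only [cells, mem_filter, mem_image, mem_product, mem_range, Prod.exists] at h
    obtain ⟨⟨l, g, i, u, j, v, ⟨hl, hg, hi, hu, hj, hv⟩, rfl⟩, hne⟩ := h
    exact ⟨⟨hl, hi, hj⟩, hne⟩
  · rintro ⟨⟨hl, hi, hj⟩, p, hp⟩
    have hp' := G.mem_list.1 hp
    simp only [cells, mem_filter, mem_image, mem_product, mem_range, Prod.exists]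
    exact ⟨⟨κ.l, κ.g, κ.i, κ.u, κ.j, κ.v, ⟨hl, hp'.1 ▸ (Nat.div_le_self _ _).trans_lt (G.x_lt p), hi,
      (G.lt_of_canon_low hp'.2.1).2, hj, (G.lt_of_canon_high hp'.2.2).2⟩, rfl⟩, p, hp⟩

/-- The table of the powers of two. -/
def powTable : Finset Entry := (range G.L).image fun i => ([0, 1], i, 2 ^ i)

/-- The colors of the elements of the lists, by position. -/
noncomputable def colorTable : Finset Entry :=
  G.cells.biUnion fun κ => (G.list κ).image fun p => (1 :: κ.key, G.pos κ p, G.col p)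

/-- The positions of the elements of the lists, by priority. -/
noncomputable def posTable : Finset Entry :=
  G.cells.biUnion fun κ => (G.list κ).image fun p => (2 :: κ.key, G.prio κ.l p, G.pos κ p)

/-- The lists belong to sibling blocks. -/
def Siblings (κ κ' : Cell) : Prop := κ.l = κ'.l ∧ κ.g % 2 = 0 ∧ κ'.g = κ.g + 1

/-- The key for an entry of the matrix. -/
def matKey (κ κ' : Cell) (m m' : ℕ) : List ℕ := 3 :: m' :: (κ'.key ++ m :: κ.key)

open scoped Classical in
/-- The number of common colors of any two prefixes of lists of sibling blocks that consist of full
blocks of `X` elements. -/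
noncomputable def matTable (X : ℕ) : Finset Entry :=
  ((G.cells ×ˢ G.cells).filter fun t => Siblings t.1 t.2).biUnion fun t =>
    (Icc 1 (#(G.list t.1) / X) ×ˢ Icc 1 (#(G.list t.2) / X)).image fun m =>
      (matKey t.1 t.2 m.1 m.2, 0, G.common t.1 t.2 (m.1 * X) (m.2 * X))

/-- The maxima of the priorities over columns. -/
def columnTable : Finset Entry :=
  (univ ×ˢ range G.L ×ˢ range G.L).image fun t : Fin n × ℕ × ℕ =>
    ([4, G.col t.1, G.y t.1 / 2 ^ t.2.2, 2 ^ t.2.2, G.x t.1 / 2 ^ t.2.1, 2 ^ t.2.1],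
      fold G.L t.2.2 (G.y t.1), G.columnTop t.2.1 (G.x t.1 / 2 ^ t.2.1) t.2.2 (G.y t.1 / 2 ^ t.2.2)
        (G.col t.1) (fold G.L t.2.2 (G.y t.1)))

open scoped Classical in
/-- The maximal dyadic blocks in the intervals `I l p`, by their ends. -/
noncomputable def blockTable (tag : ℕ) (I : ℕ → Fin n → Set ℕ) : Finset Entry :=
  (((univ : Finset (Fin n)) ×ˢ range G.L ×ˢ range G.L ×ˢ range (2 ^ G.L)).filter fun t =>
    Canon (I t.2.1 t.1) t.2.2.1 t.2.2.2).image fun t =>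
      ([tag, G.prio t.2.1 t.1, G.x t.1 / 2 ^ t.2.1, 2 ^ t.2.1], blockEnd t.2.2.1 t.2.2.2, 2 ^ t.2.2.1)

open scoped Classical in
/-- All tables. -/
noncomputable def table (X : ℕ) : Finset Entry :=
  G.powTable ∪ G.colorTable ∪ G.posTable ∪ G.matTable X ∪ G.columnTable ∪ G.blockTable 5 G.low ∪
    G.blockTable 6 G.high

theorem mem_powTable {e : Entry} : e ∈ G.powTable ↔ ∃ i < G.L, ([0, 1], i, 2 ^ i) = e := by
  simp [powTable]

theorem mem_colorTable {e : Entry} : e ∈ G.colorTable ↔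
    ∃ κ ∈ G.cells, ∃ p ∈ G.list κ, (1 :: κ.key, G.pos κ p, G.col p) = e := by
  simp only [colorTable, mem_biUnion, mem_image]

theorem mem_posTable {e : Entry} : e ∈ G.posTable ↔
    ∃ κ ∈ G.cells, ∃ p ∈ G.list κ, (2 :: κ.key, G.prio κ.l p, G.pos κ p) = e := by
  simp only [posTable, mem_biUnion, mem_image]

theorem mem_matTable {X : ℕ} {e : Entry} : e ∈ G.matTable X ↔
    ∃ κ ∈ G.cells, ∃ κ' ∈ G.cells, Siblings κ κ' ∧ ∃ m m', 1 ≤ m ∧ m ≤ #(G.list κ) / X ∧ 1 ≤ m' ∧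
      m' ≤ #(G.list κ') / X ∧ (matKey κ κ' m m', 0, G.common κ κ' (m * X) (m' * X)) = e := by
  simp only [matTable, mem_biUnion, mem_filter, mem_image, mem_product, Prod.exists, mem_Icc]
  constructor
  · rintro ⟨κ, κ', ⟨⟨hκ, hκ'⟩, hs⟩, m, m', ⟨⟨h1, h2⟩, h3, h4⟩, he⟩
    exact ⟨κ, hκ, κ', hκ', hs, m, m', h1, h2, h3, h4, he⟩
  · rintro ⟨κ, hκ, κ', hκ', hs, m, m', h1, h2, h3, h4, he⟩
    exact ⟨κ, κ', ⟨⟨hκ, hκ'⟩, hs⟩, m, m', ⟨⟨h1, h2⟩, h3, h4⟩, he⟩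

theorem mem_columnTable {e : Entry} : e ∈ G.columnTable ↔ ∃ p, ∃ l < G.L, ∃ k < G.L,
    ([4, G.col p, G.y p / 2 ^ k, 2 ^ k, G.x p / 2 ^ l, 2 ^ l], fold G.L k (G.y p),
      G.columnTop l (G.x p / 2 ^ l) k (G.y p / 2 ^ k) (G.col p) (fold G.L k (G.y p))) = e := by
  simp only [columnTable, mem_image, mem_product, mem_univ, true_and, mem_range, Prod.exists]
  constructor
  · rintro ⟨p, l, k, ⟨hl, hk⟩, he⟩
    exact ⟨p, l, hl, k, hk, he⟩
  · rintro ⟨p, l, hl, k, hk, he⟩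
    exact ⟨p, l, k, ⟨hl, hk⟩, he⟩

theorem mem_blockTable {tag : ℕ} {I : ℕ → Fin n → Set ℕ} {e : Entry} :
    e ∈ G.blockTable tag I ↔ ∃ p, ∃ l < G.L, ∃ i < G.L, ∃ u < 2 ^ G.L, Canon (I l p) i u ∧
      ([tag, G.prio l p, G.x p / 2 ^ l, 2 ^ l], blockEnd i u, 2 ^ i) = e := by
  simp only [blockTable, mem_image, mem_filter, mem_product, mem_univ, true_and, mem_range,
    Prod.exists]
  constructor
  · rintro ⟨p, l, i, u, ⟨⟨hl, hi, hu⟩, hc⟩, he⟩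
    exact ⟨p, l, hl, i, hi, u, hu, hc, he⟩
  · rintro ⟨p, l, hl, i, hi, u, hu, hc, he⟩
    exact ⟨p, l, i, u, ⟨⟨hl, hi, hu⟩, hc⟩, he⟩

theorem mem_table {X : ℕ} {e : Entry} : e ∈ G.table X ↔ e ∈ G.powTable ∨ e ∈ G.colorTable ∨
    e ∈ G.posTable ∨ e ∈ G.matTable X ∨ e ∈ G.columnTable ∨ e ∈ G.blockTable 5 G.low ∨
    e ∈ G.blockTable 6 G.high := by
  simp only [table, mem_union]; tauto

/-- The base of the digits in the tables. -/
def base : ℕ := 2 ^ (G.L + 1)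

theorem base_eq : G.base = 2 * 2 ^ G.L := by rw [base, pow_succ]; ring

theorem eight_le : 8 ≤ 2 ^ G.L :=
  calc 8 = 2 ^ 3 := by norm_num
    _ ≤ 2 ^ G.L := Nat.pow_le_pow_right (by norm_num) G.three_le

theorem pow_lt_base {i : ℕ} (hi : i < G.L) : 2 ^ i < G.base :=
  Nat.pow_lt_pow_right (by norm_num) (by omega)

theorem isKey_cons {d : ℕ} {l : List ℕ} (hd : d < G.base) (hl : IsKey G.base l) :
    IsKey G.base (d :: l) := by
  refine ⟨?_, by simp, by rw [List.getLast_cons hl.2.1]; exact hl.2.2⟩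
  intro e he
  rcases List.mem_cons.1 he with rfl | he
  exacts [hd, hl.1 e he]

theorem isKey_single {d : ℕ} (hd : d < G.base) (h0 : d ≠ 0) : IsKey G.base [d] :=
  ⟨by simpa using hd, by simp, by simpa using h0⟩

theorem isKey_append {l l' : List ℕ} (hl : IsKey G.base l) (hl' : IsKey G.base l') :
    IsKey G.base (l ++ l') := by
  refine ⟨?_, by simp [hl.2.1], by
    rw [List.getLast_append_of_ne_nil (by simp [hl.2.1]) hl'.2.1]; exact hl'.2.2⟩
  intro e he
  rcases List.mem_append.1 he with he | he
  exacts [hl.1 e he, hl'.1 e he]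

/-- The entries of the index are in the ranges of the tables. -/
def InRange (κ : Cell) : Prop := κ.l < G.L ∧ κ.i < G.L ∧ κ.j < G.L ∧ κ.g < 2 ^ G.L ∧ κ.u < 2 ^ G.L ∧
  κ.v < 2 ^ G.L

theorem inRange_of_mem_list {κ : Cell} {p : Fin n} (h : κ.l < G.L ∧ κ.i < G.L ∧ κ.j < G.L)
    (hp : p ∈ G.list κ) : G.InRange κ := by
  have hp' := G.mem_list.1 hp
  exact ⟨h.1, h.2.1, h.2.2, hp'.1 ▸ (Nat.div_le_self _ _).trans_lt (G.x_lt p),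
    (G.lt_of_canon_low hp'.2.1).2, (G.lt_of_canon_high hp'.2.2).2⟩

theorem inRange_of_mem_cells {κ : Cell} (h : κ ∈ G.cells) : G.InRange κ := by
  obtain ⟨h, p, hp⟩ := G.mem_cells.1 h
  exact G.inRange_of_mem_list h hp

theorem isKey_key {κ : Cell} (h : G.InRange κ) : IsKey G.base κ.key := by
  obtain ⟨hl, hi, hj, hg, hu, hv⟩ := h
  have := G.base_eq
  exact G.isKey_cons (by omega) <| G.isKey_cons (G.pow_lt_base hj) <| G.isKey_cons (by omega) <|
    G.isKey_cons (G.pow_lt_base hi) <| G.isKey_cons (by omega) <|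
    G.isKey_single (G.pow_lt_base hl) (by positivity)

theorem isKey_matKey {κ κ' : Cell} {m m' : ℕ} (h : G.InRange κ) (h' : G.InRange κ') (hm : m ≤ n)
    (hm' : m' ≤ n) : IsKey G.base (matKey κ κ' m m') := by
  have := G.base_eq
  have := G.n_le
  have := G.eight_le
  exact G.isKey_cons (by omega) <| G.isKey_cons (by omega) <| G.isKey_append (G.isKey_key h') <|
    G.isKey_cons (by omega) (G.isKey_key h)

theorem isKey_column {l g k e χ : ℕ} (hl : l < G.L) (hk : k < G.L) (hg : g < 2 ^ G.L)
    (he : e < 2 ^ G.L) (hχ : χ < 2 ^ G.L) : IsKey G.base [4, χ, e, 2 ^ k, g, 2 ^ l] := by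
  have := G.base_eq
  have := G.eight_le
  exact G.isKey_cons (by omega) <| G.isKey_cons (by omega) <| G.isKey_cons (by omega) <|
    G.isKey_cons (G.pow_lt_base hk) <| G.isKey_cons (by omega) <|
    G.isKey_single (G.pow_lt_base hl) (by positivity)

theorem isKey_block {tag z l g : ℕ} (ht : tag ≤ 8) (hz : z ≤ 2 ^ G.L) (hg : g < 2 ^ G.L)
    (hl : l < G.L) : IsKey G.base [tag, z, g, 2 ^ l] := by
  have := G.base_eq
  have := G.eight_le
  exact G.isKey_cons (by omega) <| G.isKey_cons (by omega) <| G.isKey_cons (by omega) <|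
    G.isKey_single (G.pow_lt_base hl) (by positivity)

theorem valid_table {X : ℕ} : ∀ e ∈ G.table X, e.Valid G.base := by
  have hB := G.base_eq
  have h8 := G.eight_le
  have hn := G.n_le
  have hdiv : ∀ p k, G.x p / 2 ^ k < 2 ^ G.L := fun p k =>
    (Nat.div_le_self _ _).trans_lt (G.x_lt p)
  have hdivy : ∀ p k, G.y p / 2 ^ k < 2 ^ G.L := fun p k =>
    (Nat.div_le_self _ _).trans_lt (by have := G.y_lt p; omega)
  intro e he
  rw [mem_table, mem_powTable, mem_colorTable, mem_posTable, mem_matTable, mem_columnTable,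
    mem_blockTable, mem_blockTable] at he
  rcases he with ⟨i, hi, rfl⟩ | ⟨κ, hκ, p, hp, rfl⟩ | ⟨κ, hκ, p, hp, rfl⟩ |
    ⟨κ, hκ, κ', hκ', -, m, m', -, hm, -, hm', rfl⟩ | ⟨p, l, hl, k, hk, rfl⟩ |
    ⟨p, l, hl, i, hi, u, hu, hc, rfl⟩ | ⟨p, l, hl, i, hi, u, hu, hc, rfl⟩
  · refine ⟨G.isKey_cons (by omega) (G.isKey_single (by omega) (by omega)), ?_, G.pow_lt_base hi⟩
    have : i < 2 ^ i := Nat.lt_two_pow_self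
    have := G.pow_lt_base hi
    simp only; omega
  · have := G.pos_le (κ := κ) (p := p)
    have := G.col_lt p
    refine ⟨G.isKey_cons (by omega) (G.isKey_key (G.inRange_of_mem_cells hκ)), ?_, ?_⟩ <;>
      simp only <;> omega
  · have := G.pos_le (κ := κ) (p := p)
    have := G.prio_le κ.l p
    refine ⟨G.isKey_cons (by omega) (G.isKey_key (G.inRange_of_mem_cells hκ)), ?_, ?_⟩ <;>
      simp only <;> omega
  · have hcard : ∀ κ m, m ≤ #(G.list κ) / X → m ≤ n := fun κ m h =>
      (h.trans (Nat.div_le_self _ _)).trans ((card_le_univ _).trans (by simp))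
    have := G.common_le κ κ' (m * X) (m' * X)
    refine ⟨G.isKey_matKey (G.inRange_of_mem_cells hκ) (G.inRange_of_mem_cells hκ') (hcard _ _ hm)
      (hcard _ _ hm'), ?_, ?_⟩ <;> simp only <;> omega
  · refine ⟨G.isKey_column hl hk (hdiv _ _) (hdivy _ _) (G.col_lt p), ?_, ?_⟩
    · have := fold_le (L := G.L) (k := k) (t := G.y p) (by have := G.y_lt p; omega)
      simp only; omega
    · have := G.columnTop_le l (G.x p / 2 ^ l) k (G.y p / 2 ^ k) (G.col p) (fold G.L k (G.y p))
      simp only; omega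
  · have := (G.lt_of_canon_low hc).1
    exact ⟨G.isKey_block (by norm_num) (G.prio_le l p) (hdiv _ _) hl, by simp only; omega,
      G.pow_lt_base hi⟩
  · have := (G.lt_of_canon_high hc).1
    exact ⟨G.isKey_block (by norm_num) (G.prio_le l p) (hdiv _ _) hl, by simp only; omega,
      G.pow_lt_base hi⟩

/-! ### Table accesses -/

/-- The successor function of the stored set. -/
noncomputable def oracle (X : ℕ) : ℕ → ℕ := succOf (tableSet G.base (G.table X))

/-- The result of a table access. -/
noncomputable def get (X : ℕ) (l : List ℕ) (z : ℕ) : ℕ :=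
  Expr.acc (G.oracle X) G.base (Nat.ofDigits G.base l) z

theorem get_cases (X : ℕ) {l : List ℕ} (hl : IsKey G.base l) {z : ℕ} (hz : z < G.base) :
    (∃ z' v, (l, z', v) ∈ G.table X ∧ z ≤ z' ∧
      (∀ z'' v', (l, z'', v') ∈ G.table X → z ≤ z'' → z' ≤ z'') ∧ G.get X l z = v) ∨
    ((∀ z' v, (l, z', v) ∈ G.table X → z' < z) ∧ G.get X l z = 0) := by
  refine acc_cases ?_ G.valid_table hl hz
  have := G.base_eq
  have := G.eight_le
  omega

theorem get_pow (X : ℕ) {i : ℕ} (hi : i < G.L) : G.get X [0, 1] i = 2 ^ i := by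
  have hB := G.base_eq
  have h8 := G.eight_le
  have hmem : ∀ z v, (([0, 1], z, v) : Entry) ∈ G.table X ↔ z < G.L ∧ v = 2 ^ z := by
    intro z v
    simp [mem_table, mem_powTable, mem_colorTable, mem_posTable, mem_matTable, mem_columnTable,
      mem_blockTable, matKey]
    intro _
    exact eq_comm
  have hi' : i < G.base := lt_trans Nat.lt_two_pow_self (G.pow_lt_base hi)
  have hkey : IsKey G.base [0, 1] :=
    G.isKey_cons (by omega) (G.isKey_single (by omega) one_ne_zero)
  rcases G.get_cases X hkey hi' with ⟨z, v, hz, h1, h2, h3⟩ | ⟨h1, -⟩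
  · have := h2 i (2 ^ i) ((hmem _ _).2 ⟨hi, rfl⟩) le_rfl
    obtain rfl : z = i := le_antisymm this h1
    rw [h3, ((hmem _ _).1 hz).2]
  · exact absurd (h1 i (2 ^ i) ((hmem _ _).2 ⟨hi, rfl⟩)) (lt_irrefl _)

theorem isKey_tag {κ : Cell} (hκ : G.InRange κ) {tag : ℕ} (ht : tag ≤ 8) :
    IsKey G.base (tag :: κ.key) := by
  have hB := G.base_eq
  have h8 := G.eight_le
  exact G.isKey_cons (by omega) (G.isKey_key hκ)

theorem mem_cells_of_mem_list {κ : Cell} (hκ : G.InRange κ) {p : Fin n} (hp : p ∈ G.list κ) :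
    κ ∈ G.cells := G.mem_cells.2 ⟨⟨hκ.1, hκ.2.1, hκ.2.2.1⟩, p, hp⟩

theorem get_pos (X : ℕ) {κ : Cell} (hκ : G.InRange κ) {τ : ℕ} (hτ : τ < G.base) :
    G.get X (2 :: κ.key) τ = numGe (G.list κ) (G.prio κ.l) τ := by
  have hmem : ∀ z v, ((2 :: κ.key, z, v) : Entry) ∈ G.table X ↔
      ∃ p ∈ G.list κ, G.prio κ.l p = z ∧ G.pos κ p = v := by
    intro z v
    simp [mem_table, mem_powTable, mem_colorTable, mem_posTable, mem_matTable, mem_columnTable,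
      mem_blockTable, matKey]
    constructor
    · rintro ⟨κ', -, p, hp, hk, hz, hv⟩
      obtain rfl := Cell.key_inj hk
      exact ⟨p, hp, hz, hv⟩
    · rintro ⟨p, hp, hz, hv⟩
      exact ⟨κ, G.mem_cells_of_mem_list hκ hp, p, hp, rfl, hz, hv⟩
  rcases G.get_cases X (G.isKey_tag hκ (tag := 2) (by norm_num)) hτ with
    ⟨z, v, hz, h1, h2, h3⟩ | ⟨h1, h3⟩
  · obtain ⟨p, hp, rfl, rfl⟩ := (hmem _ _).1 hz
    rw [h3, pos]
    refine le_antisymm ((numGe_le_iff hp τ).2 h1) ?_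
    refine card_le_card fun q hq => ?_
    rw [mem_filter] at hq ⊢
    exact ⟨hq.1, h2 _ _ ((hmem _ _).2 ⟨q, hq.1, rfl, rfl⟩) hq.2⟩
  · rw [h3, eq_comm, numGe, card_eq_zero, filter_eq_empty_iff]
    intro q hq
    exact not_le.2 (h1 _ _ ((hmem _ _).2 ⟨q, hq, rfl, rfl⟩))

theorem get_color (X : ℕ) {κ : Cell} (hκ : G.InRange κ) {p : Fin n} (hp : p ∈ G.list κ) :
    G.get X (1 :: κ.key) (G.pos κ p) = G.col p := by
  have hB := G.base_eq
  have h8 := G.eight_le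
  have hn := G.n_le
  have hmem : ∀ z v, ((1 :: κ.key, z, v) : Entry) ∈ G.table X ↔
      ∃ p ∈ G.list κ, G.pos κ p = z ∧ G.col p = v := by
    intro z v
    simp [mem_table, mem_powTable, mem_colorTable, mem_posTable, mem_matTable, mem_columnTable,
      mem_blockTable, matKey]
    constructor
    · rintro ⟨κ', -, q, hq, hk, hz, hv⟩
      obtain rfl := Cell.key_inj hk
      exact ⟨q, hq, hz, hv⟩
    · rintro ⟨q, hq, hz, hv⟩
      exact ⟨κ, G.mem_cells_of_mem_list hκ hq, q, hq, rfl, hz, hv⟩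
  have hpos : G.pos κ p < G.base := by
    have := G.pos_le (κ := κ) (p := p)
    omega
  have hpm := (hmem _ _).2 ⟨p, hp, rfl, rfl⟩
  rcases G.get_cases X (G.isKey_tag hκ (tag := 1) (by norm_num)) hpos with
    ⟨z, v, hz, h1, h2, h3⟩ | ⟨h1, h3⟩
  · obtain ⟨q, hq, rfl, rfl⟩ := (hmem _ _).1 hz
    rw [h3, numGe_injOn (G.prio_injOn κ) hq hp (le_antisymm (h2 _ _ hpm le_rfl) h1)]
  · exact absurd (h1 _ _ hpm) (lt_irrefl _)

theorem matKey_inj {κ₁ κ₂ κ₁' κ₂' : Cell} {m₁ m₂ m₁' m₂' : ℕ}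
    (h : matKey κ₁ κ₁' m₁ m₁' = matKey κ₂ κ₂' m₂ m₂') :
    κ₁ = κ₂ ∧ κ₁' = κ₂' ∧ m₁ = m₂ ∧ m₁' = m₂' := by
  simp only [matKey, List.cons.injEq, true_and] at h
  obtain ⟨h1, h2⟩ := h
  obtain ⟨h3, h4⟩ := List.append_inj h2 rfl
  simp only [List.cons.injEq] at h4
  exact ⟨Cell.key_inj h4.2, Cell.key_inj h3, h4.1, h1⟩

theorem common_eq_zero {κ κ' : Cell} {m m' : ℕ} (h : m = 0 ∨ m' = 0) : G.common κ κ' m m' = 0 := by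
  rw [common, card_eq_zero, filter_eq_empty_iff]
  rintro p hp ⟨h1, q, hq, h2, -⟩
  have h3 := one_le_numGe (f := G.prio κ.l) hp
  have h4 := one_le_numGe (f := G.prio κ'.l) hq
  rw [pos] at h1 h2
  omega

theorem get_mat (X : ℕ) {κ κ' : Cell} (hκ : G.InRange κ) (hκ' : G.InRange κ') (hs : Siblings κ κ')
    {m m' : ℕ} (hm : m ≤ #(G.list κ) / X) (hm' : m' ≤ #(G.list κ') / X) :
    G.get X (matKey κ κ' m m') 0 = G.common κ κ' (m * X) (m' * X) := by
  have hB := G.base_eq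
  have h8 := G.eight_le
  have hmem : ∀ z v, ((matKey κ κ' m m', z, v) : Entry) ∈ G.table X ↔
      κ ∈ G.cells ∧ κ' ∈ G.cells ∧ 1 ≤ m ∧ 1 ≤ m' ∧ z = 0 ∧
        v = G.common κ κ' (m * X) (m' * X) := by
    intro z v
    rw [mem_table, mem_matTable]
    simp only [mem_powTable, mem_colorTable, mem_posTable, mem_columnTable,
      mem_blockTable, Prod.mk.injEq]
    constructor
    · rintro (⟨i, -, hk, -⟩ | ⟨κ₁, -, p, -, hk, -⟩ | ⟨κ₁, -, p, -, hk, -⟩ |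
        ⟨κ₁, h1, κ₂, h2, -, m₁, m₂, h3, -, h4, -, hk, hz, hv⟩ | ⟨p, l, -, k, -, hk, -⟩ |
        ⟨p, l, -, i, -, u, -, -, hk, -⟩ | ⟨p, l, -, i, -, u, -, -, hk, -⟩)
      · simp [matKey] at hk
      · simp [matKey] at hk
      · simp [matKey] at hk
      · obtain ⟨rfl, rfl, rfl, rfl⟩ := matKey_inj hk
        exact ⟨h1, h2, h3, h4, hz.symm, hv.symm⟩
      · simp [matKey] at hk
      · simp [matKey] at hk
      · simp [matKey] at hk
    · rintro ⟨h1, h2, h3, h4, rfl, rfl⟩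
      exact .inr (.inr (.inr (.inl ⟨κ, h1, κ', h2, hs, m, m', h3, hm, h4, hm', rfl, rfl, rfl⟩)))
  have hcard : ∀ κ m, m ≤ #(G.list κ) / X → m ≤ n := fun κ m h =>
    (h.trans (Nat.div_le_self _ _)).trans ((card_le_univ _).trans (by simp))
  rcases G.get_cases X (G.isKey_matKey hκ hκ' (hcard _ _ hm) (hcard _ _ hm')) (z := 0) (by omega) with
    ⟨z, v, hz, h1, h2, h3⟩ | ⟨h1, h3⟩
  · rw [h3, ((hmem _ _).1 hz).2.2.2.2.2]
  · rw [h3, eq_comm]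
    have : ¬ (κ ∈ G.cells ∧ κ' ∈ G.cells ∧ 1 ≤ m ∧ 1 ≤ m') := fun ⟨ha, hb, hc, hd⟩ =>
      absurd (h1 0 _ ((hmem _ _).2 ⟨ha, hb, hc, hd, rfl, rfl⟩)) (lt_irrefl _)
    by_cases h0 : m = 0 ∨ m' = 0
    · exact G.common_eq_zero (by rcases h0 with rfl | rfl <;> simp)
    · rw [common, card_eq_zero, filter_eq_empty_iff]
      rintro p hp ⟨-, q, hq, -⟩
      exact this ⟨G.mem_cells_of_mem_list hκ hp, G.mem_cells_of_mem_list hκ' hq, by omega, by omega⟩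

theorem get_column (X : ℕ) {l g k e χ z : ℕ} (hl : l < G.L) (hk : k < G.L) (hg : g < 2 ^ G.L)
    (he : e < 2 ^ G.L) (hχ : χ < 2 ^ G.L) (hz : z < G.base) :
    G.get X [4, χ, e, 2 ^ k, g, 2 ^ l] z = G.columnTop l g k e χ z := by
  have hmem : ∀ z v, (([4, χ, e, 2 ^ k, g, 2 ^ l], z, v) : Entry) ∈ G.table X ↔
      ∃ p, G.x p / 2 ^ l = g ∧ G.y p / 2 ^ k = e ∧ G.col p = χ ∧ fold G.L k (G.y p) = z ∧
        G.columnTop l g k e χ z = v := by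
    intro z v
    simp [mem_table, mem_powTable, mem_colorTable, mem_posTable, mem_matTable, mem_columnTable,
      mem_blockTable, matKey, Cell.key]
    constructor
    · rintro ⟨-, -, p, ⟨h1, h2, h3⟩, rfl, hv⟩
      exact ⟨p, h3, h2, h1, rfl, by rw [← h1, ← h2, ← h3]; exact hv⟩
    · rintro ⟨p, rfl, rfl, rfl, rfl, rfl⟩
      exact ⟨hl, hk, p, ⟨rfl, rfl, rfl⟩, rfl, rfl⟩
  rcases G.get_cases X (G.isKey_column hl hk hg he hχ) hz with ⟨z', v, hz', h1, h2, h3⟩ | ⟨h1, h3⟩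
  · obtain ⟨p, hg, he, hχ, hz', hv⟩ := (hmem _ _).1 hz'
    rw [h3, ← hv, columnTop, columnTop]
    congr 1
    ext q
    simp only [column, mem_filter, mem_univ, true_and]
    refine ⟨fun h => ⟨h.1, h.2.1, h.2.2.1, h1.trans h.2.2.2⟩, fun h => ⟨h.1, h.2.1, h.2.2.1, ?_⟩⟩
    exact h2 _ _ ((hmem _ _).2 ⟨q, h.1, h.2.1, h.2.2.1, rfl, rfl⟩) h.2.2.2
  · have : G.column l g k e χ z = ∅ := by
      rw [column, filter_eq_empty_iff]
      rintro q - ⟨ha, hb, hc, hd⟩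
      exact absurd (h1 _ _ ((hmem _ _).2 ⟨q, ha, hb, hc, rfl, rfl⟩)) (not_lt.2 hd)
    rw [h3, columnTop, this, sup_empty]; rfl

theorem get_block (X : ℕ) {tag : ℕ} {I : ℕ → Fin n → Set ℕ}
    (hI : (tag = 5 ∧ I = G.low) ∨ (tag = 6 ∧ I = G.high)) {l i c : ℕ} {p : Fin n} (hl : l < G.L)
    (hi : i < G.L) (hc : c < 2 ^ G.L) (hcanon : Canon (I l p) i (c / 2 ^ i)) :
    G.get X [tag, G.prio l p, G.x p / 2 ^ l, 2 ^ l] c = 2 ^ i := by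
  have hB := G.base_eq
  have hmem : ∀ z v, (([tag, G.prio l p, G.x p / 2 ^ l, 2 ^ l], z, v) : Entry) ∈ G.table X ↔
      ∃ i < G.L, ∃ u < 2 ^ G.L, Canon (I l p) i u ∧ blockEnd i u = z ∧ 2 ^ i = v := by
    have hiff : ∀ z v, (([tag, G.prio l p, G.x p / 2 ^ l, 2 ^ l], z, v) : Entry) ∈ G.table X ↔
        (([tag, G.prio l p, G.x p / 2 ^ l, 2 ^ l], z, v) : Entry) ∈ G.blockTable tag I := by
      intro z v
      rcases hI with ⟨rfl, rfl⟩ | ⟨rfl, rfl⟩ <;>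
      simp [mem_table, mem_powTable, mem_colorTable, mem_posTable, mem_matTable, mem_columnTable,
        mem_blockTable, matKey, Cell.key]
    intro z v
    rw [hiff, mem_blockTable]
    simp only [Prod.mk.injEq, List.cons.injEq, and_true, true_and, Nat.pow_right_inj (le_refl 2)]
    constructor
    · rintro ⟨q, l', -, i, hi, u, hu, hc, ⟨h1, h2, rfl⟩, rfl, rfl⟩
      obtain rfl := G.prio_inj h2 h1
      exact ⟨i, hi, u, hu, hc, rfl, rfl⟩
    · rintro ⟨i, hi, u, hu, hc, rfl, rfl⟩
      exact ⟨p, l, hl, i, hi, u, hu, hc, ⟨rfl, rfl, rfl⟩, rfl, rfl⟩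
  have hself := (hmem _ _).2 ⟨i, hi, c / 2 ^ i, (Nat.div_le_self _ _).trans_lt hc, hcanon, rfl, rfl⟩
  have hg : G.x p / 2 ^ l < 2 ^ G.L := (Nat.div_le_self _ _).trans_lt (G.x_lt p)
  rcases G.get_cases X (G.isKey_block (tag := tag) (by omega) (G.prio_le l p) hg hl)
    (z := c) (by omega) with ⟨z, v, hz, h1, h2, h3⟩ | ⟨h1, h3⟩
  · obtain ⟨j, -, v, -, hj, rfl, rfl⟩ := (hmem _ _).1 hz
    rw [h3, hcanon.blockEnd_le hj h1 (h2 _ _ hself le_blockEnd)]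
  · exact absurd (h1 _ _ hself) (not_lt.2 le_blockEnd)

end Grid

/-! ### Counting colors on two sides -/

theorem sum_ite_exists {α : Type*} (s : Finset α) (Q : α → Prop) [DecidablePred Q]
    [Decidable (∃ q ∈ s, Q q)] (h : ∀ p ∈ s, ∀ q ∈ s, Q p → Q q → p = q) :
    ∑ q ∈ s, (if Q q then 1 else 0) = if ∃ q ∈ s, Q q then 1 else 0 := by
  split_ifs with hex
  · obtain ⟨q, hq, hQ⟩ := hex
    rw [sum_eq_single_of_mem q hq fun p hp hne => if_neg fun hQp => hne (h p hp q hq hQp hQ), if_pos hQ]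
  · exact sum_eq_zero fun q hq => if_neg fun hQ => hex ⟨q, hq, hQ⟩

/-- The number of colors in two sets in each of which all colors are distinct.  The common colors are
split up by a part `F` of the first set and a part `F'` of the second. -/
theorem card_image_union_eq {α : Type*} [DecidableEq α] {f : α → ℕ} {A A' F F' : Finset α}
    (hA : Set.InjOn f A) (hA' : Set.InjOn f A') (hF : F ⊆ A) (hF' : F' ⊆ A') :
    #((A ∪ A').image f) = (#A + #A') - (#{p ∈ F | ∃ q ∈ F', f q = f p} +
      #{p ∈ A \ F | ∃ q ∈ A', f q = f p} + #{q ∈ A' \ F' | ∃ p ∈ F, f p = f q}) := by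
  have h1 : #((A ∪ A').image f) + #(A.image f ∩ A'.image f) = #A + #A' := by
    rw [image_union, card_union_add_card_inter, card_image_of_injOn hA, card_image_of_injOn hA']
  have h2 : A.image f ∩ A'.image f = {p ∈ A | ∃ q ∈ A', f q = f p}.image f := by
    ext v
    simp only [mem_inter, mem_image, mem_filter]
    constructor
    · rintro ⟨⟨p, hp, rfl⟩, q, hq, h⟩
      exact ⟨p, ⟨hp, q, hq, h⟩, rfl⟩
    · rintro ⟨p, ⟨hp, q, hq, h⟩, rfl⟩
      exact ⟨⟨p, hp, rfl⟩, q, hq, h⟩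
  have h3 : #{p ∈ A | ∃ q ∈ A', f q = f p} =
      #{p ∈ F | ∃ q ∈ A', f q = f p} + #{p ∈ A \ F | ∃ q ∈ A', f q = f p} := by
    rw [← card_union_of_disjoint, ← filter_union, union_sdiff_of_subset hF]
    exact disjoint_filter_filter disjoint_sdiff
  have h4 : #{p ∈ F | ∃ q ∈ A', f q = f p} = #{q ∈ A' | ∃ p ∈ F, f p = f q} := by
    rw [← card_image_of_injOn (hA.mono (coe_subset.2 ((filter_subset _ _).trans hF))),
      ← card_image_of_injOn (hA'.mono (coe_subset.2 (filter_subset _ _)))]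
    congr 1
    ext v
    simp only [mem_image, mem_filter]
    constructor
    · rintro ⟨p, ⟨hp, q, hq, h⟩, rfl⟩
      exact ⟨q, ⟨hq, p, hp, h.symm⟩, h⟩
    · rintro ⟨q, ⟨hq, p, hp, h⟩, rfl⟩
      exact ⟨p, ⟨hp, q, hq, h.symm⟩, h⟩
  have h5 : #{q ∈ A' | ∃ p ∈ F, f p = f q} =
      #{q ∈ F' | ∃ p ∈ F, f p = f q} + #{q ∈ A' \ F' | ∃ p ∈ F, f p = f q} := by
    rw [← card_union_of_disjoint, ← filter_union, union_sdiff_of_subset hF']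
    exact disjoint_filter_filter disjoint_sdiff
  have h6 : #{q ∈ F' | ∃ p ∈ F, f p = f q} = #{p ∈ F | ∃ q ∈ F', f q = f p} := by
    rw [← card_image_of_injOn (hA.mono (coe_subset.2 ((filter_subset _ _).trans hF))),
      ← card_image_of_injOn (hA'.mono (coe_subset.2 ((filter_subset _ _).trans hF')))]
    congr 1
    ext v
    simp only [mem_image, mem_filter]
    constructor
    · rintro ⟨p, ⟨hp, q, hq, h⟩, rfl⟩
      exact ⟨q, ⟨hq, p, hp, h.symm⟩, h⟩
    · rintro ⟨q, ⟨hq, p, hp, h⟩, rfl⟩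
      exact ⟨p, ⟨hp, q, hq, h.symm⟩, h⟩
  rw [h2, card_image_of_injOn (hA.mono (coe_subset.2 (filter_subset _ _)))] at h1
  omega

namespace Grid

variable {n : ℕ} (G : Grid n)

/-- The representatives on one side of a query: those in block `g` of length `2 ^ l` with priority at
least `τ`. -/
noncomputable def side (l g c d τ : ℕ) : Finset (Fin n) := {p ∈ G.reps l g c d | τ ≤ G.prio l p}

theorem mem_side {l g c d τ : ℕ} {p : Fin n} :
    p ∈ G.side l g c d τ ↔ p ∈ G.reps l g c d ∧ τ ≤ G.prio l p := mem_filter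

/-- The length of the part of a list that consists of full blocks of `X` elements with priority at
least `τ`. -/
noncomputable def fullLen (X : ℕ) (κ : Cell) (τ : ℕ) : ℕ := numGe (G.list κ) (G.prio κ.l) τ / X * X

open scoped Classical in
/-- The representatives on one side of a query that are in full blocks of their lists. -/
noncomputable def fullPart (X l g c d τ : ℕ) : Finset (Fin n) :=
  {p ∈ G.reps l g c d | ∃ i < G.L, ∃ j < G.L, p ∈ G.list (cellAt l g c d i j) ∧
    G.pos (cellAt l g c d i j) p ≤ G.fullLen X (cellAt l g c d i j) τ}

theorem prio_ge_of_pos_le {X : ℕ} {κ : Cell} {τ : ℕ} {p : Fin n} (hp : p ∈ G.list κ)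
    (h : G.pos κ p ≤ G.fullLen X κ τ) : τ ≤ G.prio κ.l p :=
  (numGe_le_iff hp τ).1 (h.trans (Nat.div_mul_le_self _ _))

theorem fullPart_subset (X l g c d τ : ℕ) : G.fullPart X l g c d τ ⊆ G.side l g c d τ := by
  intro p hp
  simp only [fullPart, mem_filter] at hp
  obtain ⟨hr, i, -, j, -, hl, h⟩ := hp
  exact G.mem_side.2 ⟨hr, G.prio_ge_of_pos_le hl h⟩

theorem cellAt_unique {l g c d i j i' j' : ℕ} {p : Fin n} (hp : p ∈ G.list (cellAt l g c d i j))
    (hp' : p ∈ G.list (cellAt l g c d i' j')) : i = i' ∧ j = j' := by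
  simp only [mem_list, cellAt] at hp hp'
  exact ⟨hp.2.1.level_unique hp'.2.1, hp.2.2.level_unique hp'.2.2⟩

theorem mem_reps_of_mem_list {l g c d i j : ℕ} {p : Fin n}
    (hp : p ∈ G.list (cellAt l g c d i j)) : p ∈ G.reps l g c d := by
  simp only [mem_list, cellAt] at hp
  exact G.mem_reps.2 ⟨hp.1, hp.2.1.mem, hp.2.2.mem⟩

theorem mem_fullPart_iff {X l g c d τ i j : ℕ} (hi : i < G.L) (hj : j < G.L) {p : Fin n}
    (hp : p ∈ G.list (cellAt l g c d i j)) : p ∈ G.fullPart X l g c d τ ↔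
      G.pos (cellAt l g c d i j) p ≤ G.fullLen X (cellAt l g c d i j) τ := by
  simp only [fullPart, mem_filter]
  constructor
  · rintro ⟨-, i', -, j', -, hp', h⟩
    obtain ⟨rfl, rfl⟩ := G.cellAt_unique hp hp'
    exact h
  · exact fun h => ⟨G.mem_reps_of_mem_list hp, i, hi, j, hj, hp, h⟩

/-! ### Correctness of the query -/

section Query

variable {X : ℕ}

theorem acc_pow {i : ℕ} (hi : i < G.L) : Expr.acc (G.oracle X) G.base G.base i = 2 ^ i := by
  have := G.get_pow X hi
  simpa [get, Nat.ofDigits] using this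

theorem lam_eq (κ : Cell) (B : ℕ) :
    Expr.lam B (2 ^ κ.l) κ.g (2 ^ κ.i) κ.u (2 ^ κ.j) κ.v = Nat.ofDigits B κ.key := by
  simp [Expr.lam, Cell.key, Nat.ofDigits]; ring

theorem lam_cellAt {l g c d i j : ℕ} (hi : i < G.L) (hj : j < G.L) :
    Expr.lam G.base (2 ^ l) g (Expr.acc (G.oracle X) G.base G.base i)
      (c / Expr.acc (G.oracle X) G.base G.base i) (Expr.acc (G.oracle X) G.base G.base j)
      (d / Expr.acc (G.oracle X) G.base G.base j) =
    Nat.ofDigits G.base (cellAt l g c d i j).key := by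
  rw [G.acc_pow hi, G.acc_pow hj]
  exact lam_eq (cellAt l g c d i j) G.base

theorem inRange_cellAt {l g c d i j : ℕ} (hl : l < G.L) (hg : g < 2 ^ G.L) (hc : c < 2 ^ G.L)
    (hd : d < 2 ^ G.L) (hi : i < G.L) (hj : j < G.L) : G.InRange (cellAt l g c d i j) :=
  ⟨hl, hi, hj, hg, (Nat.div_le_self _ _).trans_lt hc, (Nat.div_le_self _ _).trans_lt hd⟩

theorem cnt_eq {κ : Cell} (hκ : G.InRange κ) {τ : ℕ} (hτ : τ < G.base) :
    Expr.cnt (G.oracle X) G.base (Nat.ofDigits G.base κ.key) τ =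
      numGe (G.list κ) (G.prio κ.l) τ := by
  rw [← G.get_pos X hκ hτ, get, Expr.cnt]
  congr 1
  simp [Nat.ofDigits]; ring

theorem ofDigits_matKey (κ κ' : Cell) (m m' B : ℕ) : Nat.ofDigits B (matKey κ κ' m m') =
    ((Nat.ofDigits B κ.key * B + m) * (B * B * B * B * B * B * B) +
      (Nat.ofDigits B κ'.key * B + m')) * B + 3 := by
  have h : κ'.key.length = 6 := rfl
  rw [matKey, Nat.ofDigits_cons, Nat.ofDigits_cons, Nat.ofDigits_append, Nat.ofDigits_cons, h]
  ring

theorem acc_mat_eq {κ κ' : Cell} (hκ : G.InRange κ) (hκ' : G.InRange κ') (hs : Siblings κ κ')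
    {m m' : ℕ} (hm : m ≤ #(G.list κ) / X) (hm' : m' ≤ #(G.list κ') / X) :
    Expr.acc (G.oracle X) G.base (((Nat.ofDigits G.base κ.key * G.base + m) *
      (G.base * G.base * G.base * G.base * G.base * G.base * G.base) +
      (Nat.ofDigits G.base κ'.key * G.base + m')) * G.base + 3) 0 =
    G.common κ κ' (m * X) (m' * X) := by
  rw [← G.get_mat X hκ hκ' hs hm hm', get, ofDigits_matKey]

theorem acc_color_eq {κ : Cell} (hκ : G.InRange κ) {p : Fin n} (hp : p ∈ G.list κ) :
    Expr.acc (G.oracle X) G.base (Nat.ofDigits G.base κ.key * G.base + 1) (G.pos κ p) = G.col p := by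
  rw [← G.get_color X hκ hp, get]
  congr 1
  simp [Nat.ofDigits]; ring

theorem denote_sizeE_eq {l g c d : ℕ} (hl : l < G.L) (hg : g < 2 ^ G.L) (hc : c < 2 ^ G.L)
    (hd : d < 2 ^ G.L) {τ : ℕ} (hτ : τ < G.base) (e₁ e₂ e₃ e₄ e₅ : ℕ) :
    Expr.sizeE.denote (G.oracle X) [2 ^ l, g, τ, c, d, G.base, X, G.L, e₁, e₂, e₃, e₄, e₅] =
      #(G.side l g c d τ) := by
  rw [Expr.denote_sizeE, side, card_filter, sum_reps]
  refine sum_congr rfl fun i hi => sum_congr rfl fun j hj => ?_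
  rw [mem_range] at hi hj
  rw [G.lam_cellAt hi hj, G.cnt_eq (G.inRange_cellAt hl hg hc hd hi hj) hτ, numGe, card_filter]
  rfl

open scoped Classical in
theorem denote_matE_eq {l g c d : ℕ} (hl : l < G.L) (hg : g < 2 ^ G.L) (hc : c < 2 ^ G.L)
    (hd : d < 2 ^ G.L) {τ g' τ' : ℕ} (hg' : g' = g + 1) (hgl : g' < 2 ^ G.L) (h2 : g % 2 = 0)
    (hτ : τ < G.base) (hτ' : τ' < G.base) (e₃ e₄ e₅ : ℕ) :
    Expr.matE.denote (G.oracle X) [2 ^ l, g, τ, c, d, G.base, X, G.L, g', τ', e₃, e₄, e₅] =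
      #{p ∈ G.fullPart X l g c d τ | ∃ q ∈ G.fullPart X l g' c d τ', G.col q = G.col p} := by
  rw [Expr.denote_matE]
  have hF : {p ∈ G.fullPart X l g c d τ | ∃ q ∈ G.fullPart X l g' c d τ', G.col q = G.col p} =
      {p ∈ G.reps l g c d | p ∈ G.fullPart X l g c d τ ∧
        ∃ q ∈ G.fullPart X l g' c d τ', G.col q = G.col p} := by
    ext p
    simp only [mem_filter]
    exact ⟨fun h => ⟨(G.mem_side.1 (G.fullPart_subset _ _ _ _ _ _ h.1)).1, h⟩, fun h => h.2⟩
  rw [hF, card_filter, sum_reps]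
  refine sum_congr rfl fun i hi => sum_congr rfl fun j hj => ?_
  rw [mem_range] at hi hj
  have hκ := G.inRange_cellAt hl hg hc hd hi hj
  have hinner : ∀ p, (if ∃ q ∈ G.fullPart X l g' c d τ', G.col q = G.col p then 1 else 0) =
      ∑ i' ∈ range G.L, ∑ j' ∈ range G.L, if ∃ q ∈ G.list (cellAt l g' c d i' j'),
        G.pos (cellAt l g' c d i' j') q ≤ G.fullLen X (cellAt l g' c d i' j') τ' ∧
          G.col q = G.col p then 1 else 0 := by
    intro p
    have h1 : (∃ q ∈ G.fullPart X l g' c d τ', G.col q = G.col p) ↔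
        ∃ q ∈ G.reps l g' c d, q ∈ G.fullPart X l g' c d τ' ∧ G.col q = G.col p :=
      ⟨fun ⟨q, h, h'⟩ => ⟨q, (G.mem_side.1 (G.fullPart_subset _ _ _ _ _ _ h)).1, h, h'⟩,
        fun ⟨q, _, h⟩ => ⟨q, h⟩⟩
    rw [if_congr h1 rfl rfl, ← sum_ite_exists, sum_reps]
    · refine sum_congr rfl fun i' hi' => sum_congr rfl fun j' hj' => ?_
      rw [mem_range] at hi' hj'
      rw [← sum_ite_exists]
      · exact sum_congr rfl fun q hq => if_congr (by rw [G.mem_fullPart_iff hi' hj' hq]) rfl rfl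
      · exact fun q hq r hr h h' => G.list_col_inj hq hr (h.2.trans h'.2.symm)
    · exact fun q hq r hr h h' => G.reps_col_inj hq hr (h.2.trans h'.2.symm)
  have hout : ∀ p ∈ G.list (cellAt l g c d i j), (if p ∈ G.fullPart X l g c d τ ∧
      ∃ q ∈ G.fullPart X l g' c d τ', G.col q = G.col p then 1 else 0) =
      ∑ i' ∈ range G.L, ∑ j' ∈ range G.L,
        if G.pos (cellAt l g c d i j) p ≤ G.fullLen X (cellAt l g c d i j) τ ∧
          ∃ q ∈ G.list (cellAt l g' c d i' j'),
            G.pos (cellAt l g' c d i' j') q ≤ G.fullLen X (cellAt l g' c d i' j') τ' ∧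
            G.col q = G.col p then 1 else 0 := by
    intro p hp
    have hiff := G.mem_fullPart_iff (X := X) (τ := τ) hi hj hp
    by_cases h : G.pos (cellAt l g c d i j) p ≤ G.fullLen X (cellAt l g c d i j) τ
    · simp only [h, hiff, true_and]
      exact hinner p
    · simp [h, hiff]
  rw [sum_congr rfl hout]
  symm
  rw [sum_comm]
  refine sum_congr rfl fun i' hi' => ?_
  rw [sum_comm]
  refine sum_congr rfl fun j' hj' => ?_
  rw [mem_range] at hi' hj'
  have hκ' := G.inRange_cellAt hl hgl hc hd hi' hj'
  rw [← card_filter, G.lam_cellAt hi hj, G.lam_cellAt hi' hj']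
  dsimp only
  rw [G.cnt_eq hκ hτ, G.cnt_eq hκ' hτ']
  symm
  exact G.acc_mat_eq hκ hκ' ⟨rfl, h2, hg'⟩ (Nat.div_le_div_right (numGe_le_card _))
    (Nat.div_le_div_right (numGe_le_card _))

theorem mem_column_or_iff {l g k c d χ : ℕ} (hs : Separates k c d) {q : Fin n} :
    q ∈ G.column l g k (c / 2 ^ k) χ c ∪ G.column l g k (d / 2 ^ k) χ (2 ^ G.L - d) ↔
      G.x q / 2 ^ l = g ∧ G.col q = χ ∧ c ≤ G.y q ∧ G.y q ≤ d := by
  have hy := G.y_lt q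
  have h1 : fold G.L k c = c := if_pos hs.sibling.1
  have h2 : fold G.L k d = 2 ^ G.L - d := if_neg (by have := hs.sibling; omega)
  rw [hs.mem_Icc_iff (L := G.L) (by omega), h1, h2]
  simp only [column, mem_union, mem_filter, mem_univ, true_and]
  tauto

theorem top_eq {l g k c d χ : ℕ} (hl : l < G.L) (hg : g < 2 ^ G.L) (hc : c < 2 ^ G.L)
    (hd : d < 2 ^ G.L) (hk : k < G.L) (hs : Separates k c d) (hχ : χ < 2 ^ G.L) :
    Expr.top (G.oracle X) (2 ^ l) g c d G.base (2 ^ k) (2 ^ G.L) χ =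
      ({q | G.x q / 2 ^ l = g ∧ G.col q = χ ∧ c ≤ G.y q ∧ G.y q ≤ d} : Finset (Fin n)).sup
        fun q => G.prio l q + 1 := by
  have hB := G.base_eq
  have h1 := G.get_column X hl hk hg ((Nat.div_le_self c (2 ^ k)).trans_lt hc) hχ (z := c) (by omega)
  have h2 := G.get_column X hl hk hg ((Nat.div_le_self d (2 ^ k)).trans_lt hd) hχ
    (z := 2 ^ G.L - d) (by omega)
  have he : ∀ e, Nat.ofDigits G.base [4, χ, e, 2 ^ k, g, 2 ^ l] =
      ((((2 ^ l * G.base + g) * G.base + 2 ^ k) * G.base + e) * G.base + χ) * G.base + 4 := by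
    intro e
    simp only [Nat.ofDigits_cons, Nat.ofDigits_nil]
    ring
  rw [get, he] at h1 h2
  rw [Expr.top, h1, h2]
  refine (sup_union (f := fun q => G.prio l q + 1)).symm.trans ?_
  congr 1
  ext q
  rw [G.mem_column_or_iff hs]
  simp

theorem top_eq_of_mem_reps {l g k c d : ℕ} (hl : l < G.L) (hg : g < 2 ^ G.L) (hc : c < 2 ^ G.L)
    (hd : d < 2 ^ G.L) (hk : k < G.L) (hs : Separates k c d) {q : Fin n} (hq : q ∈ G.reps l g c d) :
    Expr.top (G.oracle X) (2 ^ l) g c d G.base (2 ^ k) (2 ^ G.L) (G.col q) = G.prio l q + 1 := by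
  rw [G.top_eq hl hg hc hd hk hs (G.col_lt q)]
  have hq' := G.mem_reps.1 hq
  refine le_antisymm (Finset.sup_le fun r hr => ?_) ?_
  · simp only [mem_filter, mem_univ, true_and] at hr
    by_contra hlt
    have hb : G.Beats l r q := ⟨hr.1.trans hq'.1.symm, hr.2.1, by omega⟩
    rcases le_total (G.y r) (G.y q) with hy | hy
    · exact hq'.2.1.2 r hb ⟨hr.2.2.1, hy⟩
    · exact hq'.2.2.2.2 r hb ⟨hy, hr.2.2.2⟩
  · refine le_sup (f := fun q => G.prio l q + 1) ?_
    simp only [mem_filter, mem_univ, true_and]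
    exact ⟨hq'.1, hq'.2.1.1, hq'.2.2.2.1⟩

theorem top_eq_zero {l g k c d χ : ℕ} (hl : l < G.L) (hg : g < 2 ^ G.L) (hc : c < 2 ^ G.L)
    (hd : d < 2 ^ G.L) (hk : k < G.L) (hs : Separates k c d) (hχ : χ < 2 ^ G.L)
    (h : ∀ q ∈ G.reps l g c d, G.col q ≠ χ) :
    Expr.top (G.oracle X) (2 ^ l) g c d G.base (2 ^ k) (2 ^ G.L) χ = 0 := by
  rw [G.top_eq hl hg hc hd hk hs hχ, ← Nat.bot_eq_zero, Finset.sup_eq_bot_iff]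
  intro r hr
  simp only [mem_filter, mem_univ, true_and] at hr
  obtain ⟨q, hq, hcol, -⟩ := G.exists_rep (l := l) hr.2.2.1 hr.2.2.2 hd
  exact absurd (hcol.trans hr.2.1) (h q (hr.1 ▸ hq))

theorem acc_block_eq {l i c : ℕ} {p : Fin n} {tag : ℕ} {I : ℕ → Fin n → Set ℕ}
    (hI : (tag = 5 ∧ I = G.low) ∨ (tag = 6 ∧ I = G.high)) (hl : l < G.L) (hi : i < G.L)
    (hc : c < 2 ^ G.L) (hcanon : Canon (I l p) i (c / 2 ^ i)) :
    Expr.acc (G.oracle X) G.base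
      (((2 ^ l * G.base + G.x p / 2 ^ l) * G.base + G.prio l p) * G.base + tag) c = 2 ^ i := by
  rw [← G.get_block X hI hl hi hc hcanon, get]
  congr 1
  simp only [Nat.ofDigits_cons, Nat.ofDigits_nil]
  ring

theorem full_eq {l g c d τ i j : ℕ} (hl : l < G.L) (hg : g < 2 ^ G.L) (hc : c < 2 ^ G.L)
    (hd : d < 2 ^ G.L) (hτ : τ < G.base) (hi : i < G.L) (hj : j < G.L) {q : Fin n}
    (hq : q ∈ G.list (cellAt l g c d i j)) [Decidable (q ∈ G.fullPart X l g c d τ)] :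
    Expr.full (G.oracle X) (2 ^ l) g τ c d G.base X (G.prio l q + 1) =
      if q ∈ G.fullPart X l g c d τ then 1 else 0 := by
  have hκ := G.inRange_cellAt hl hg hc hd hi hj
  have hq' := G.mem_list.1 hq
  simp only [cellAt] at hq'
  obtain ⟨rfl, hci, hdj⟩ := hq'
  have h5 := G.acc_block_eq (X := X) (.inl ⟨rfl, rfl⟩) hl hi hc hci
  have h6 := G.acc_block_eq (X := X) (.inr ⟨rfl, rfl⟩) hl hj hd hdj
  have hlam := lam_eq (cellAt l (G.x q / 2 ^ l) c d i j) G.base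
  simp only [cellAt] at hlam
  have hp : G.prio l q < G.base := by
    have := G.prio_le l q
    have := G.base_eq
    have := G.eight_le
    omega
  have c1 := G.cnt_eq (X := X) hκ hp
  have c2 := G.cnt_eq (X := X) hκ hτ
  simp only [cellAt] at c1 c2
  rw [Expr.full, Nat.add_sub_cancel, h5, h6, hlam, c1, c2]
  exact if_congr (G.mem_fullPart_iff hi hj hq).symm rfl rfl

theorem check_eq {l g k c d τ F χ : ℕ} (hl : l < G.L) (hg : g < 2 ^ G.L) (hc : c < 2 ^ G.L)
    (hd : d < 2 ^ G.L) (hk : k < G.L) (hs : Separates k c d) (hτ : τ < G.base) (hχ : χ < 2 ^ G.L)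
    {A : Finset (Fin n)} (hA : A = if F = 0 then G.side l g c d τ else G.fullPart X l g c d τ)
    [Decidable (∃ q ∈ A, G.col q = χ)] :
    Expr.check (G.oracle X) (2 ^ l) g τ c d G.base X (2 ^ k) (2 ^ G.L) F χ =
      if ∃ q ∈ A, G.col q = χ then 1 else 0 := by
  classical
  have hAs : A ⊆ G.side l g c d τ := by
    rw [hA]; split_ifs
    exacts [subset_rfl, G.fullPart_subset _ _ _ _ _ _]
  rw [Expr.check]
  by_cases hex : ∃ q ∈ G.reps l g c d, G.col q = χ
  · obtain ⟨q, hq, rfl⟩ := hex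
    have huniq : (∃ r ∈ A, G.col r = G.col q) ↔ q ∈ A := by
      refine ⟨fun ⟨r, hr, h⟩ => ?_, fun h => ⟨q, h, rfl⟩⟩
      rwa [← G.reps_col_inj (G.mem_side.1 (hAs hr)).1 hq h]
    rw [G.top_eq_of_mem_reps hl hg hc hd hk hs hq, if_congr huniq rfl rfl]
    split_ifs with h1 h2 h3 h3 h3
    · have := (G.mem_side.1 (hAs h2)).2
      omega
    · rfl
    · rfl
    · rw [hA, if_pos (by omega), mem_side] at h3
      exact absurd ⟨hq, by omega⟩ h3
    · obtain ⟨i, hi, hci⟩ := G.exists_canon_low (G.mem_reps.1 hq).2.1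
      obtain ⟨j, hj, hdj⟩ := G.exists_canon_high (G.mem_reps.1 hq).2.2
      have hql : q ∈ G.list (cellAt l g c d i j) := G.mem_list.2 ⟨(G.mem_reps.1 hq).1, hci, hdj⟩
      rw [G.full_eq hl hg hc hd hτ hi hj hql]
      rw [hA, if_neg (by omega)] at h3
      exact if_pos h3
    · obtain ⟨i, hi, hci⟩ := G.exists_canon_low (G.mem_reps.1 hq).2.1
      obtain ⟨j, hj, hdj⟩ := G.exists_canon_high (G.mem_reps.1 hq).2.2
      have hql : q ∈ G.list (cellAt l g c d i j) := G.mem_list.2 ⟨(G.mem_reps.1 hq).1, hci, hdj⟩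
      rw [G.full_eq hl hg hc hd hτ hi hj hql]
      rw [hA, if_neg (by omega)] at h3
      exact if_neg h3
  · have h0 : ¬ ∃ q ∈ A, G.col q = χ := fun ⟨q, hq, h⟩ => hex ⟨q, (G.mem_side.1 (hAs hq)).1, h⟩
    rw [G.top_eq_zero hl hg hc hd hk hs hχ fun q hq h => hex ⟨q, hq, h⟩, if_pos (Nat.zero_le _),
      if_neg h0]

open scoped Classical in
theorem denote_leftoverE_eq {l g g' k c d τ τ' F : ℕ} (hl : l < G.L) (hg : g < 2 ^ G.L)
    (hc : c < 2 ^ G.L) (hd : d < 2 ^ G.L) (hg' : g' < 2 ^ G.L) (hk : k < G.L)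
    (hs : Separates k c d) (hτ : τ < G.base) (hτ' : τ' < G.base) {A : Finset (Fin n)}
    (hA : A = if F = 0 then G.side l g' c d τ' else G.fullPart X l g' c d τ') :
    Expr.leftoverE.denote (G.oracle X)
      [2 ^ l, g, τ, c, d, G.base, X, G.L, g', τ', 2 ^ k, 2 ^ G.L, F] =
      #{p ∈ G.side l g c d τ \ G.fullPart X l g c d τ | ∃ q ∈ A, G.col q = G.col p} := by
  have h1 : {p ∈ G.side l g c d τ \ G.fullPart X l g c d τ | ∃ q ∈ A, G.col q = G.col p} =
      {p ∈ G.reps l g c d | (τ ≤ G.prio l p ∧ p ∉ G.fullPart X l g c d τ) ∧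
        ∃ q ∈ A, G.col q = G.col p} := by
    ext p
    simp only [mem_filter, mem_sdiff, mem_side]
    tauto
  rw [Expr.denote_leftoverE, h1, card_filter, sum_reps]
  refine sum_congr rfl fun i hi => sum_congr rfl fun j hj => ?_
  rw [mem_range] at hi hj
  have hκ := G.inRange_cellAt hl hg hc hd hi hj
  rw [G.lam_cellAt hi hj]
  dsimp only
  rw [G.cnt_eq hκ hτ]
  rw [sum_positions (f := G.prio (cellAt l g c d i j).l) (G.prio_injOn _) τ _ fun m =>
    Expr.check (G.oracle X) (2 ^ l) g' τ' c d G.base X (2 ^ k) (2 ^ G.L) F (Expr.acc (G.oracle X)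
      G.base (Nat.ofDigits G.base (cellAt l g c d i j).key * G.base + 1) m), sum_filter]
  refine sum_congr rfl fun p hp => ?_
  have h2 := G.acc_color_eq (X := X) hκ hp
  have h3 := G.check_eq hl hg' hc hd hk hs hτ' (G.col_lt p) hA
  have h4 := G.mem_fullPart_iff (X := X) (τ := τ) hi hj hp
  rw [pos] at h2 h4
  rw [h2, h3, ← ite_and]
  refine if_congr ?_ rfl rfl
  rw [h4, fullLen, not_le]
  rfl

/-- The query counts the colors on both sides of the boundary between sibling blocks. -/
theorem denote_nodeE_eq {l g g' k c d τ τ' : ℕ} (hl : l < G.L) (hg : g < 2 ^ G.L)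
    (hc : c < 2 ^ G.L) (hd : d < 2 ^ G.L) (hg' : g' = g + 1) (hgl : g' < 2 ^ G.L) (h2 : g % 2 = 0)
    (hk : k < G.L) (hs : Separates k c d) (hτ : τ < G.base) (hτ' : τ' < G.base) :
    Expr.nodeE.denote (G.oracle X)
      [2 ^ l, g, τ, g', τ', c, d, G.base, X, G.L, 2 ^ k, 2 ^ G.L] =
      #((G.side l g c d τ ∪ G.side l g' c d τ').image G.col) := by
  classical
  rw [Expr.denote_nodeE, G.denote_sizeE_eq hl hg hc hd hτ, G.denote_sizeE_eq hl hgl hc hd hτ',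
    G.denote_matE_eq hl hg hc hd hg' hgl h2 hτ hτ',
    G.denote_leftoverE_eq hl hg hc hd hgl hk hs hτ hτ' (if_pos rfl).symm,
    G.denote_leftoverE_eq hl hgl hc hd hg hk hs hτ' hτ (if_neg one_ne_zero).symm]
  have hinj : ∀ g τ, Set.InjOn G.col (G.side l g c d τ) := fun g τ p hp q hq =>
    G.reps_col_inj (G.mem_side.1 hp).1 (G.mem_side.1 hq).1
  rw [card_image_union_eq (hinj g τ) (hinj g' τ') (G.fullPart_subset X l g c d τ)
    (G.fullPart_subset X l g' c d τ')]
  congr!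

theorem denote_lcaE_eq {k a b : ℕ} (hk : k < G.L) (hs : Separates k a b) :
    Expr.lcaE.denote (G.oracle X) [a, b, G.base, G.L] = 2 ^ k := by
  rw [Expr.denote_lcaE, sum_eq_single_of_mem k (mem_range.2 hk)]
  · rw [G.acc_pow hk, ← pow_succ]
    exact (if_pos hs.1).trans (if_pos hs.2)
  · intro j hj hne
    rw [G.acc_pow (mem_range.1 hj), ← pow_succ]
    split_ifs with h1 h2
    · exact absurd (Separates.unique ⟨h1, h2⟩ hs) hne
    · rfl
    · rfl

theorem denote_lcaE_eq_zero {a b : ℕ} (hab : b ≤ a) :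
    Expr.lcaE.denote (G.oracle X) [a, b, G.base, G.L] = 0 := by
  rw [Expr.denote_lcaE]
  refine sum_eq_zero fun k hk => if_neg ?_
  have := Nat.div_le_div_right (c := Expr.acc (G.oracle X) G.base G.base k) hab
  omega

theorem image_side {l a b c d : ℕ} (hs : Separates l a b) (hd : d < 2 ^ G.L) :
    (G.side l (a / 2 ^ l) c d a ∪ G.side l (b / 2 ^ l) c d (2 ^ G.L - b)).image G.col =
      ({p | (a ≤ G.x p ∧ G.x p ≤ b) ∧ c ≤ G.y p ∧ G.y p ≤ d} : Finset (Fin n)).image G.col := by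
  have h1 : fold G.L l a = a := if_pos hs.sibling.1
  have h2 : fold G.L l b = 2 ^ G.L - b := if_neg (by have := hs.sibling; omega)
  have hx : ∀ p, a ≤ G.x p ∧ G.x p ≤ b ↔ (G.x p / 2 ^ l = a / 2 ^ l ∧ a ≤ G.prio l p) ∨
      (G.x p / 2 ^ l = b / 2 ^ l ∧ 2 ^ G.L - b ≤ G.prio l p) := fun p => by
    rw [hs.mem_Icc_iff (L := G.L) (G.x_lt p).le, h1, h2]; rfl
  ext χ
  simp only [mem_image, mem_union, mem_side, mem_filter, mem_univ, true_and]
  constructor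
  · rintro ⟨p, hp, rfl⟩
    have hy : p ∈ G.reps l (G.x p / 2 ^ l) c d := by
      rcases hp with hp | hp <;> rw [(G.mem_reps.1 hp.1).1] <;> exact hp.1
    refine ⟨p, ⟨(hx p).2 ?_, (G.mem_reps.1 hy).2.1.1, (G.mem_reps.1 hy).2.2.2.1⟩, rfl⟩
    rcases hp with hp | hp
    · exact .inl ⟨(G.mem_reps.1 hp.1).1, hp.2⟩
    · exact .inr ⟨(G.mem_reps.1 hp.1).1, hp.2⟩
  · rintro ⟨p, ⟨hp, hcp, hpd⟩, rfl⟩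
    obtain ⟨q, hq, hcol, hle, -⟩ := G.exists_rep (l := l) hcp hpd hd
    refine ⟨q, ?_, hcol⟩
    rcases (hx p).1 hp with ⟨h3, h4⟩ | ⟨h3, h4⟩
    · exact .inl ⟨h3 ▸ hq, h4.trans hle⟩
    · exact .inr ⟨h3 ▸ hq, h4.trans hle⟩

/-- The query counts the colors in the rectangle.  The coordinates of the points have to be odd, as the
sides of the rectangle are even. -/
theorem denote_queryE_eq {ra rb rc rd : ℕ} (hb : 2 * rb < 2 ^ G.L) (hd : 2 * rd < 2 ^ G.L)
    (hx : ∀ p, Odd (G.x p)) (hy : ∀ p, Odd (G.y p)) :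
    Expr.queryE.denote (G.oracle X) [ra, rb, rc, rd, G.base, 2 ^ G.L, X, G.L] =
      #(({p | (2 * ra ≤ G.x p ∧ G.x p ≤ 2 * rb) ∧ 2 * rc ≤ G.y p ∧ G.y p ≤ 2 * rd} :
        Finset (Fin n)).image G.col) := by
  have hB := G.base_eq
  rw [Expr.denote_queryE]
  dsimp only
  rcases Nat.lt_or_ge (2 * ra) (2 * rb) with hab | hab
  swap
  · rw [G.denote_lcaE_eq_zero hab, if_neg (by norm_num), eq_comm, card_eq_zero, image_eq_empty,
      filter_eq_empty_iff]
    rintro p - ⟨⟨h1, h2⟩, -⟩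
    obtain ⟨m, hm⟩ := hx p
    omega
  rcases Nat.lt_or_ge (2 * rc) (2 * rd) with hcd | hcd
  swap
  · rw [G.denote_lcaE_eq_zero hcd]
    simp only [nonpos_iff_eq_zero, one_ne_zero, if_false, ite_self]
    rw [eq_comm, card_eq_zero, image_eq_empty, filter_eq_empty_iff]
    rintro p - ⟨-, h1, h2⟩
    obtain ⟨m, hm⟩ := hy p
    omega
  obtain ⟨l, hl, hs⟩ := exists_separates hab hb
  obtain ⟨k, hk, hsk⟩ := exists_separates hcd hd
  rw [G.denote_lcaE_eq hl hs, G.denote_lcaE_eq hk hsk, if_pos Nat.one_le_two_pow,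
    if_pos Nat.one_le_two_pow,
    G.denote_nodeE_eq hl ((Nat.div_le_self _ _).trans_lt (hab.trans hb)) (hcd.trans hd) hd
      hs.sibling.2 ((Nat.div_le_self _ _).trans_lt hb) hs.sibling.1 hk hsk (by omega) (by omega),
    G.image_side hs hd]

end Query

/-! ### The size of the tables -/

theorem Cell.eq_of_mem_list {κ κ' : Cell} {p : Fin n} (hp : p ∈ G.list κ) (hp' : p ∈ G.list κ')
    (hl : κ.l = κ'.l) (hi : κ.i = κ'.i) (hu : κ.u % 2 = κ'.u % 2) (hj : κ.j = κ'.j)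
    (hv : κ.v % 2 = κ'.v % 2) : κ = κ' := by
  obtain ⟨l, g, i, u, j, v⟩ := κ
  obtain ⟨l', g', i', u', j', v'⟩ := κ'
  simp only at hl hi hu hj hv
  subst hl hi hj
  obtain ⟨h1, h2, h3⟩ := G.mem_list.1 hp
  obtain ⟨h1', h2', h3'⟩ := G.mem_list.1 hp'
  simp only at h1 h2 h3 h1' h2' h3'
  rw [h2.eq_of_mod_two (G.low_ordConnected _ _) h2' hu,
    h3.eq_of_mod_two (G.high_ordConnected _ _) h3' hv, ← h1, ← h1']

/-- A point is in at most four lists for every block and all levels. -/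
theorem sum_card_list_le : ∑ κ ∈ G.cells, #(G.list κ) ≤ 4 * n * G.L ^ 3 := by
  rw [← card_sigma]
  calc #(G.cells.sigma G.list)
      ≤ #((univ : Finset (Fin n)) ×ˢ range G.L ×ˢ range G.L ×ˢ range 2 ×ˢ range G.L ×ˢ range 2) := by
        refine card_le_card_of_injOn (fun t => (t.2, t.1.l, t.1.i, t.1.u % 2, t.1.j, t.1.v % 2)) ?_ ?_
        · rintro ⟨κ, p⟩ h
          simp only [coe_sigma, Set.mem_sigma_iff, mem_coe] at h
          obtain ⟨⟨hl, hi, hj⟩, -⟩ := G.mem_cells.1 h.1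
          simp [hl, hi, hj]
          omega
        · rintro ⟨κ, p⟩ h ⟨κ', p'⟩ h' heq
          simp only [coe_sigma, Set.mem_sigma_iff, mem_coe] at h h'
          simp only [Prod.mk.injEq] at heq
          obtain ⟨rfl, hl, hi, hu, hj, hv⟩ := heq
          rw [Cell.eq_of_mem_list G h.2 h'.2 hl hi hu hj hv]
    _ = 4 * n * G.L ^ 3 := by
        simp only [card_product, card_univ, Fintype.card_fin, card_range]; ring

/-- Two points determine the level at which they are in sibling blocks. -/
theorem Siblings.separates {κ κ' : Cell} (h : Siblings κ κ') {p q : Fin n} (hp : p ∈ G.list κ)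
    (hq : q ∈ G.list κ') : Separates κ.l (G.x p) (G.x q) := by
  obtain ⟨hl, h2, hg⟩ := h
  have h3 := (G.mem_list.1 hp).1
  have h4 := (G.mem_list.1 hq).1
  rw [← hl] at h4
  rw [Separates, div_two_pow_succ, div_two_pow_succ, h3, h4]
  omega

open scoped Classical in
theorem sum_card_mul_card_le :
    ∑ t ∈ G.cells ×ˢ G.cells with Siblings t.1 t.2, #(G.list t.1) * #(G.list t.2) ≤
      16 * n ^ 2 * G.L ^ 4 := by
  simp only [← card_product]
  rw [← card_sigma]
  calc _ ≤ #((univ : Finset (Fin n × Fin n)) ×ˢ (range G.L ×ˢ range 2 ×ˢ range G.L ×ˢ range 2) ×ˢ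
        (range G.L ×ˢ range 2 ×ˢ range G.L ×ˢ range 2)) := by
        refine card_le_card_of_injOn (fun t => (t.2, (t.1.1.i, t.1.1.u % 2, t.1.1.j, t.1.1.v % 2),
          (t.1.2.i, t.1.2.u % 2, t.1.2.j, t.1.2.v % 2))) ?_ ?_
        · rintro ⟨⟨κ, κ'⟩, p⟩ h
          simp only [coe_sigma, Set.mem_sigma_iff, mem_coe, mem_filter, mem_product] at h
          obtain ⟨⟨-, hi, hj⟩, -⟩ := G.mem_cells.1 h.1.1.1
          obtain ⟨⟨-, hi', hj'⟩, -⟩ := G.mem_cells.1 h.1.1.2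
          simp [hi, hj, hi', hj']
          omega
        · rintro ⟨⟨κ₁, κ₁'⟩, p, q⟩ h ⟨⟨κ₂, κ₂'⟩, p', q'⟩ h' heq
          simp only [coe_sigma, Set.mem_sigma_iff, mem_coe, mem_filter, mem_product] at h h'
          simp only [Prod.mk.injEq] at heq
          obtain ⟨⟨rfl, rfl⟩, ⟨hi, hu, hj, hv⟩, hi', hu', hj', hv'⟩ := heq
          have hl : κ₁.l = κ₂.l := (Siblings.separates G h.1.2 h.2.1 h.2.2).unique
            (Siblings.separates G h'.1.2 h'.2.1 h'.2.2)
          have hl' : κ₁'.l = κ₂'.l := h.1.2.1.symm.trans (hl.trans h'.1.2.1)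
          rw [Cell.eq_of_mem_list G h.2.1 h'.2.1 hl hi hu hj hv,
            Cell.eq_of_mem_list G h.2.2 h'.2.2 hl' hi' hu' hj' hv']
    _ = 16 * n ^ 2 * G.L ^ 4 := by
        simp only [card_product, card_univ, Fintype.card_prod, Fintype.card_fin, card_range]; ring

theorem card_matTable_le (X : ℕ) : X ^ 2 * #(G.matTable X) ≤ 16 * n ^ 2 * G.L ^ 4 := by
  classical
  refine le_trans ?_ G.sum_card_mul_card_le
  refine (Nat.mul_le_mul le_rfl card_biUnion_le).trans ?_
  rw [mul_sum]
  refine sum_le_sum fun t _ => ?_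
  refine (Nat.mul_le_mul le_rfl card_image_le).trans ?_
  rw [card_product, Nat.card_Icc, Nat.card_Icc, Nat.add_sub_cancel, Nat.add_sub_cancel]
  have h1 := Nat.div_mul_le_self #(G.list t.1) X
  have h2 := Nat.div_mul_le_self #(G.list t.2) X
  calc _ = (#(G.list t.1) / X * X) * (#(G.list t.2) / X * X) := by ring
    _ ≤ _ := Nat.mul_le_mul h1 h2

theorem card_colorTable_le : #G.colorTable ≤ 4 * n * G.L ^ 3 :=
  (card_biUnion_le.trans (sum_le_sum fun _ _ => card_image_le)).trans G.sum_card_list_le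

theorem card_posTable_le : #G.posTable ≤ 4 * n * G.L ^ 3 :=
  (card_biUnion_le.trans (sum_le_sum fun _ _ => card_image_le)).trans G.sum_card_list_le

theorem card_columnTable_le : #G.columnTable ≤ n * G.L ^ 2 := by
  refine card_image_le.trans (le_of_eq ?_)
  simp only [card_product, card_univ, Fintype.card_fin, card_range]; ring

theorem card_blockTable_le (tag : ℕ) {I : ℕ → Fin n → Set ℕ} (hI : ∀ l p, (I l p).OrdConnected) :
    #(G.blockTable tag I) ≤ 2 * n * G.L ^ 2 := by
  classical
  refine card_image_le.trans ?_
  calc _ ≤ #((univ : Finset (Fin n)) ×ˢ range G.L ×ˢ range G.L ×ˢ range 2) := by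
        refine card_le_card_of_injOn (fun t => (t.1, t.2.1, t.2.2.1, t.2.2.2 % 2)) ?_ ?_
        · rintro ⟨p, l, i, u⟩ h
          simp only [coe_filter, mem_product, mem_univ, true_and, mem_range, Set.mem_ofPred_eq] at h
          simp [h.1.1, h.1.2.1]
          omega
        · rintro ⟨p, l, i, u⟩ h ⟨p', l', i', u'⟩ h' heq
          simp only [coe_filter, mem_product, mem_univ, true_and, mem_range, Set.mem_ofPred_eq] at h h'
          simp only [Prod.mk.injEq] at heq
          obtain ⟨rfl, rfl, rfl, hu⟩ := heq
          rw [h.2.eq_of_mod_two (hI l p) h'.2 hu]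
    _ = 2 * n * G.L ^ 2 := by
        simp only [card_product, card_univ, Fintype.card_fin, card_range]; ring

theorem card_table_le (hn : 1 ≤ n) (X : ℕ) : #(G.table X) ≤ #(G.matTable X) + 14 * n * G.L ^ 3 := by
  classical
  have h3 := G.three_le
  have h1 : G.L ≤ n * G.L ^ 3 := by
    calc G.L = 1 * G.L ^ 1 := by ring
      _ ≤ n * G.L ^ 3 := Nat.mul_le_mul hn (Nat.pow_le_pow_right (by omega) (by norm_num))
  have h2 : n * G.L ^ 2 ≤ n * G.L ^ 3 :=
    Nat.mul_le_mul le_rfl (Nat.pow_le_pow_right (by omega) (by norm_num))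
  have e1 : #G.powTable ≤ G.L := card_image_le.trans (card_range _).le
  have e2 := G.card_colorTable_le
  have e3 := G.card_posTable_le
  have e4 := G.card_columnTable_le
  have e5 := G.card_blockTable_le 5 G.low_ordConnected
  have e6 := G.card_blockTable_le 6 G.high_ordConnected
  have u : ∀ s t : Finset Entry, #(s ∪ t) ≤ #s + #t := card_union_le
  have := u (G.powTable ∪ G.colorTable ∪ G.posTable ∪ G.matTable X ∪ G.columnTable ∪
    G.blockTable 5 G.low) (G.blockTable 6 G.high)
  have := u (G.powTable ∪ G.colorTable ∪ G.posTable ∪ G.matTable X ∪ G.columnTable)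
    (G.blockTable 5 G.low)
  have := u (G.powTable ∪ G.colorTable ∪ G.posTable ∪ G.matTable X) G.columnTable
  have := u (G.powTable ∪ G.colorTable ∪ G.posTable) (G.matTable X)
  have := u (G.powTable ∪ G.colorTable) G.posTable
  have := u G.powTable G.colorTable
  rw [table]
  nlinarith

theorem length_le_of_mem_table {X : ℕ} : ∀ e ∈ G.table X, e.1.length ≤ 15 := by
  intro e he
  rw [mem_table, mem_powTable, mem_colorTable, mem_posTable, mem_matTable, mem_columnTable,
    mem_blockTable, mem_blockTable] at he
  rcases he with ⟨i, hi, rfl⟩ | ⟨κ, hκ, p, hp, rfl⟩ | ⟨κ, hκ, p, hp, rfl⟩ |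
    ⟨κ, hκ, κ', hκ', -, m, m', -, hm, -, hm', rfl⟩ | ⟨p, l, hl, k, hk, rfl⟩ |
    ⟨p, l, hl, i, hi, u, hu, hc, rfl⟩ | ⟨p, l, hl, i, hi, u, hu, hc, rfl⟩ <;>
  simp [matKey, Cell.key]

theorem lt_of_mem_tableSet {X s : ℕ} (hs : s ∈ tableSet G.base (G.table X)) : s < G.base ^ 17 := by
  obtain ⟨⟨l, z, v⟩, he, rfl⟩ := mem_image.1 hs
  obtain ⟨⟨hl, -⟩, hz, hv⟩ := G.valid_table _ he
  have hlen := G.length_le_of_mem_table _ he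
  simp only at hl hz hv hlen
  have hB : 1 < G.base := by have := G.base_eq; have := G.eight_le; omega
  have h1 := (Nat.ofDigits_lt_base_pow_length hB hl).trans_le (Nat.pow_le_pow_right (by omega) hlen)
  rw [Entry.code]
  have h2 : Nat.ofDigits G.base l * G.base + z < G.base ^ 16 := by
    calc _ < (Nat.ofDigits G.base l + 1) * G.base := by linarith
      _ ≤ G.base ^ 15 * G.base := Nat.mul_le_mul h1 le_rfl
      _ = _ := by ring
  calc _ < (Nat.ofDigits G.base l * G.base + z + 1) * G.base := by linarith
    _ ≤ G.base ^ 16 * G.base := Nat.mul_le_mul h2 le_rfl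
    _ = _ := by ring

end Grid

/-! ### Rank space -/

section Rank

variable {n : ℕ} (f : Fin n → ℝ)

/-- The rank of an element by `f`, where ties are broken by the index. -/
noncomputable def rank (i : Fin n) : ℕ := #{j | f j < f i ∨ f j = f i ∧ j < i}

theorem rank_lt (i : Fin n) : rank f i < n := by
  have h : #{j | f j < f i ∨ f j = f i ∧ j < i} < #(univ : Finset (Fin n)) :=
    card_lt_card ((ssubset_iff_of_subset (subset_univ _)).2 ⟨i, mem_univ i, by simp⟩)
  simpa [rank] using h

theorem rank_injective : Function.Injective (rank f) := by
  have key : ∀ i j, f i < f j ∨ f i = f j ∧ i < j → rank f i < rank f j := by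
    intro i j hij
    refine card_lt_card ((ssubset_iff_of_subset fun k hk => ?_).2 ⟨i, by simpa using hij, by simp⟩)
    simp only [mem_filter, mem_univ, true_and] at hk ⊢
    rcases hij with hij | ⟨hij, h⟩ <;> rcases hk with hk | ⟨hk, h'⟩
    · exact .inl (hk.trans hij)
    · exact .inl (hk ▸ hij)
    · exact .inl (hij ▸ hk)
    · exact .inr ⟨hk.trans hij, h'.trans h⟩
  intro i j h
  by_contra hne
  rcases lt_trichotomy (f i) (f j) with hlt | heq | hlt
  · exact (key i j (.inl hlt)).ne h
  · rcases lt_or_gt_of_ne hne with hlt | hlt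
    · exact (key i j (.inr ⟨heq, hlt⟩)).ne h
    · exact (key j i (.inr ⟨heq.symm, hlt⟩)).ne h.symm
  · exact (key j i (.inl hlt)).ne h.symm

theorem card_lt_le_rank_iff (i : Fin n) (a : ℝ) : #{j | f j < a} ≤ rank f i ↔ a ≤ f i := by
  constructor
  · intro h
    by_contra! hlt
    refine absurd h (not_le.2 (card_lt_card ((ssubset_iff_of_subset fun k hk => ?_).2
      ⟨i, by simpa using hlt, by simp⟩)))
    simp only [mem_filter, mem_univ, true_and] at hk ⊢
    rcases hk with hk | hk
    · exact hk.trans hlt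
    · exact hk.1 ▸ hlt
  · intro h
    refine card_le_card fun k hk => ?_
    simp only [mem_filter, mem_univ, true_and] at hk ⊢
    exact .inl (hk.trans_le h)

theorem rank_lt_card_le_iff (i : Fin n) (b : ℝ) : rank f i < #{j | f j ≤ b} ↔ f i ≤ b := by
  constructor
  · intro h
    by_contra! hlt
    refine absurd h (not_lt.2 (card_le_card fun k hk => ?_))
    simp only [mem_filter, mem_univ, true_and] at hk ⊢
    exact .inl (hk.trans_lt hlt)
  · intro h
    refine card_lt_card ((ssubset_iff_of_subset fun k hk => ?_).2 ⟨i, by simpa using h, by simp⟩)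
    simp only [mem_filter, mem_univ, true_and] at hk ⊢
    rcases hk with hk | hk
    · exact hk.le.trans h
    · exact hk.1 ▸ h

end Rank

theorem two_mul_lt_two_pow {n : ℕ} : 2 * n < 2 ^ (Nat.log 2 n + 2) := by
  have h := Nat.lt_pow_succ_log_self (b := 2) (by norm_num) n
  rw [pow_succ]
  omega

/-- The colors of the points, replaced by small numbers. -/
noncomputable def smallColor {n : ℕ} (color : Fin n → ℕ) (p : Fin n) : ℕ :=
  numGe (univ.image color) id (color p)

/-- The input points in rank space.  All coordinates are odd. -/
noncomputable def toGrid {n : ℕ} (hn : 2 ≤ n) (P : Fin n → ℝ × ℝ) (color : Fin n → ℕ) : Grid n where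
  L := Nat.log 2 n + 2
  x p := 2 * rank (fun i => (P i).1) p + 1
  y p := 2 * rank (fun i => (P i).2) p + 1
  col := smallColor color
  x_inj p q h := rank_injective (fun i => (P i).1) (by simp only at h; omega)
  x_lt p := by
    have := rank_lt (fun i => (P i).1) p
    have := two_mul_lt_two_pow (n := n)
    omega
  y_pos p := by omega
  y_lt p := by
    have := rank_lt (fun i => (P i).2) p
    have := two_mul_lt_two_pow (n := n)
    omega
  col_lt p := by
    have h1 := numGe_le_card (s := univ.image color) (f := id) (color p)
    have h2 := card_image_le (s := (univ : Finset (Fin n))) (f := color)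
    have := two_mul_lt_two_pow (n := n)
    rw [card_univ, Fintype.card_fin] at h2
    rw [smallColor]
    omega
  n_le := by
    have := two_mul_lt_two_pow (n := n)
    omega
  three_le := by
    have := Nat.log_pos (b := 2) (by norm_num) hn
    omega

theorem card_image_smallColor {n : ℕ} (color : Fin n → ℕ) (F : Finset (Fin n)) :
    #(F.image (smallColor color)) = #(F.image color) := by
  have h : F.image (smallColor color) =
      (F.image color).image fun k => numGe (univ.image color) id k := by
    rw [image_image]; rfl
  rw [h, card_image_of_injOn]
  exact (numGe_injOn (f := id) (Set.injOn_id _)).mono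
    (coe_subset.2 (image_subset_image (subset_univ F)))

/-- On the ranks of the sides of a rectangle, the query gives the number of colors in it. -/
theorem denote_queryE_toGrid {n : ℕ} (hn : 2 ≤ n) (P : Fin n → ℝ × ℝ) (color : Fin n → ℕ) (X : ℕ)
    (a b c d : ℝ) : Expr.queryE.denote ((toGrid hn P color).oracle X)
      [#{i | (P i).1 < a}, #{i | (P i).1 ≤ b}, #{i | (P i).2 < c}, #{i | (P i).2 ≤ d},
        (toGrid hn P color).base, 2 ^ (toGrid hn P color).L, X, (toGrid hn P color).L] =
      colorCount P color a b c d := by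
  have hlt := two_mul_lt_two_pow (n := n)
  have hcard : ∀ s : Finset (Fin n), #s ≤ n := fun s => (card_le_univ s).trans (by simp)
  have hb := hcard {i | (P i).1 ≤ b}
  have hd := hcard {i | (P i).2 ≤ d}
  rw [Grid.denote_queryE_eq _ (show _ < 2 ^ (Nat.log 2 n + 2) by omega)
    (show _ < 2 ^ (Nat.log 2 n + 2) by omega) (fun p => ⟨_, rfl⟩) (fun p => ⟨_, rfl⟩)]
  rw [show (toGrid hn P color).col = smallColor color from rfl, card_image_smallColor, colorCount,
    ← Set.ncard_coe_finset, coe_image]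
  refine congrArg (fun s => (color '' s).ncard) (Set.ext fun p => ?_)
  have h1 := card_lt_le_rank_iff (fun i => (P i).1) p a
  have h2 := rank_lt_card_le_iff (fun i => (P i).1) p b
  have h3 := card_lt_le_rank_iff (fun i => (P i).2) p c
  have h4 := rank_lt_card_le_iff (fun i => (P i).2) p d
  rw [mem_coe, mem_filter]
  simp only [mem_univ, true_and, Set.mem_ofPred_eq, Set.mem_Icc, toGrid, ← h1, ← h2, ← h3, ← h4]
  omega

/-! ### The bounds -/

/-- The structure and the query, with the bounds in terms of the rounded logarithm. -/
theorem exists_structure : ∃ (w : ℕ) (query : Program 8), ∀ n X, 2 ≤ n → 1 ≤ X → X ≤ n →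
    ∀ (P : Fin n → ℝ × ℝ) (color : Fin n → ℕ), ∃ D : DataStructure 8, D.WellFormed (n ^ w) P ∧
      X ^ 2 * D.size ≤ 16 * n ^ 2 * (Nat.log 2 n + 2) ^ 4 +
        X ^ 2 * (14 * n * (Nat.log 2 n + 2) ^ 3 + 2 * n + 1) ∧
      ∀ a b c d : ℝ, ∃ (t : ℕ) (f : ℕ → Word), Exec (n ^ w) query (D.start a b c d) t ⟨f, D.heap, D.size⟩ ∧
        t ≤ 7250 * ((Nat.log 2 n + 3) ^ 5 + X * (Nat.log 2 n + 3) ^ 3) ∧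
        f 0 = .int (colorCount P color a b c d) := by
  -- The base is at most `n ^ 4`, and stored numbers have `17` digits: at most `15` in the key of an
  -- entry, the last digit and the value.
  obtain ⟨w, query, h⟩ := exists_program Expr.queryE 68
  refine ⟨w, query, fun n X hn hX hXn P color => ?_⟩
  set G := toGrid hn P color with hG
  have hL : G.L = Nat.log 2 n + 2 := rfl
  have hbase : G.base ≤ n ^ 4 := by
    have h1 := Nat.pow_log_le_self 2 (show n ≠ 0 by omega)
    have h2 : 2 ^ 3 ≤ n ^ 3 := Nat.pow_le_pow_left hn 3
    calc G.base = 2 ^ Nat.log 2 n * 2 ^ 3 := by rw [Grid.base, hL]; ring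
      _ ≤ n * n ^ 3 := Nat.mul_le_mul h1 h2
      _ = n ^ 4 := by ring
  have hpow : ∀ {k}, k ≤ n ^ 4 → k ≤ n ^ 68 := fun hk =>
    hk.trans (Nat.pow_le_pow_right (by omega) (by norm_num))
  have hB := G.base_eq
  have hLB : G.L < 2 ^ G.L := Nat.lt_two_pow_self
  have hn4 : n ≤ n ^ 4 := Nat.le_self_pow (by norm_num) n
  have hS : ∀ s ∈ tableSet G.base (G.table X), s < G.base ^ 17 := fun s => G.lt_of_mem_tableSet
  have hcard : #(tableSet G.base (G.table X)) < 2 ^ (17 * (G.L + 1) + 1) := by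
    have h1 : #(tableSet G.base (G.table X)) ≤ G.base ^ 17 := by
      rw [← card_range (G.base ^ 17)]
      exact card_le_card fun s hs => mem_range.2 (hS s hs)
    have h2 : G.base ^ 17 = 2 ^ (17 * (G.L + 1)) := by rw [Grid.base, ← pow_mul]; ring_nf
    have h3 : 0 < 2 ^ (17 * (G.L + 1)) := by positivity
    rw [pow_succ]
    omega
  obtain ⟨D, hwf, hsize, hquery⟩ := h n hn P (tableSet G.base (G.table X)) (17 * (G.L + 1) + 1) G.base
    (2 ^ G.L) X G.L (fun s hs => (hS s hs).le.trans ((Nat.pow_le_pow_left hbase 17).trans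
      (by rw [← pow_mul]))) hcard (hpow hbase) (hpow (by omega)) (hpow (hXn.trans hn4))
    (hpow (by omega))
  refine ⟨D, hwf, ?_, fun a b c d => ?_⟩
  · have h1 : #(tableSet G.base (G.table X)) ≤ #(G.table X) := card_image_le
    have h2 := G.card_table_le (by omega) X
    have h3 := G.card_matTable_le X
    rw [hL] at h2 h3
    calc X ^ 2 * D.size ≤ X ^ 2 * (#(G.matTable X) +
          (14 * n * (Nat.log 2 n + 2) ^ 3 + 2 * n + 1)) := Nat.mul_le_mul le_rfl (by omega)
      _ ≤ _ := by rw [mul_add]; exact Nat.add_le_add_right h3 _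
  · obtain ⟨f, ⟨t, ht, hexec⟩, hf⟩ := hquery a b c d
    refine ⟨t, f, hexec, ht.trans ?_, by
      rw [hf]; exact congrArg _ (denote_queryE_toGrid hn P color X a b c d)⟩
    refine (Nat.add_le_add_left (Expr.cost_queryE_le _ _ _ _ _ _ _ _ _ _ hX) _).trans ?_
    rw [hL]
    generalize Nat.log 2 n = k
    have h1 : 6 * (17 * (k + 2 + 1) + 1) + 8 + 110 ≤ 144 * (k + 3) := by omega
    have h2 : 24 * (k + 1) + 36 ≤ 50 * (k + 3) ^ 5 := by
      have : k + 3 ≤ (k + 3) ^ 5 := Nat.le_self_pow (by norm_num) _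
      omega
    calc _ ≤ 50 * (k + 3) ^ 5 + 50 * (144 * (k + 3)) * ((k + 3) ^ 4 + X * (k + 3) ^ 2) :=
          Nat.add_le_add h2 (Nat.mul_le_mul (Nat.mul_le_mul le_rfl h1) le_rfl)
      _ ≤ 50 * ((k + 3) ^ 5 + X * (k + 3) ^ 3) +
          50 * (144 * (k + 3)) * ((k + 3) ^ 4 + X * (k + 3) ^ 2) := by
          gcongr; exact Nat.le_add_right _ _
      _ = _ := by ring

theorem AnswersWithin.mono {K n W : ℕ} {query : Program K} {D : DataStructure K} {P : Fin n → ℝ × ℝ}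
    {color : Fin n → ℕ} {S S' T T' : ℝ} (h : AnswersWithin W query D P color S T) (hS : S ≤ S')
    (hT : T ≤ T') : AnswersWithin W query D P color S' T' := by
  obtain ⟨hwf, hs, hq⟩ := h
  refine ⟨hwf, hs.trans hS, fun a b c d => ?_⟩
  obtain ⟨t, σ, h1, h2, h3, h4⟩ := hq a b c d
  exact ⟨t, σ, h1, h2.trans hT, h3.trans hS, h4⟩

theorem one_le_logb {n : ℕ} (hn : 2 ≤ n) : 1 ≤ Real.logb 2 n := by
  rw [Real.le_logb_iff_rpow_le (by norm_num) (by positivity)]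
  simpa using (by exact_mod_cast hn : (2 : ℝ) ≤ n)

theorem natLog_le_logb {n : ℕ} : (Nat.log 2 n : ℝ) ≤ Real.logb 2 n := by
  simpa using Real.natLog_le_logb n 2

/-- The bounds in terms of the real logarithm; both `Nat.log 2 n` and `1` are at most `Real.logb 2 n`. -/
theorem exists_answersWithin : ∃ (w : ℕ) (query : Program 8), ∀ n X, 2 ≤ n → 1 ≤ X → X ≤ n →
    ∀ (P : Fin n → ℝ × ℝ) (color : Fin n → ℕ), ∃ D : DataStructure 8,
      AnswersWithin (n ^ w) query D P color
        (10000000 * (((n : ℝ) / X) ^ 2 * Real.logb 2 n ^ 4 + n * Real.logb 2 n ^ 3))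
        (10000000 * (Real.logb 2 n ^ 5 + X * Real.logb 2 n ^ 3)) := by
  obtain ⟨w, query, h⟩ := exists_structure
  refine ⟨w, query, fun n X hn hX hXn P color => ?_⟩
  obtain ⟨D, hwf, hsize, hquery⟩ := h n X hn hX hXn P color
  set g := Real.logb 2 n with hg
  have hg1 : 1 ≤ g := one_le_logb hn
  have hk : (Nat.log 2 n : ℝ) ≤ g := natLog_le_logb
  have hX0 : (0 : ℝ) < X := by exact_mod_cast hX
  have hn0 : (2 : ℝ) ≤ n := by exact_mod_cast hn
  have hS : ((D.size * 8 : ℕ) : ℝ) ≤ 10000000 * (((n : ℝ) / X) ^ 2 * g ^ 4 + n * g ^ 3) := by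
    have h1 : (X : ℝ) ^ 2 * D.size ≤ 16 * n ^ 2 * (Nat.log 2 n + 2) ^ 4 +
        X ^ 2 * (14 * n * (Nat.log 2 n + 2) ^ 3 + 2 * n + 1) := by exact_mod_cast hsize
    have h2 : (Nat.log 2 n + 2 : ℝ) ≤ 3 * g := by linarith
    have h3 : (1 : ℝ) ≤ g ^ 3 := one_le_pow₀ hg1
    have h4 : (14 * n * (Nat.log 2 n + 2) ^ 3 + 2 * n + 1 : ℝ) ≤ 400 * (n * g ^ 3) := by
      have : (14 * n * (Nat.log 2 n + 2) ^ 3 : ℝ) ≤ 14 * n * (3 * g) ^ 3 := by gcongr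
      nlinarith
    have h5 : (D.size : ℝ) ≤ 1296 * (((n : ℝ) / X) ^ 2 * g ^ 4) + 400 * (n * g ^ 3) := by
      refine le_of_mul_le_mul_left (h1.trans ?_) (by positivity : (0 : ℝ) < (X : ℝ) ^ 2)
      have h6 : (X : ℝ) ^ 2 * (1296 * (((n : ℝ) / X) ^ 2 * g ^ 4) + 400 * (n * g ^ 3)) =
          16 * n ^ 2 * (3 * g) ^ 4 + X ^ 2 * (400 * (n * g ^ 3)) := by
        field_simp
        ring
      rw [h6]
      gcongr
    have h7 : 0 ≤ ((n : ℝ) / X) ^ 2 * g ^ 4 := by positivity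
    have h8 : 0 ≤ (n : ℝ) * g ^ 3 := by positivity
    push_cast
    linarith
  refine ⟨D, hwf, hS, fun a b c d => ?_⟩
  obtain ⟨t, f, hexec, ht, hf⟩ := hquery a b c d
  refine ⟨t, _, hexec, ?_, hS, fun _ _ => rfl, hf⟩
  have h1 : (t : ℝ) ≤ 7250 * ((Nat.log 2 n + 3) ^ 5 + X * (Nat.log 2 n + 3) ^ 3) := by
    exact_mod_cast ht
  have h2 : (Nat.log 2 n + 3 : ℝ) ≤ 4 * g := by linarith
  have h3 : (0 : ℝ) ≤ X * g ^ 3 := by positivity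
  have h4 : (0 : ℝ) ≤ g ^ 5 := by positivity
  calc (t : ℝ) ≤ 7250 * ((4 * g) ^ 5 + X * (4 * g) ^ 3) := h1.trans (by gcongr)
    _ = 7424000 * g ^ 5 + 464000 * (X * g ^ 3) := by ring
    _ ≤ _ := by linarith

theorem logb_pow_three_le {n : ℕ} (hn : 2 ≤ n) : Real.logb 2 n ^ 3 ≤ 125 * n := by
  have hn0 : (0 : ℝ) ≤ n := by positivity
  -- `lg x ≤ 3 x ^ (1 / 3) / log 2`, and `log 2 > 3 / 5`.
  have h1 : Real.logb 2 n ≤ 5 * (n : ℝ) ^ (1 / 3 : ℝ) := by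
    have h2 := Real.log_le_rpow_div hn0 (show (0 : ℝ) < 1 / 3 by norm_num)
    have h3 := Real.log_two_gt_d9
    have h4 : 0 ≤ (n : ℝ) ^ (1 / 3 : ℝ) := by positivity
    rw [Real.logb, div_le_iff₀ (by linarith)]
    nlinarith
  have h0 : 0 ≤ Real.logb 2 n := zero_le_one.trans (one_le_logb hn)
  calc Real.logb 2 n ^ 3 ≤ (5 * (n : ℝ) ^ (1 / 3 : ℝ)) ^ 3 := by gcongr
    _ = 125 * ((n : ℝ) ^ (1 / 3 : ℝ)) ^ 3 := by ring
    _ = 125 * n := by rw [← Real.rpow_natCast, ← Real.rpow_mul hn0]; norm_num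

/-- The bounds for the choice of `X` that balances them. -/
theorem balance {n X : ℕ} (hn : 2 ≤ n) (hX : X = ⌈√((n : ℝ) * Real.logb 2 n)⌉₊) :
    1 ≤ X ∧ X ≤ n ∧ ((n : ℝ) / X) ^ 2 * Real.logb 2 n ^ 4 ≤ n * Real.logb 2 n ^ 3 ∧
      Real.logb 2 n ^ 5 + X * Real.logb 2 n ^ 3 ≤
        14 * (√(n : ℝ) * Real.logb 2 n ^ (7 / 2 : ℝ)) := by
  have hg1 := one_le_logb hn
  have hg3 := logb_pow_three_le hn
  have hgn : Real.logb 2 n ≤ n := by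
    rw [Real.logb_le_iff_le_rpow (by norm_num) (by positivity), Real.rpow_natCast]
    exact_mod_cast Nat.lt_two_pow_self.le
  have hn0 : (2 : ℝ) ≤ n := by exact_mod_cast hn
  set g := Real.logb 2 n
  have hg0 : 0 ≤ g := by linarith
  have hs : 1 ≤ √((n : ℝ) * g) := by
    rw [Real.one_le_sqrt]; nlinarith
  have hXle : √((n : ℝ) * g) ≤ X := hX ▸ Nat.le_ceil _
  have hXlt : (X : ℝ) < √((n : ℝ) * g) + 1 := hX ▸ Nat.ceil_lt_add_one (by positivity)
  have hX0 : (0 : ℝ) < X := by linarith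
  refine ⟨by exact_mod_cast hX0, ?_, ?_, ?_⟩
  · rw [hX, Nat.ceil_le, Real.sqrt_le_left (by positivity)]
    nlinarith
  · have h1 : (n : ℝ) * g ≤ X ^ 2 := by
      rw [← Real.sqrt_le_left hX0.le]; exact hXle
    rw [div_pow, div_mul_eq_mul_div, div_le_iff₀ (by positivity)]
    calc (n : ℝ) ^ 2 * g ^ 4 = n * g ^ 3 * (n * g) := by ring
      _ ≤ _ := by gcongr
  · have h1 : g ^ (7 / 2 : ℝ) = g ^ 3 * √g := by
      rw [Real.sqrt_eq_rpow, ← Real.rpow_natCast g 3, ← Real.rpow_add (by linarith)]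
      norm_num
    have h2 : g ^ 2 ≤ 12 * (√(n : ℝ) * √g) := by
      rw [← Real.sqrt_mul (by positivity), ← Real.sqrt_sq (by positivity : 0 ≤ g ^ 2),
        show (12 : ℝ) = √144 by rw [show (144 : ℝ) = 12 ^ 2 by norm_num]; simp,
        ← Real.sqrt_mul (by norm_num)]
      refine Real.sqrt_le_sqrt ?_
      calc (g ^ 2) ^ 2 = g ^ 3 * g := by ring
        _ ≤ 125 * n * g := by gcongr
        _ ≤ _ := by nlinarith
    have h3 : (X : ℝ) ≤ 2 * (√(n : ℝ) * √g) := by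
      rw [← Real.sqrt_mul (by positivity)]; linarith
    rw [h1]
    calc g ^ 5 + X * g ^ 3 = (g ^ 2 + X) * g ^ 3 := by ring
      _ ≤ (12 * (√(n : ℝ) * √g) + 2 * (√(n : ℝ) * √g)) * g ^ 3 := by gcongr
      _ = _ := by ring

end PointerMachine

theorem mainTheorem4 :
    ∃ (K w : ℕ) (query : PointerMachine.Program K)
      (build : (n X : ℕ) → (Fin n → ℝ × ℝ) → (Fin n → ℕ) → PointerMachine.DataStructure K)
      (A : ℝ), 0 < A ∧
      (∀ n X : ℕ, 2 ≤ n → 1 ≤ X → X ≤ n →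
        ∀ (P : Fin n → ℝ × ℝ) (color : Fin n → ℕ),
          PointerMachine.AnswersWithin (n ^ w) query (build n X P color) P color
            (A * (((n : ℝ) / X) ^ 2 * Real.logb 2 n ^ 4 + n * Real.logb 2 n ^ 3))
            (A * (Real.logb 2 n ^ 5 + X * Real.logb 2 n ^ 3))) ∧
      (∀ n X : ℕ, 2 ≤ n → X = ⌈√((n : ℝ) * Real.logb 2 n)⌉₊ →
        1 ≤ X ∧ X ≤ n ∧
        ∀ (P : Fin n → ℝ × ℝ) (color : Fin n → ℕ),
          PointerMachine.AnswersWithin (n ^ w) query (build n X P color) P color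
            (A * (n * Real.logb 2 n ^ 3))
            (A * (√(n : ℝ) * Real.logb 2 n ^ (7 / 2 : ℝ)))) := by
  have : Nonempty (PointerMachine.DataStructure 8) := ⟨⟨0, 0, fun _ _ => .nil⟩⟩
  obtain ⟨w, query, h⟩ := PointerMachine.exists_answersWithin
  choose! D hD using h
  have hpos : ∀ n : ℕ, 2 ≤ n → 0 ≤ Real.logb 2 n := fun n hn =>
    zero_le_one.trans (PointerMachine.one_le_logb hn)
  -- The constant is `14`, from `balance`, times the one of `exists_answersWithin`.
  refine ⟨8, w, query, D, 140000000, by norm_num, fun n X hn hX hXn P color => ?_,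
    fun n X hn hX => ?_⟩
  · have := hpos n hn
    exact (hD n X hn hX hXn P color).mono (by gcongr; norm_num) (by gcongr; norm_num)
  · obtain ⟨h1, h2, h3, h4⟩ := PointerMachine.balance hn hX
    refine ⟨h1, h2, fun P color => (hD n X hn h1 h2 P color).mono ?_ ?_⟩
    · have := hpos n hn
      have : 0 ≤ (n : ℝ) * Real.logb 2 n ^ 3 := by positivity
      linarith
    · linarith
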